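/- **Theorem 3.5.** *Setting.* Let $(X,d)$ be a compact metric space and let $\theta>0$ be such that any two disjoint compact subsets of $X$ are separated by a $\theta$-Hölder function $X\to[0,1]$ (equal to $0$ on one set and to $1$ on the other). For a homeomorphism $T\colon X\to X$ and $\epsilon>0$ put $$W^u_\epsilon(x)=\{y: d(T^{-n}y,T^{-n}x)\le\epsilon\ \forall n\ge0\},\qquad W^u(x)=\{y: d(T^{-n}y,T^{-n}x)\to0 \text{ as } n\to+\infty\},$$ and define $W^s_\epsilon(x)$, $W^s(x)$ in the same way with $T^n$ in place of $T^{-n}$. $T$ is *hyperbolic* if: $T$ and $T^{-1}$ are Lipschitz; there are $\epsilon_0>0$ and continuous functions $\lambda_u,\lambda_s\colon X\to(0,\infty)$ with $d(T^{-1}x',T^{-1}x'')\le e^{-\lambda_u(x)}d(x',x'')$ for $x',x''\in W^u_{\epsilon_0}(x)$ and $d(Tx',Tx'')\le e^{-\lambda_s(x)}d(x',x'')$ for $x',x''\in W^s_{\epsilon_0}(x)$; and there are $\epsilon_1\in(0,\epsilon_0)$ and $C>0$ such that whenever $d(x,y)\le2\epsilon_1$ the set $W^u_{\epsilon_0}(x)\cap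 W^s_{\epsilon_0}(y)$ is a single point $[x,y]$, which depends continuously on $(x,y)$ and satisfies $\max\{d([x,y],x),d([x,y],y)\}\le C\,d(x,y)$. $T$ is *transitive* if for all nonempty open $U,V\subseteq X$ there is $n\ge0$ with $T^n(U)\cap V\ne\emptyset$. Let $\mathbb E$ be a $\theta$-Hölder real vector bundle of rank $d$ over $X$, i.e. it has finitely many local trivializations $h_i(x)\colon\mathbb R^d\to\mathbb E_x$ ($x\in U_i$) over open sets covering $X$, with $\theta$-Hölder coordinate changes $h_j(x)^{-1}h_i(x)$. A *$\theta$-Hölder automorphism* $\Phi$ of $\mathbb E$ covering $T$ is a family of linear isomorphisms $\Phi_x\colon\mathbb E_x\to\mathbb E_{Tx}$ such that all the maps $x\mapsto h_j(Tx)^{-1}\Phi_xh_i(x)$, on $U_i\cap T^{-1}U_j$, are $\theta$-Hölder; $\Phi^n_x=\Phi_{T^{n-1}x}\circ\dots\circ\Phi_x$. *Transport maps* are linear maps $I_{y\gets x}\colon\mathbb E_x\to\mathbb E_y$ ($x,y\in X$) with $I_{x\gets x}=\mathrm{id}$ for which all $(x,y)\mapsto h_j(y)^{-1}I_{y\gets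 x}h_i(x)$ are $\theta$-Hölder on $U_i\times U_j$. A *Riemannian norm* is a continuous function on $\mathbb E$ whose restriction to each fiber is the norm of an inner product. *Bunching.* For $\eta_u,\eta_s\in(0,\theta]$, $\Phi$ is *$(\eta_u,\eta_s)$-bunched* if for some Riemannian norm $$\log\big(\|\Phi_x\|\,\|\Phi_x^{-1}\|\big)<\min\{\eta_u\lambda_u(x),\eta_s\lambda_s(x)\}\qquad\text{for all }x\in X,$$ and *fiber-bunched* if it is $(\theta,\theta)$-bunched. Let $\Lambda_u\colon X\to(0,\infty)$ be continuous such that for some $\epsilon\in(0,\epsilon_0)$, all $x$ and all $x',x''\in W^u_\epsilon(x)$: $Tx',Tx''\in W^u_{\epsilon_0}(Tx)$ and $d(Tx',Tx'')\le e^{\Lambda_u(x)}d(x',x'')$. Fix a constant $\eta_0\in(0,\theta]$, depending only on the base dynamics and $\theta$, with $$\eta_0\le\inf_X\frac{\theta\lambda_s}{\lambda_s+\lambda_u+\Lambda_u}$$ (such $\Lambda_u$ and $\eta_0$ always exist). $\Phi$ is *strongly bunched* if either $d\le2$ and $\Phi$ is fiber-bunched, or $\Phi$ is $(\eta_0,\theta)$-bunched.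 *Irreducibility.* A family of $p$-dimensional subspaces $\mathbb F_x\subseteq\mathbb E_x$ is a *$\theta$-Hölder subbundle* if $\mathrm d(\mathbb F_y,I_{y\gets x}\mathbb F_x)\le C\,d(x,y)^\theta$ for all sufficiently close $x,y$, where $I$ are transport maps, and $\mathrm d(V_1,V_2)=\inf\|F_1-F_2\|$ over linear isomorphisms $F_i\colon\mathbb R^p\to V_i$ with $\|F_i^{-1}\|\le1$, with respect to a Riemannian norm (the choices of $I$ and of the norm do not matter). $\Phi$ is *irreducible* if there is no $\theta$-Hölder subbundle $\mathbb F$ of dimension $0<p<d$ with $\Phi_x(\mathbb F_x)=\mathbb F_{Tx}$ for all $x$. *Holonomies.* For $\star\in\{u,s\}$, the unstable ($\star=u$) and stable ($\star=s$) *holonomies* of $\Phi$ are the linear maps $H^\star_{y\gets x}\colon\mathbb E_x\to\mathbb E_y$, $y\in W^\star(x)$, such that $H^\star_{x\gets x}=\mathrm{id}$; $H^\star_{z\gets y}H^\star_{y\gets x}=H^\star_{z\gets x}$; $\Phi_yH^\star_{y\gets x}=H^\star_{Ty\gets Tx}\Phi_x$; $\|H^\star_{y\gets x}-I_{y\gets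 x}\|\le C\,d(x,y)^\theta$ for $y\in W^\star_{\epsilon_0}(x)$, for some constant $C$; and $(u,y)\mapsto H^\star_{y\gets x}(u)$ is continuous on $\{(u,y): u\in\mathbb E_x,\ y\in W^\star_{\epsilon_0}(x)\}$. *Statement.* Let $T$ be a transitive hyperbolic homeomorphism and let $\Phi$ be a strongly bunched irreducible $\theta$-Hölder automorphism covering $T$. Then $\Phi$ is *spannable*: the unstable and stable holonomies $H^u$, $H^s$ exist, and for all $x,y\in X$ and all nonzero $u\in\mathbb E_x$ there are points $x_1,\dots,x_d\in W^u(x)$ and integers $n_1,\dots,n_d\ge0$ such that the points $y_i=T^{n_i}x_i$ all belong to $W^s(y)$ and the vectors $$v_i=H^s_{y\gets y_i}\circ\Phi^{n_i}_{x_i}\circ H^u_{x_i\gets x}(u),\qquad i=1,\dots,d,$$ form a basis of $\mathbb E_y$. -/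

import Mathlib

open Set Filter Topology Bundle
open scoped NNReal

noncomputable section

namespace HolderCocycle

/-! ### Dynamics on the base -/

section Base

variable {X : Type*} [MetricSpace X]

/-- The algebra of `θ`-Hölder functions on `X` is normal: disjoint compact sets are separated by a
`θ`-Hölder function with values in `[0,1]`. -/
def HolderNormal (X : Type*) [MetricSpace X] (θ : ℝ≥0) : Prop :=
  ∀ K₀ K₁ : Set X, IsCompact K₀ → IsCompact K₁ → Disjoint K₀ K₁ →
    ∃ f : X → ℝ, (∃ C : ℝ≥0, HolderWith C θ f) ∧ (∀ x, f x ∈ Icc (0 : ℝ) 1) ∧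
      (∀ x ∈ K₀, f x = 0) ∧ (∀ x ∈ K₁, f x = 1)

/-- The local unstable set `W^u_ε(x)`. -/
def localUnstable (T : X ≃ₜ X) (ε : ℝ) (x : X) : Set X :=
  {y | ∀ n : ℕ, dist (T.symm^[n] y) (T.symm^[n] x) ≤ ε}

/-- The local stable set `W^s_ε(x)`. -/
def localStable (T : X ≃ₜ X) (ε : ℝ) (x : X) : Set X :=
  {y | ∀ n : ℕ, dist (T^[n] y) (T^[n] x) ≤ ε}

/-- The unstable set `W^u(x)`. -/
def unstableSet (T : X ≃ₜ X) (x : X) : Set X :=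
  {y | Tendsto (fun n : ℕ => dist (T.symm^[n] y) (T.symm^[n] x)) atTop (𝓝 0)}

/-- The stable set `W^s(x)`. -/
def stableSet (T : X ≃ₜ X) (x : X) : Set X :=
  {y | Tendsto (fun n : ℕ => dist (T^[n] y) (T^[n] x)) atTop (𝓝 0)}

/-- `T` is a hyperbolic homeomorphism, with size `ε₀` of the local stable and unstable sets, and
hyperbolicity exponents `lu` (unstable) and `ls` (stable). -/
structure IsHyperbolic (T : X ≃ₜ X) (ε₀ : ℝ) (lu ls : X → ℝ) : Prop where
  lipschitz : ∃ K : ℝ≥0, LipschitzWith K T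
  lipschitz_symm : ∃ K : ℝ≥0, LipschitzWith K T.symm
  eps_pos : 0 < ε₀
  continuous_lu : Continuous lu
  continuous_ls : Continuous ls
  lu_pos : ∀ x, 0 < lu x
  ls_pos : ∀ x, 0 < ls x
  contract_unstable : ∀ x, ∀ x' ∈ localUnstable T ε₀ x, ∀ x'' ∈ localUnstable T ε₀ x,
    dist (T.symm x') (T.symm x'') ≤ Real.exp (-lu x) * dist x' x''
  contract_stable : ∀ y, ∀ y' ∈ localStable T ε₀ y, ∀ y'' ∈ localStable T ε₀ y,
    dist (T y') (T y'') ≤ Real.exp (-ls y) * dist y' y''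
  /-- local product structure: existence, uniqueness and continuity of the bracket, and the
  estimate on its distance to the two points -/
  bracket : ∃ ε₁ : ℝ, 0 < ε₁ ∧ ε₁ < ε₀ ∧ ∃ br : X → X → X,
    (∀ x y, dist x y ≤ 2 * ε₁ → localUnstable T ε₀ x ∩ localStable T ε₀ y = {br x y}) ∧
    ContinuousOn (fun p : X × X => br p.1 p.2) {p | dist p.1 p.2 ≤ 2 * ε₁} ∧
    ∃ C : ℝ, 0 < C ∧ ∀ x y, dist x y ≤ 2 * ε₁ →
      max (dist (br x y) x) (dist (br x y) y) ≤ C * dist x y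

/-- Topological transitivity of `T`. -/
def IsTransitive (T : X ≃ₜ X) : Prop :=
  ∀ U V : Set X, IsOpen U → IsOpen V → U.Nonempty → V.Nonempty →
    ∃ n : ℕ, (T^[n] '' U ∩ V).Nonempty

/-- `Lu` is a continuous positive upper bound for the rate at which `T` expands small local unstable
sets. -/
def IsExpansionBound (T : X ≃ₜ X) (ε₀ : ℝ) (Lu : X → ℝ) : Prop :=
  Continuous Lu ∧ (∀ x, 0 < Lu x) ∧ ∃ ε₁ : ℝ, 0 < ε₁ ∧ ε₁ < ε₀ ∧
    ∀ x, ∀ x' ∈ localUnstable T ε₁ x, ∀ x'' ∈ localUnstable T ε₁ x,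
      T x' ∈ localUnstable T ε₀ (T x) ∧ T x'' ∈ localUnstable T ε₀ (T x) ∧
      dist (T x') (T x'') ≤ Real.exp (Lu x) * dist x' x''

/-- `η₀ ∈ (0, θ]` is an admissible exponent for strong bunching:
`η₀ ≤ inf_X θ ls / (ls + lu + Lu)` for some expansion bound `Lu` as above. It depends on the base
dynamics and on `θ` only. -/
def IsStrongBunchingExponent (T : X ≃ₜ X) (ε₀ : ℝ) (lu ls : X → ℝ) (θ : ℝ≥0) (η₀ : ℝ) : Prop :=
  0 < η₀ ∧ η₀ ≤ θ ∧ ∃ Lu : X → ℝ, IsExpansionBound T ε₀ Lu ∧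
    ∀ x, η₀ ≤ θ * ls x / (ls x + lu x + Lu x)

/-- Admissible exponents for strong bunching exist. -/
theorem exists_isStrongBunchingExponent [CompactSpace X] (T : X ≃ₜ X) (ε₀ : ℝ) (lu ls : X → ℝ)
    (hT : IsHyperbolic T ε₀ lu ls) (θ : ℝ≥0) (hθ : 0 < θ) :
    ∃ η₀, IsStrongBunchingExponent T ε₀ lu ls θ η₀ := by
  obtain ⟨K, hK⟩ := hT.lipschitz
  have hε := hT.eps_pos
  set M : ℝ := K + 2 with hM
  have hM2 : 2 ≤ M := by have := K.coe_nonneg; linarith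
  have hlip : ∀ a b, dist (T a) (T b) ≤ M * dist a b := fun a b =>
    (hK.dist_le_mul a b).trans (by
      have := dist_nonneg (x := a) (y := b)
      nlinarith)
  have hlog : 0 < Real.log M := Real.log_pos (by linarith)
  have key : ∀ x, ∀ z ∈ localUnstable T (ε₀ / M) x, T z ∈ localUnstable T ε₀ (T x) := by
    intro x z hz n
    cases n with
    | zero =>
      refine (hlip z x).trans ?_
      have h0 : dist z x ≤ ε₀ / M := hz 0
      calc M * dist z x ≤ M * (ε₀ / M) := by gcongr
        _ = ε₀ := by field_simp
    | succ k =>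
      simp only [Function.iterate_succ_apply, Homeomorph.symm_apply_apply]
      exact (hz k).trans (div_le_self hε.le (by linarith))
  have hLu : IsExpansionBound T ε₀ (fun _ => Real.log M) := by
    refine ⟨continuous_const, fun _ => hlog, ε₀ / M, by positivity,
      div_lt_self hε (by linarith), fun x x' h' x'' h'' => ⟨key x x' h', key x x'' h'', ?_⟩⟩
    rw [Real.exp_log (by linarith)]
    exact hlip _ _
  have hpos : ∀ x, 0 < θ * ls x / (ls x + lu x + Real.log M) := fun x => by
    have h1 := hT.ls_pos x
    have h2 := hT.lu_pos x
    have h3 : (0 : ℝ) < θ := hθ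
    positivity
  have hcont : Continuous fun x => θ * ls x / (ls x + lu x + Real.log M) := by
    have h1 := hT.continuous_ls
    have h2 := hT.continuous_lu
    refine Continuous.div (by fun_prop) (by fun_prop) fun x => ?_
    have h1 := hT.ls_pos x
    have h2 := hT.lu_pos x
    positivity
  have h3 : (0 : ℝ) < θ := hθ
  rcases isEmpty_or_nonempty X with hX | hX
  · exact ⟨θ, h3, le_rfl, _, hLu, fun x => (hX.false x).elim⟩
  · obtain ⟨x₀, -, hx₀⟩ := isCompact_univ.exists_isMinOn univ_nonempty hcont.continuousOn
    exact ⟨min θ (θ * ls x₀ / (ls x₀ + lu x₀ + Real.log M)), lt_min h3 (hpos x₀), min_le_left _ _,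
      _, hLu, fun x => (min_le_right _ _).trans (hx₀ (mem_univ x))⟩

end Base

/-! ### Hölder vector bundles -/

/-- The model fiber. -/
abbrev Model (d : ℕ) : Type := EuclideanSpace ℝ (Fin d)

section Fibers

variable {X : Type*} [TopologicalSpace X] {d : ℕ} {E : X → Type*}
  [TopologicalSpace (TotalSpace (Model d) E)] [∀ x, AddCommGroup (E x)] [∀ x, Module ℝ (E x)]

/-- The matrix of a linear map `L : E_x → E_y` in the coordinates `e` around `x` and `e'` around `y`
(meaningful when `x` and `y` lie in the respective base sets). -/
def coordRep (e e' : Trivialization (Model d) (π (Model d) E)) [e.IsLinear ℝ] [e'.IsLinear ℝ]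
    {x y : X} (L : E x →ₗ[ℝ] E y) : Model d →L[ℝ] Model d :=
  LinearMap.toContinuousLinearMap (e'.linearMapAt ℝ y ∘ₗ L ∘ₗ e.symmₗ ℝ x)

variable (d E) in
/-- A (continuous) Riemannian norm on the bundle: a continuous function on the total space, whose
restriction to each fiber is the norm induced by an inner product. -/
structure RiemannianNorm where
  inner : ∀ x, E x →ₗ[ℝ] E x →ₗ[ℝ] ℝ
  symm : ∀ x (v w : E x), inner x v w = inner x w v
  pos : ∀ x (v : E x), v ≠ 0 → 0 < inner x v v
  continuous_norm : Continuous fun v : TotalSpace (Model d) E => √(inner v.proj v.snd v.snd)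

namespace RiemannianNorm

variable (g : RiemannianNorm d E)

/-- The norm on the fiber over `x`. -/
def norm {x : X} (v : E x) : ℝ := √(g.inner x v v)

/-- Operator norm of a linear map between two fibers. -/
def opNorm {x y : X} (L : E x →ₗ[ℝ] E y) : ℝ :=
  sInf {c : ℝ | 0 ≤ c ∧ ∀ v, g.norm (L v) ≤ c * g.norm v}

/-- Bolicity `‖L‖ ‖L⁻¹‖` of a linear isomorphism between two fibers. -/
def bol {x y : X} (L : E x ≃ₗ[ℝ] E y) : ℝ :=
  g.opNorm (L : E x →ₗ[ℝ] E y) * g.opNorm (L.symm : E y →ₗ[ℝ] E x)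

/-- Distance between two `p`-dimensional subspaces of a fiber: the infimum of `‖F₁ - F₂‖` over the
linear isomorphisms `F₁ : ℝᵖ → V₁` and `F₂ : ℝᵖ → V₂` with `‖Fᵢ⁻¹‖ ≤ 1`. -/
def grassDist (p : ℕ) {x : X} (V₁ V₂ : Submodule ℝ (E x)) : ℝ :=
  sInf {c : ℝ | 0 ≤ c ∧ ∃ F₁ F₂ : EuclideanSpace ℝ (Fin p) →ₗ[ℝ] E x,
    LinearMap.range F₁ = V₁ ∧ LinearMap.range F₂ = V₂ ∧
    (∀ v, ‖v‖ ≤ g.norm (F₁ v)) ∧ (∀ v, ‖v‖ ≤ g.norm (F₂ v)) ∧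
    ∀ v, g.norm (F₁ v - F₂ v) ≤ c * ‖v‖}

end RiemannianNorm

end Fibers

section Bundles

variable {X : Type*} [MetricSpace X] {d : ℕ} {E : X → Type*}
  [TopologicalSpace (TotalSpace (Model d) E)] [∀ x, AddCommGroup (E x)] [∀ x, Module ℝ (E x)]

variable (d E) in
/-- A `θ`-Hölder structure on the bundle: finitely many linear local trivializations that cover the
base, with `θ`-Hölder coordinate transformations. -/
structure HolderAtlas (θ : ℝ≥0) where
  ι : Type
  finite : Finite ι
  chart : ι → Trivialization (Model d) (π (Model d) E)
  linear : ∀ i, (chart i).IsLinear ℝ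
  cover : ∀ x, ∃ i, x ∈ (chart i).baseSet
  holder : ∀ i j, ∃ C : ℝ≥0, HolderOnWith C θ
    (fun x => coordRep (chart i) (chart j) (LinearMap.id : E x →ₗ[ℝ] E x))
    ((chart i).baseSet ∩ (chart j).baseSet)

attribute [instance] HolderAtlas.linear

variable {θ : ℝ≥0} (A : HolderAtlas d E θ)

/-- A family of transport maps `I_{y ← x} : E_x → E_y`, written `I x y`. -/
def IsTransport (I : ∀ x y, E x →ₗ[ℝ] E y) : Prop :=
  (∀ x, I x x = LinearMap.id) ∧
  ∀ i j, ∃ C : ℝ≥0, HolderOnWith C θ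
    (fun p : X × X => coordRep (A.chart i) (A.chart j) (I p.1 p.2))
    ((A.chart i).baseSet ×ˢ (A.chart j).baseSet)

variable {T : X ≃ₜ X} (Φ : ∀ x, E x ≃ₗ[ℝ] E (T x))

/-- `Φ` is a `θ`-Hölder automorphism covering `T`. -/
def IsHolderAutomorphism : Prop :=
  (∃ K : ℝ≥0, LipschitzWith K T) ∧
  ∀ i j, ∃ C : ℝ≥0, HolderOnWith C θ
    (fun x => coordRep (A.chart i) (A.chart j) (Φ x : E x →ₗ[ℝ] E (T x)))
    ((A.chart i).baseSet ∩ T ⁻¹' (A.chart j).baseSet)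

/-- The iterate `Φⁿ_x : E_x → E_{Tⁿ x}`. -/
def iter : ∀ (n : ℕ) (x : X), E x →ₗ[ℝ] E (T^[n] x)
  | 0, _ => LinearMap.id
  | n + 1, x => iter n (T x) ∘ₗ (Φ x : E x →ₗ[ℝ] E (T x))

variable (d) in
/-- `Φ` is `(ηu, ηs)`-bunched, relative to the hyperbolicity exponents `lu`, `ls` of `T`. -/
def IsBunched (lu ls : X → ℝ) (ηu ηs : ℝ) : Prop :=
  ∃ g : RiemannianNorm d E, ∀ x, Real.log (g.bol (Φ x)) < min (ηu * lu x) (ηs * ls x)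

variable (d) in
/-- `Φ` is fiber-bunched. -/
def IsFiberBunched (θ : ℝ≥0) (lu ls : X → ℝ) : Prop := IsBunched d Φ lu ls θ θ

variable (d) in
/-- `Φ` is strongly bunched, where `η₀` is the strong bunching exponent. -/
def IsStronglyBunched (θ : ℝ≥0) (lu ls : X → ℝ) (η₀ : ℝ) : Prop :=
  (d ≤ 2 ∧ IsFiberBunched d Φ θ lu ls) ∨ IsBunched d Φ lu ls η₀ θ

/-- `V` is a `p`-dimensional `θ`-Hölder subbundle. (Such a subbundle is automatically continuous. The
condition does not depend on the choice of the transport maps and of the norm.) -/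
def IsHolderSubbundle (p : ℕ) (V : ∀ x, Submodule ℝ (E x)) : Prop :=
  (∀ x, Module.finrank ℝ (V x) = p) ∧
  ∃ (I : ∀ x y, E x →ₗ[ℝ] E y) (g : RiemannianNorm d E), IsTransport A I ∧
    ∃ δ C : ℝ, 0 < δ ∧ ∀ x y, dist x y < δ →
      g.grassDist p (V y) ((V x).map (I x y)) ≤ C * dist x y ^ (θ : ℝ)

/-- `Φ` is reducible: it has a nontrivial invariant `θ`-Hölder subbundle. -/
def IsReducible : Prop :=
  ∃ (p : ℕ) (V : ∀ x, Submodule ℝ (E x)), 0 < p ∧ p < d ∧ IsHolderSubbundle A p V ∧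
    ∀ x, (V x).map (Φ x : E x →ₗ[ℝ] E (T x)) = V (T x)

/-- `Φ` is irreducible. -/
def IsIrreducible : Prop := ¬ IsReducible A Φ

/-! ### Holonomies and spannability -/

/-- The properties that characterize the holonomies `H_{y ← x} : E_x → E_y`, written `H x y`, of
`Φ` along the sets `W x`, with local versions `Wloc x`. Only the values with `y ∈ W x` matter. -/
structure IsHolonomy (W Wloc : X → Set X) (H : ∀ x y, E x →ₗ[ℝ] E y) : Prop where
  refl : ∀ x, H x x = LinearMap.id
  comp : ∀ x y z, y ∈ W x → z ∈ W y → H y z ∘ₗ H x y = H x z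
  equivariant : ∀ x y, y ∈ W x →
    (Φ y : E y →ₗ[ℝ] E (T y)) ∘ₗ H x y = H (T x) (T y) ∘ₗ (Φ x : E x →ₗ[ℝ] E (T x))
  holder : ∃ (I : ∀ x y, E x →ₗ[ℝ] E y) (g : RiemannianNorm d E), IsTransport A I ∧
    ∃ C : ℝ, 0 < C ∧ ∀ x y, y ∈ Wloc x → g.opNorm (H x y - I x y) ≤ C * dist x y ^ (θ : ℝ)
  continuous : ContinuousOn
    (fun q : TotalSpace (Model d) E × X =>
      (⟨q.2, H q.1.proj q.2 q.1.snd⟩ : TotalSpace (Model d) E))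
    {q | q.2 ∈ Wloc q.1.proj}

/-- `H` is the family of unstable holonomies of `Φ`. -/
def IsUnstableHolonomy (ε₀ : ℝ) (H : ∀ x y, E x →ₗ[ℝ] E y) : Prop :=
  IsHolonomy A Φ (unstableSet T) (localUnstable T ε₀) H

/-- `H` is the family of stable holonomies of `Φ`. -/
def IsStableHolonomy (ε₀ : ℝ) (H : ∀ x y, E x →ₗ[ℝ] E y) : Prop :=
  IsHolonomy A Φ (stableSet T) (localStable T ε₀) H

/-- `Φ` is spannable: it has unstable and stable holonomies `Hu`, `Hs`, and for all points `x`, `y`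
and all nonzero `u ∈ E_x` there are points `xᵢ ∈ W^u(x)` and integers `nᵢ ≥ 0` such that
`T^{nᵢ} xᵢ ∈ W^s(y)` and the `d` vectors `Hs ∘ Φ^{nᵢ} ∘ Hu (u)` form a basis of `E_y`. -/
def IsSpannable (ε₀ : ℝ) : Prop :=
  (∃ Hu, IsUnstableHolonomy A Φ ε₀ Hu) ∧ (∃ Hs, IsStableHolonomy A Φ ε₀ Hs) ∧
  ∀ Hu Hs : ∀ x y, E x →ₗ[ℝ] E y, IsUnstableHolonomy A Φ ε₀ Hu → IsStableHolonomy A Φ ε₀ Hs →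
    ∀ (x y : X) (u : E x), u ≠ 0 →
      ∃ (x' : Fin d → X) (n : Fin d → ℕ),
        (∀ i, x' i ∈ unstableSet T x) ∧ (∀ i, T^[n i] (x' i) ∈ stableSet T y) ∧
        LinearIndependent ℝ
          (fun i => Hs (T^[n i] (x' i)) y (iter Φ (n i) (x' i) (Hu x (x' i) u))) ∧
        Submodule.span ℝ (range
          (fun i => Hs (T^[n i] (x' i)) y (iter Φ (n i) (x' i) (Hu x (x' i) u)))) = ⊤

end Bundles

end HolderCocycle

end

open HolderCocycle

/-! Fix a nonzero vector. Transport it by unstable holonomies, by the automorphism and finally by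
stable holonomies; the results span a subspace of every fiber (`spanAt`). The claim is that these
subspaces form an invariant Hölder subbundle. Irreducibility then forces them to fill the fibers,
and a basis can be selected among the spanning vectors.

By construction the subspaces are respected by the automorphism and by stable holonomies. Their
dimension is lower semicontinuous, because a vector extends continuously to nearby points by an
unstable holonomy followed by a stable one along the local product structure (`localSection`). The
set where the dimension is not maximal is therefore closed, backward invariant and saturated by
local stable sets, and transitivity makes it empty (`exists_finrank_eq`).

The delicate point is invariance under unstable holonomies, since stable and unstable holonomies
need not commute. If the rank is at most two, a proper span is a line. Over a dense set of base
points this line is generated by a vector whose unstable translates are again admissible, so it is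
invariant there, and continuity gives the rest (`Ku_apply_mem_of_finrank_eq_one`). In the other
case, the failure to commute around a quadrilateral of local stable and unstable sides is at most a
multiple of the `η`-th power of the length of an unstable side (`exists_quadrilateral_holder`). To
see this, iterate forward until the growing unstable sides meet the shrinking stable ones, apply the
trivial Hölder bound there, and conjugate back; the inequality defining the strong bunching exponent
is what this balance requires. The spans are thus invariant up to an error of order `η`. Conjugating
by backward iterates that return to a fixed small region, bunching with exponent `η` drives the
error to zero (`Ku_apply_mem_of_quadrilateral`).

Once both kinds of holonomies preserve the spans, nearby spans are related by going through the
bracket, which is Hölder-close to the identity (`exists_transport_spanAt`,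
`isHolderSubbundle_map_retr`).

To have limits and norms in one fixed space, the bundle is embedded in a trivial one by a Hölder
partition of unity (`HolderPartition`). The automorphism becomes a `MatrixCocycle` of operators
whose fibers are the ranges of projections. Pointwise bunching spreads to pairs of orbits
(`BunchedBy`) and yields `Dominated`, which makes the products `Nn n y * Mn n x` converge to the
holonomies. Unstable objects are stable objects of the inverse cocycle `rev`. -/

namespace HolderCocycle

/-! ### Stable and unstable sets, contraction along them, and transitivity. -/

section Dynamics

variable {X : Type*} [MetricSpace X]

theorem iterate_symm_iterate (T : X ≃ₜ X) (n : ℕ) (x : X) : T^[n] (T.symm^[n] x) = x :=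
  (Function.RightInverse.iterate T.apply_symm_apply n) x

theorem symm_iterate_iterate (T : X ≃ₜ X) (n : ℕ) (x : X) : T.symm^[n] (T^[n] x) = x :=
  (Function.LeftInverse.iterate T.symm_apply_apply n) x

theorem mem_localStable_self (T : X ≃ₜ X) {ε : ℝ} (hε : 0 ≤ ε) (x : X) :
    x ∈ localStable T ε x := fun n => by simpa using hε

theorem mem_localStable_comm {T : X ≃ₜ X} {ε : ℝ} {x y : X} :
    y ∈ localStable T ε x ↔ x ∈ localStable T ε y := by
  simp only [localStable, mem_ofPred_eq, dist_comm]

theorem localStable_mono {T : X ≃ₜ X} {ε ε' : ℝ} (h : ε ≤ ε') (x : X) :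
    localStable T ε x ⊆ localStable T ε' x := fun _ hy n => (hy n).trans h

theorem localStable_iterate {T : X ≃ₜ X} {ε : ℝ} {x y : X} (h : y ∈ localStable T ε x) (n : ℕ) :
    T^[n] y ∈ localStable T ε (T^[n] x) := fun k => by
  simpa only [← Function.iterate_add_apply] using h (k + n)

theorem localUnstable_mono {T : X ≃ₜ X} {ε ε' : ℝ} (h : ε ≤ ε') (x : X) :
    localUnstable T ε x ⊆ localUnstable T ε' x := fun _ hy n => (hy n).trans h

theorem mem_localUnstable_self (T : X ≃ₜ X) {ε : ℝ} (hε : 0 ≤ ε) (x : X) :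
    x ∈ localUnstable T ε x := fun n => by simpa using hε

/-- Membership constrains the past only, so a forward step adds a single new condition, the one at
time zero. -/
theorem localUnstable_map {T : X ≃ₜ X} {ε : ℝ} {x y : X} (h : y ∈ localUnstable T ε x)
    (h' : dist (T y) (T x) ≤ ε) : T y ∈ localUnstable T ε (T x) := fun n => by
  cases n with
  | zero => exact h'
  | succ n => simpa using h n

/-- Unstable sets of `T` are definitionally stable sets of `T.symm`; this is how results about
stable sets are reused here and below. -/
theorem localUnstable_symm_iterate {T : X ≃ₜ X} {ε : ℝ} {x y : X} (h : y ∈ localUnstable T ε x)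
    (n : ℕ) : T.symm^[n] y ∈ localUnstable T ε (T.symm^[n] x) :=
  localStable_iterate (T := T.symm) h n

theorem mem_stableSet_self (T : X ≃ₜ X) (x : X) : x ∈ stableSet T x := by
  simp [stableSet]

theorem mem_stableSet_comm {T : X ≃ₜ X} {x y : X} : y ∈ stableSet T x ↔ x ∈ stableSet T y := by
  simp only [stableSet, mem_ofPred_eq, dist_comm]

theorem mem_stableSet_trans {T : X ≃ₜ X} {x y z : X} (h : y ∈ stableSet T x)
    (h' : z ∈ stableSet T y) : z ∈ stableSet T x := by
  have := Tendsto.add h' h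
  rw [add_zero] at this
  exact squeeze_zero (fun _ => dist_nonneg) (fun n => dist_triangle _ (T^[n] y) _) this

theorem stableSet_iterate_iff {T : X ≃ₜ X} {x y : X} (m : ℕ) :
    T^[m] y ∈ stableSet T (T^[m] x) ↔ y ∈ stableSet T x := by
  simp only [stableSet, mem_ofPred_eq, ← Function.iterate_add_apply]
  exact tendsto_add_atTop_iff_nat (f := fun n => dist (T^[n] y) (T^[n] x)) m

theorem stableSet_map {T : X ≃ₜ X} {x y : X} (h : y ∈ stableSet T x) :
    T y ∈ stableSet T (T x) := (stableSet_iterate_iff 1).2 h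

theorem stableSet_symm_iterate_iff {T : X ≃ₜ X} {x y : X} (m : ℕ) :
    T.symm^[m] y ∈ stableSet T (T.symm^[m] x) ↔ y ∈ stableSet T x := by
  rw [← stableSet_iterate_iff m, iterate_symm_iterate, iterate_symm_iterate]

theorem mem_unstableSet_comm {T : X ≃ₜ X} {x y : X} :
    y ∈ unstableSet T x ↔ x ∈ unstableSet T y :=
  mem_stableSet_comm (T := T.symm)

theorem mem_unstableSet_trans {T : X ≃ₜ X} {x y z : X} (h : y ∈ unstableSet T x)
    (h' : z ∈ unstableSet T y) : z ∈ unstableSet T x :=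
  mem_stableSet_trans (T := T.symm) h h'

theorem unstableSet_iterate_iff {T : X ≃ₜ X} {x y : X} (m : ℕ) :
    T^[m] y ∈ unstableSet T (T^[m] x) ↔ y ∈ unstableSet T x :=
  stableSet_symm_iterate_iff (T := T.symm) m

theorem unstableSet_symm_iterate_iff {T : X ≃ₜ X} {x y : X} (m : ℕ) :
    T.symm^[m] y ∈ unstableSet T (T.symm^[m] x) ↔ y ∈ unstableSet T x :=
  stableSet_iterate_iff (T := T.symm) m

/-- Eventually the forward iterates of two points on a common stable set are on a common local
stable set. -/
theorem exists_iterate_mem_localStable {T : X ≃ₜ X} {x y : X} (h : y ∈ stableSet T x) {ε : ℝ}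
    (hε : 0 < ε) : ∃ m₀, ∀ m ≥ m₀, T^[m] y ∈ localStable T ε (T^[m] x) := by
  have h1 : ∀ᶠ n : ℕ in atTop, dist (T^[n] y) (T^[n] x) < ε := Tendsto.eventually_lt_const hε h
  obtain ⟨m₀, hm₀⟩ := eventually_atTop.1 h1
  refine ⟨m₀, fun m hm n => ?_⟩
  simp only [← Function.iterate_add_apply]
  exact (hm₀ _ (by omega)).le

/-- `T` contracts the local stable sets of size `ε` with exponent `l`. -/
structure ContractsStable (T : X ≃ₜ X) (ε : ℝ) (l : X → ℝ) : Prop where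
  continuous : Continuous l
  pos : ∀ x, 0 < l x
  contract : ∀ x, ∀ x' ∈ localStable T ε x, ∀ x'' ∈ localStable T ε x,
    dist (T x') (T x'') ≤ Real.exp (-l x) * dist x' x''

namespace ContractsStable

variable {T : X ≃ₜ X} {ε : ℝ} {l : X → ℝ} (h : ContractsStable T ε l)
include h

/-- The rate is read along the orbit of the center `c`, which may differ from both points. This
freedom lets all sides of a configuration be measured against one orbit. -/
theorem dist_iterate_le {c a b : X} (ha : a ∈ localStable T ε c) (hb : b ∈ localStable T ε c)
    (n : ℕ) : dist (T^[n] a) (T^[n] b) ≤ Real.exp (-birkhoffSum T l n c) * dist a b := by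
  induction n with
  | zero => simp
  | succ n ih =>
    rw [Function.iterate_succ_apply', Function.iterate_succ_apply']
    refine (h.contract _ _ (localStable_iterate ha n) _ (localStable_iterate hb n)).trans ?_
    rw [birkhoffSum_succ, neg_add, Real.exp_add, mul_comm (Real.exp (-birkhoffSum T l n c)),
      mul_assoc]
    gcongr

theorem birkhoffSum_nonneg (n : ℕ) (x : X) : 0 ≤ birkhoffSum T l n x :=
  Finset.sum_nonneg fun _ _ => (h.pos _).le

theorem dist_iterate_le_dist {c a b : X} (ha : a ∈ localStable T ε c)
    (hb : b ∈ localStable T ε c) (n : ℕ) : dist (T^[n] a) (T^[n] b) ≤ dist a b := by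
  refine (h.dist_iterate_le ha hb n).trans (mul_le_of_le_one_left dist_nonneg ?_)
  rw [Real.exp_le_one_iff, neg_nonpos]
  exact h.birkhoffSum_nonneg n c

theorem exists_pos_le [CompactSpace X] : ∃ r, 0 < r ∧ ∀ x, r ≤ l x := by
  rcases isEmpty_or_nonempty X with hX | hX
  · exact ⟨1, one_pos, fun x => (hX.false x).elim⟩
  · obtain ⟨x₀, -, hx₀⟩ := isCompact_univ.exists_isMinOn univ_nonempty h.continuous.continuousOn
    exact ⟨l x₀, h.pos x₀, fun x => hx₀ (mem_univ x)⟩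

theorem exists_rate [CompactSpace X] : ∃ r, 0 < r ∧ ∀ c, ∀ a ∈ localStable T ε c,
    ∀ b ∈ localStable T ε c, ∀ n : ℕ,
      dist (T^[n] a) (T^[n] b) ≤ Real.exp (-r) ^ n * dist a b := by
  obtain ⟨r, hr, hl⟩ := h.exists_pos_le
  refine ⟨r, hr, fun c a ha b hb n => (h.dist_iterate_le ha hb n).trans ?_⟩
  rw [← Real.exp_nat_mul]
  gcongr
  rw [mul_neg, neg_le_neg_iff, birkhoffSum]
  simpa using Finset.card_nsmul_le_sum (Finset.range n) (fun k => l (T^[k] c)) r fun k _ => hl _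

theorem localStable_subset [CompactSpace X] (x : X) (hε : 0 ≤ ε) :
    localStable T ε x ⊆ stableSet T x := by
  intro y hy
  obtain ⟨r, hr, H⟩ := h.exists_rate
  have h0 : Tendsto (fun n : ℕ => Real.exp (-r) ^ n * dist y x) atTop (𝓝 (0 * dist y x)) :=
    (tendsto_pow_atTop_nhds_zero_of_lt_one (Real.exp_pos _).le
      (Real.exp_lt_one_iff.2 (neg_lt_zero.2 hr))).mul_const _
  rw [zero_mul] at h0
  exact squeeze_zero (fun _ => dist_nonneg) (fun n => H x y hy x (mem_localStable_self T hε x) n) h0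

/-- Two points of one local stable set never move apart under forward iteration, so their initial
distance already serves as a radius. -/
theorem mem_localStable_dist {c a b : X} (ha : a ∈ localStable T ε c)
    (hb : b ∈ localStable T ε c) : a ∈ localStable T (dist a b) b :=
  fun n => h.dist_iterate_le_dist ha hb n

end ContractsStable

namespace IsHyperbolic

variable {T : X ≃ₜ X} {ε₀ : ℝ} {lu ls : X → ℝ} (h : IsHyperbolic T ε₀ lu ls)
include h

theorem stable : ContractsStable T ε₀ ls := ⟨h.continuous_ls, h.ls_pos, h.contract_stable⟩

theorem unstable : ContractsStable T.symm ε₀ lu :=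
  ⟨h.continuous_lu, h.lu_pos, h.contract_unstable⟩

/-- A backward invariant nonempty closed set that is saturated by small local stable sets is the
whole space. -/
theorem eq_univ_of_stable_saturated (hT : IsTransitive T) {ρ : ℝ} (hρ : 0 < ρ) {K : Set X}
    (hK : IsClosed K) (hne : K.Nonempty) (hinv : ∀ y ∈ K, T.symm y ∈ K)
    (hsat : ∀ y ∈ K, ∀ z ∈ localStable T ε₀ y, dist z y < ρ → z ∈ K) : K = univ := by
  by_contra hKu
  obtain ⟨p, hp⟩ := (ne_univ_iff_exists_notMem K).1 hKu
  have hr : 0 < Metric.infDist p K := (hK.notMem_iff_infDist_pos hne).1 hp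
  obtain ⟨ε₁, hε₁, hε₁', br, hbr, -, C, hC, hbrC⟩ := h.bracket
  set r := Metric.infDist p K
  set δ := min (2 * ε₁) (min (ρ / (2 * C)) (r / (2 * C)))
  have hδ : 0 < δ := by positivity
  have hδρ : C * δ < ρ := by
    have : δ ≤ ρ / (2 * C) := (min_le_right _ _).trans (min_le_left _ _)
    rw [le_div_iff₀ (by positivity)] at this
    linarith
  have hδr : C * δ ≤ r / 2 := by
    have : δ ≤ r / (2 * C) := (min_le_right _ _).trans (min_le_right _ _)
    rw [le_div_iff₀ (by positivity)] at this
    linarith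
  have hU : IsOpen {a | r / 2 < Metric.infDist a K} :=
    isOpen_lt continuous_const (Metric.continuous_infDist_pt K)
  -- An orbit segment goes from a point `a` far from `K` to a point near some `y` in `K`. The
  -- bracket of the endpoint with `y` lies in `K` by saturation. Pulled back it stays in `K` and,
  -- being on the unstable side of the endpoint, comes out within `r / 2` of `a`: a contradiction.
  obtain ⟨n, _, ⟨a, ha, rfl⟩, hb⟩ := hT _ (Metric.thickening δ K) hU Metric.isOpen_thickening
    ⟨p, half_lt_self hr⟩ (hne.mono (Metric.self_subset_thickening hδ K))
  obtain ⟨y, hy, hby⟩ := Metric.mem_thickening_iff.1 hb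
  have hd : dist (T^[n] a) y ≤ 2 * ε₁ := hby.le.trans (min_le_left _ _)
  obtain ⟨hcu, hcs⟩ := (hbr _ _ hd).symm ▸ mem_singleton (br (T^[n] a) y)
  have hmax := hbrC _ _ hd
  have hlt : C * dist (T^[n] a) y ≤ C * δ := by gcongr
  have hcK : br (T^[n] a) y ∈ K :=
    hsat y hy _ hcs (((le_max_right _ _).trans hmax).trans_lt (hlt.trans_lt hδρ))
  have hcK' : ∀ m : ℕ, T.symm^[m] (br (T^[n] a) y) ∈ K := fun m => by
    induction m with
    | zero => exact hcK
    | succ m ih => rw [Function.iterate_succ_apply']; exact hinv _ ih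
  have h1 := h.unstable.dist_iterate_le_dist (mem_localStable_self _ h.eps_pos.le _) hcu n
  rw [symm_iterate_iterate] at h1
  have h2 := Metric.infDist_le_dist_of_mem (hcK' n) (x := a)
  have h3 : dist (T^[n] a) (br (T^[n] a) y) ≤ r / 2 := by
    rw [dist_comm]
    exact ((le_max_left _ _).trans hmax).trans (hlt.trans hδr)
  exact absurd ha (not_lt.2 (h2.trans (h1.trans h3)))

/-- A forward invariant nonempty closed set that is saturated by small local unstable sets is the
whole space. -/
theorem eq_univ_of_unstable_saturated (hT : IsTransitive T) {ρ : ℝ} (hρ : 0 < ρ) {K : Set X}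
    (hK : IsClosed K) (hne : K.Nonempty) (hinv : ∀ y ∈ K, T y ∈ K)
    (hsat : ∀ y ∈ K, ∀ z ∈ localUnstable T ε₀ y, dist z y < ρ → z ∈ K) : K = univ := by
  by_contra hKu
  obtain ⟨p, hp⟩ := (ne_univ_iff_exists_notMem K).1 hKu
  have hr : 0 < Metric.infDist p K := (hK.notMem_iff_infDist_pos hne).1 hp
  obtain ⟨ε₁, hε₁, hε₁', br, hbr, -, C, hC, hbrC⟩ := h.bracket
  set r := Metric.infDist p K
  set δ := min (2 * ε₁) (min (ρ / (2 * C)) (r / (2 * C)))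
  have hδ : 0 < δ := by positivity
  have hδρ : C * δ < ρ := by
    have : δ ≤ ρ / (2 * C) := (min_le_right _ _).trans (min_le_left _ _)
    rw [le_div_iff₀ (by positivity)] at this
    linarith
  have hδr : C * δ ≤ r / 2 := by
    have : δ ≤ r / (2 * C) := (min_le_right _ _).trans (min_le_right _ _)
    rw [le_div_iff₀ (by positivity)] at this
    linarith
  have hU : IsOpen {a | r / 2 < Metric.infDist a K} :=
    isOpen_lt continuous_const (Metric.continuous_infDist_pt K)
  -- Mirror image of the stable case: the segment now starts near `K` and ends far from it, and the
  -- bracket point is pushed forward.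
  obtain ⟨n, _, ⟨a, ha, rfl⟩, hb⟩ := hT (Metric.thickening δ K) _ Metric.isOpen_thickening hU
    (hne.mono (Metric.self_subset_thickening hδ K)) ⟨p, half_lt_self hr⟩
  obtain ⟨y, hy, hby⟩ := Metric.mem_thickening_iff.1 ha
  rw [dist_comm] at hby
  have hd : dist y a ≤ 2 * ε₁ := hby.le.trans (min_le_left _ _)
  obtain ⟨hcu, hcs⟩ := (hbr _ _ hd).symm ▸ mem_singleton (br y a)
  have hmax := hbrC _ _ hd
  have hlt : C * dist y a ≤ C * δ := by gcongr
  have hcK : br y a ∈ K :=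
    hsat y hy _ hcu (((le_max_left _ _).trans hmax).trans_lt (hlt.trans_lt hδρ))
  have hcK' : ∀ m : ℕ, T^[m] (br y a) ∈ K := fun m => by
    induction m with
    | zero => exact hcK
    | succ m ih => rw [Function.iterate_succ_apply']; exact hinv _ ih
  have h1 := h.stable.dist_iterate_le_dist (mem_localStable_self _ h.eps_pos.le _) hcs n
  have h2 := Metric.infDist_le_dist_of_mem (hcK' n) (x := T^[n] a)
  have h3 : dist a (br y a) ≤ r / 2 := by
    rw [dist_comm]
    exact ((le_max_right _ _).trans hmax).trans (hlt.trans hδr)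
  exact absurd hb (not_lt.2 (h2.trans (h1.trans h3)))

end IsHyperbolic

/-- A quantitative form of uniform continuity on a compact space. -/
theorem exists_abs_sub_lt_of_continuous [CompactSpace X] {f : X → ℝ} (hf : Continuous f) {ε : ℝ}
    (hε : 0 < ε) : ∃ δ, 0 < δ ∧ ∀ x y, dist x y < δ → |f x - f y| < ε := by
  obtain ⟨δ, hδ, H⟩ := Metric.uniformContinuous_iff.1
    (CompactSpace.uniformContinuous_of_continuous hf) ε hε
  exact ⟨δ, hδ, fun x y h => H h⟩

theorem exists_abs_le_of_continuous [CompactSpace X] {f : X → ℝ} (hf : Continuous f) :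
    ∃ B, 0 < B ∧ ∀ x, |f x| ≤ B := by
  obtain ⟨B, hB⟩ := isCompact_univ.exists_bound_of_continuousOn hf.continuousOn
  exact ⟨max B 1, by positivity, fun x => (hB x (mem_univ x)).trans (le_max_left _ _)⟩

end Dynamics

end HolderCocycle

namespace HolderCocycle

/-! ### Cocycles of operators on a fixed space: iterates, inverse cocycle, and construction of
holonomies. -/

section MatrixCocycles

variable {X : Type*} [MetricSpace X] {W : Type*} [NormedAddCommGroup W] [NormedSpace ℝ W]

/-- A `θ`-Hölder automorphism, covering `T`, of the subbundle of the trivial bundle `X × W` with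
fibers `range (Q x)`. Here `Q x` is a projection, `M x` maps the fiber over `x` to the fiber over
`T x`, and `N x` is its inverse; they vanish on `ker (Q x)` and `ker (Q (T x))`, respectively. -/
structure MatrixCocycle (T : X ≃ₜ X) (θ : ℝ) (W : Type*) [NormedAddCommGroup W]
    [NormedSpace ℝ W] where
  Q : X → W →L[ℝ] W
  M : X → W →L[ℝ] W
  N : X → W →L[ℝ] W
  Q_mul_Q : ∀ x, Q x * Q x = Q x
  N_mul_M : ∀ x, N x * M x = Q x
  M_mul_N : ∀ x, M x * N x = Q (T x)
  M_mul_Q : ∀ x, M x * Q x = M x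
  Q_mul_M : ∀ x, Q (T x) * M x = M x
  Q_mul_N : ∀ x, Q x * N x = N x
  N_mul_Q : ∀ x, N x * Q (T x) = N x
  bound : ∃ B, 1 ≤ B ∧ ∀ x, ‖Q x‖ ≤ B ∧ ‖M x‖ ≤ B ∧ ‖N x‖ ≤ B
  holder : ∃ C, 0 < C ∧ ∀ x y, ‖Q x - Q y‖ ≤ C * dist x y ^ θ ∧
    ‖M x - M y‖ ≤ C * dist x y ^ θ ∧ ‖N x - N y‖ ≤ C * dist x y ^ θ

namespace MatrixCocycle

variable {T : X ≃ₜ X} {θ : ℝ} (c : MatrixCocycle T θ W)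

/-- The inverse cocycle, covering `T⁻¹`. -/
def rev (hθ : 0 ≤ θ) (hT : ∃ K : ℝ≥0, LipschitzWith K T.symm) : MatrixCocycle T.symm θ W where
  Q := c.Q
  M x := c.N (T.symm x)
  N x := c.M (T.symm x)
  Q_mul_Q := c.Q_mul_Q
  N_mul_M x := by rw [c.M_mul_N, T.apply_symm_apply]
  M_mul_N x := by rw [c.N_mul_M]
  M_mul_Q x := by simpa using c.N_mul_Q (T.symm x)
  Q_mul_M x := c.Q_mul_N _
  Q_mul_N x := by simpa using c.Q_mul_M (T.symm x)
  N_mul_Q x := c.M_mul_Q _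
  bound := by
    obtain ⟨B, hB, H⟩ := c.bound
    exact ⟨B, hB, fun x => ⟨(H x).1, (H _).2.2, (H _).2.1⟩⟩
  holder := by
    obtain ⟨C, hC, H⟩ := c.holder
    obtain ⟨K, hK⟩ := hT
    have key : ∀ x y, C * dist (T.symm x) (T.symm y) ^ θ ≤
        C * ((K : ℝ) + 1) ^ θ * dist x y ^ θ := by
      intro x y
      rw [mul_assoc, ← Real.mul_rpow (by positivity) dist_nonneg]
      gcongr
      refine (hK.dist_le_mul x y).trans ?_
      gcongr
      linarith
    -- The projections keep their old constant, so the factor must be at least one for a single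
    -- constant to serve all three families; hence `K + 1` rather than `K`.
    have h1 : 1 ≤ ((K : ℝ) + 1) ^ θ := Real.one_le_rpow (by linarith [K.coe_nonneg]) hθ
    refine ⟨C * ((K : ℝ) + 1) ^ θ, by positivity, fun x y => ⟨?_, ?_, ?_⟩⟩
    · refine (H x y).1.trans ?_
      gcongr
      nlinarith
    · exact (H _ _).2.2.trans (key x y)
    · exact (H _ _).2.1.trans (key x y)

/-- The `n`-th iterate, from the fiber over `x` to the fiber over `Tⁿ x`. -/
def Mn : ℕ → X → W →L[ℝ] W
  | 0, x => c.Q x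
  | n + 1, x => Mn n (T x) * c.M x

/-- The inverse of the `n`-th iterate, from the fiber over `Tⁿ x` to the fiber over `x`. -/
def Nn : ℕ → X → W →L[ℝ] W
  | 0, x => c.Q x
  | n + 1, x => c.N x * Nn n (T x)

theorem Mn_zero (x : X) : c.Mn 0 x = c.Q x := rfl

theorem Mn_succ (n : ℕ) (x : X) : c.Mn (n + 1) x = c.Mn n (T x) * c.M x := rfl

theorem Nn_zero (x : X) : c.Nn 0 x = c.Q x := rfl

theorem Nn_succ (n : ℕ) (x : X) : c.Nn (n + 1) x = c.N x * c.Nn n (T x) := rfl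

theorem Q_mul_Mn (n : ℕ) (x : X) : c.Q (T^[n] x) * c.Mn n x = c.Mn n x := by
  induction n generalizing x with
  | zero => exact c.Q_mul_Q x
  | succ n ih => rw [Mn_succ, ← mul_assoc, Function.iterate_succ_apply, ih]

theorem Mn_mul_Q (n : ℕ) (x : X) : c.Mn n x * c.Q x = c.Mn n x := by
  cases n with
  | zero => exact c.Q_mul_Q x
  | succ n => rw [Mn_succ, mul_assoc, c.M_mul_Q]

theorem Nn_mul_Q (n : ℕ) (x : X) : c.Nn n x * c.Q (T^[n] x) = c.Nn n x := by
  induction n generalizing x with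
  | zero => exact c.Q_mul_Q x
  | succ n ih => rw [Nn_succ, mul_assoc, Function.iterate_succ_apply, ih]

theorem Q_mul_Nn (n : ℕ) (x : X) : c.Q x * c.Nn n x = c.Nn n x := by
  cases n with
  | zero => exact c.Q_mul_Q x
  | succ n => rw [Nn_succ, ← mul_assoc, c.Q_mul_N]

theorem Mn_one (x : X) : c.Mn 1 x = c.M x := c.Q_mul_M x

theorem Mn_add (m n : ℕ) (x : X) : c.Mn (m + n) x = c.Mn n (T^[m] x) * c.Mn m x := by
  induction m generalizing x with
  | zero => rw [zero_add, Mn_zero, Function.iterate_zero_apply, Mn_mul_Q]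
  | succ m ih => rw [add_right_comm, Mn_succ, ih, mul_assoc, Mn_succ, Function.iterate_succ_apply]

theorem Nn_add (m n : ℕ) (x : X) : c.Nn (m + n) x = c.Nn m x * c.Nn n (T^[m] x) := by
  induction m generalizing x with
  | zero => rw [zero_add, Nn_zero, Function.iterate_zero_apply, Q_mul_Nn]
  | succ m ih => rw [add_right_comm, Nn_succ, ih, ← mul_assoc, Nn_succ, Function.iterate_succ_apply]

theorem Mn_succ' (n : ℕ) (x : X) : c.Mn (n + 1) x = c.M (T^[n] x) * c.Mn n x := by
  rw [Mn_add, Mn_one]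

theorem Nn_succ' (n : ℕ) (x : X) : c.Nn (n + 1) x = c.Nn n x * c.N (T^[n] x) := by
  rw [Nn_add, Nn_succ, Nn_zero, c.N_mul_Q]

theorem Nn_mul_Mn (n : ℕ) (x : X) : c.Nn n x * c.Mn n x = c.Q x := by
  induction n with
  | zero => exact c.Q_mul_Q x
  | succ n ih =>
    rw [Mn_succ', Nn_succ', mul_assoc, ← mul_assoc (c.N _), c.N_mul_M, Q_mul_Mn, ih]

theorem Mn_mul_Nn (n : ℕ) (x : X) : c.Mn n x * c.Nn n x = c.Q (T^[n] x) := by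
  induction n generalizing x with
  | zero => exact c.Q_mul_Q x
  | succ n ih =>
    rw [Mn_succ, Nn_succ, mul_assoc, ← mul_assoc (c.M _), c.M_mul_N, Q_mul_Nn, ih,
      Function.iterate_succ_apply]

theorem rev_Mn (hθ : 0 ≤ θ) (hT : ∃ K : ℝ≥0, LipschitzWith K T.symm) (n : ℕ) (x : X) :
    (c.rev hθ hT).Mn n x = c.Nn n (T.symm^[n] x) := by
  induction n generalizing x with
  | zero => rfl
  | succ n ih =>
    rw [Mn_succ, ih, Nn_succ', Function.iterate_succ_apply, iterate_symm_iterate]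
    rfl

theorem rev_Nn (hθ : 0 ≤ θ) (hT : ∃ K : ℝ≥0, LipschitzWith K T.symm) (n : ℕ) (x : X) :
    (c.rev hθ hT).Nn n x = c.Mn n (T.symm^[n] x) := by
  induction n generalizing x with
  | zero => rfl
  | succ n ih =>
    rw [Nn_succ, ih, Mn_succ', Function.iterate_succ_apply, iterate_symm_iterate]
    rfl

variable (hθ : 0 < θ)

theorem continuous_of_dist_rpow_le {f : X → W →L[ℝ] W} {C : ℝ} (hθ : 0 < θ)
    (h : ∀ x y, ‖f x - f y‖ ≤ C * dist x y ^ θ) : Continuous f := by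
  refine continuous_iff_continuousAt.2 fun y => tendsto_iff_norm_sub_tendsto_zero.2 ?_
  have h0 : Tendsto (fun x => C * dist x y ^ θ) (𝓝 y) (𝓝 (C * dist y y ^ θ)) :=
    ((tendsto_id.dist tendsto_const_nhds).rpow_const (Or.inr hθ.le)).const_mul C
  rw [dist_self, Real.zero_rpow hθ.ne', mul_zero] at h0
  exact squeeze_zero (fun _ => norm_nonneg _) (fun x => h x y) h0

include hθ

theorem continuous_Q : Continuous c.Q := by
  obtain ⟨C, -, H⟩ := c.holder
  exact continuous_of_dist_rpow_le hθ fun x y => (H x y).1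

theorem continuous_M : Continuous c.M := by
  obtain ⟨C, -, H⟩ := c.holder
  exact continuous_of_dist_rpow_le hθ fun x y => (H x y).2.1

theorem continuous_N : Continuous c.N := by
  obtain ⟨C, -, H⟩ := c.holder
  exact continuous_of_dist_rpow_le hθ fun x y => (H x y).2.2

theorem continuous_Mn (n : ℕ) : Continuous (c.Mn n) := by
  induction n with
  | zero => exact c.continuous_Q hθ
  | succ n ih => exact (ih.comp T.continuous).mul (c.continuous_M hθ)

theorem continuous_Nn (n : ℕ) : Continuous (c.Nn n) := by
  induction n with
  | zero => exact c.continuous_Q hθ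
  | succ n ih => exact (c.continuous_N hθ).mul (ih.comp T.continuous)

omit hθ

/-- Along the local stable sets of size `ε`, the bolicity of the cocycle is dominated by the
`η`-th power of the contraction of `T`. -/
def Dominated (ε η : ℝ) : Prop :=
  ∃ C r, 0 < C ∧ 0 < r ∧ ∀ x, ∀ y ∈ localStable T ε x, ∀ n : ℕ,
    ‖c.Mn n x‖ * ‖c.Nn n y‖ * dist (T^[n] x) (T^[n] y) ^ η ≤
      C * Real.exp (-r) ^ n * dist x y ^ η

/-- A family of stable holonomies of a matrix cocycle. -/
structure IsStableFamily (ε : ℝ) (K : X → X → W →L[ℝ] W) : Prop where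
  refl : ∀ x, K x x = c.Q x
  comp : ∀ x y z, y ∈ stableSet T x → z ∈ stableSet T y → K y z * K x y = K x z
  equivariant : ∀ x y, y ∈ stableSet T x → c.M y * K x y = K (T x) (T y) * c.M x
  Q_mul : ∀ x y, c.Q y * K x y = K x y
  mul_Q : ∀ x y, K x y * c.Q x = K x y
  holder : ∃ C, 0 < C ∧ ∀ x, ∀ y ∈ localStable T ε x, ‖K x y - c.Q y * c.Q x‖ ≤ C * dist x y ^ θ
  continuousOn : ContinuousOn (fun p : X × X => K p.1 p.2) {p | p.2 ∈ localStable T ε p.1}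

/-- Consecutive approximations of the holonomy differ only by replacing the projection over `T^[n]
y` by `N (T^[n] y) * M (T^[n] x)`. What remains is a Hölder difference of `M`, sandwiched between
the two iterates: exactly the product that `Dominated` controls. -/
theorem norm_Nn_mul_Mn_succ_sub_le {C B : ℝ} (hB : 1 ≤ B)
    (hbd : ∀ x, ‖c.Q x‖ ≤ B ∧ ‖c.M x‖ ≤ B ∧ ‖c.N x‖ ≤ B)
    (hC : ∀ x y, ‖c.M x - c.M y‖ ≤ C * dist x y ^ θ) (x y : X) (n : ℕ) :
    ‖c.Nn (n + 1) y * c.Mn (n + 1) x - c.Nn n y * c.Mn n x‖ ≤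
      B * C * (‖c.Mn n x‖ * ‖c.Nn n y‖ * dist (T^[n] x) (T^[n] y) ^ θ) := by
  have key : c.Nn (n + 1) y * c.Mn (n + 1) x - c.Nn n y * c.Mn n x =
      c.Nn n y * (c.N (T^[n] y) * (c.M (T^[n] x) - c.M (T^[n] y))) * c.Mn n x := by
    rw [mul_sub, c.N_mul_M, mul_sub, c.Nn_mul_Q, sub_mul, Nn_succ', Mn_succ']
    simp only [mul_assoc]
  have h0 : 0 ≤ C * dist (T^[n] x) (T^[n] y) ^ θ := (norm_nonneg _).trans (hC _ _)
  calc _ ≤ ‖c.Nn n y‖ * (B * (C * dist (T^[n] x) (T^[n] y) ^ θ)) * ‖c.Mn n x‖ := by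
        rw [key]
        refine (norm_mul_le _ _).trans ?_
        gcongr
        refine (norm_mul_le _ _).trans ?_
        gcongr
        refine (norm_mul_le _ _).trans ?_
        gcongr
        · exact (hbd _).2.2
        · exact hC _ _
    _ = _ := by ring

/-- Existence of stable holonomies. -/
theorem exists_isStableFamily [CompactSpace X] [CompleteSpace W] (hθ : 0 < θ) {ε : ℝ}
    (hε : 0 < ε) (hloc : ∀ x, localStable T ε x ⊆ stableSet T x) (hdom : c.Dominated ε θ) :
    ∃ K, c.IsStableFamily ε K := by
  obtain ⟨B, hB, hbd⟩ := c.bound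
  obtain ⟨C₀, hC₀, hold⟩ := c.holder
  obtain ⟨C₁, r, hC₁, hr, hdom⟩ := hdom
  set ρ := Real.exp (-r)
  have hρ0 : 0 < ρ := Real.exp_pos _
  have hρ1 : ρ < 1 := Real.exp_lt_one_iff.2 (neg_lt_zero.2 hr)
  set D := B * C₀ * C₁ with hD
  have hDpos : 0 < D := by positivity
  set k : ℕ → X → X → W →L[ℝ] W := fun n x y => c.Nn n y * c.Mn n x with hk
  have step : ∀ x, ∀ y ∈ localStable T ε x, ∀ n,
      dist (k n x y) (k (n + 1) x y) ≤ D * dist x y ^ θ * ρ ^ n := by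
    intro x y hy n
    rw [dist_comm, dist_eq_norm]
    refine (c.norm_Nn_mul_Mn_succ_sub_le hB hbd (fun x y => (hold x y).2.1) x y n).trans ?_
    calc _ ≤ B * C₀ * (C₁ * ρ ^ n * dist x y ^ θ) :=
        mul_le_mul_of_nonneg_left (hdom x y hy n) (by positivity)
      _ = _ := by rw [hD]; ring
  -- This reduces convergence on the whole stable set to the local one: after `m` iterates the
  -- points are locally stable, and conjugation by fixed operators preserves limits.
  have shift : ∀ x y m n, k (m + n) x y = c.Nn m y * k n (T^[m] x) (T^[m] y) * c.Mn m x := by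
    intro x y m n
    simp only [hk, Nn_add, Mn_add, mul_assoc]
  have conv : ∀ x y, ∃ L, y ∈ stableSet T x → Tendsto (fun n => k n x y) atTop (𝓝 L) := by
    intro x y
    by_cases hy : y ∈ stableSet T x
    · obtain ⟨m, hm⟩ := exists_iterate_mem_localStable hy hε
      obtain ⟨L, hL⟩ := cauchySeq_tendsto_of_complete
        (cauchySeq_of_le_geometric ρ _ hρ1 (step _ _ (hm m le_rfl)))
      refine ⟨c.Nn m y * L * c.Mn m x, fun _ => (tendsto_add_atTop_iff_nat m).1 ?_⟩
      simp only [add_comm _ m, shift]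
      exact (hL.const_mul _).mul_const _
    · exact ⟨0, fun h => absurd h hy⟩
  choose L hL using conv
  have hvanish : ∀ x y, y ∈ stableSet T x → Tendsto (fun n => ‖c.Mn n x‖ * ‖c.Nn n y‖ *
      dist (T^[n] x) (T^[n] y) ^ θ) atTop (𝓝 0) := by
    intro x y hy
    obtain ⟨m, hm⟩ := exists_iterate_mem_localStable hy hε
    refine (tendsto_add_atTop_iff_nat m).1 ?_
    have h0 : Tendsto (fun n => ‖c.Mn m x‖ * ‖c.Nn m y‖ *
        (C₁ * ρ ^ n * dist (T^[m] x) (T^[m] y) ^ θ)) atTop (𝓝 0) := by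
      simpa using (((tendsto_pow_atTop_nhds_zero_of_lt_one hρ0.le hρ1).const_mul C₁).mul_const
        (dist (T^[m] x) (T^[m] y) ^ θ)).const_mul (‖c.Mn m x‖ * ‖c.Nn m y‖)
    refine squeeze_zero (fun _ => by positivity) (fun n => ?_) h0
    simp only [add_comm _ m, Nn_add, Mn_add]
    rw [add_comm m, Function.iterate_add_apply, Function.iterate_add_apply]
    calc _ ≤ ‖c.Mn n (T^[m] x)‖ * ‖c.Mn m x‖ * (‖c.Nn m y‖ * ‖c.Nn n (T^[m] y)‖) *
          dist (T^[n] (T^[m] x)) (T^[n] (T^[m] y)) ^ θ := by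
          gcongr <;> exact norm_mul_le _ _
      _ = ‖c.Mn m x‖ * ‖c.Nn m y‖ * (‖c.Mn n (T^[m] x)‖ * ‖c.Nn n (T^[m] y)‖ *
          dist (T^[n] (T^[m] x)) (T^[n] (T^[m] y)) ^ θ) := by ring
      _ ≤ _ := mul_le_mul_of_nonneg_left (hdom _ _ (hm m le_rfl) n) (by positivity)
  have hQk : ∀ n x y, c.Q y * k n x y * c.Q x = k n x y := fun n x y => by
    simp only [hk]
    rw [mul_assoc, mul_assoc, c.Mn_mul_Q, ← mul_assoc, c.Q_mul_Nn]
  have hLQ : ∀ x y, y ∈ stableSet T x → c.Q y * L x y * c.Q x = L x y := fun x y h => by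
    refine tendsto_nhds_unique ?_ (hL x y h)
    have := ((hL x y h).const_mul (c.Q y)).mul_const (c.Q x)
    simpa only [hQk] using this
  have hsub : ∀ x, ∀ y ∈ localStable T ε x,
      ∀ n, ‖k n x y - L x y‖ ≤ D * dist x y ^ θ * ρ ^ n / (1 - ρ) := by
    intro x y hy n
    rw [← dist_eq_norm]
    exact dist_le_of_le_geometric_of_tendsto ρ _ hρ1 (step x y hy) (hL x y (hloc x hy)) n
  have h1ρ : 0 < 1 - ρ := by linarith
  have hkc : ∀ n, Continuous fun p : X × X => k n p.1 p.2 := fun n =>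
    ((c.continuous_Nn hθ n).comp continuous_snd).mul ((c.continuous_Mn hθ n).comp continuous_fst)
  -- `L` is arbitrary off the stable sets. Sandwiching it by the projections makes `Q_mul` and
  -- `mul_Q` hold for all pairs, without changing the value on stable pairs.
  refine ⟨fun x y => c.Q y * L x y * c.Q x, ?_, ?_, ?_, ?_, ?_, ?_, ?_⟩
  · intro x
    have h := mem_stableSet_self T x
    simp only [hLQ x x h]
    refine tendsto_nhds_unique (hL x x h) ?_
    simp only [hk, c.Nn_mul_Mn]
    exact tendsto_const_nhds
  · intro x y z hy hz
    simp only [hLQ x y hy, hLQ y z hz, hLQ x z (mem_stableSet_trans hy hz)]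
    refine tendsto_nhds_unique ((hL y z hz).mul (hL x y hy)) ?_
    have h0 : Tendsto (fun n => k n y z * k n x y - k n x z) atTop (𝓝 0) := by
      refine squeeze_zero_norm' ?_ (a := fun n => 2 * C₀ * (‖k n y z‖ * (‖c.Mn n x‖ * ‖c.Nn n y‖ *
        dist (T^[n] x) (T^[n] y) ^ θ))) (by
          simpa using ((hL y z hz).norm.mul (hvanish x y hy)).const_mul (2 * C₀))
      have hQ0 : ∀ᶠ n : ℕ in atTop, C₀ * dist (T^[n] z) (T^[n] y) ^ θ < 1 / 2 := by
        have h1 := (Tendsto.rpow_const hz (p := θ) (Or.inr hθ.le)).const_mul C₀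
        rw [Real.zero_rpow hθ.ne', mul_zero] at h1
        exact h1.eventually_lt_const (by norm_num)
      filter_upwards [hQ0] with n hn
      -- The inner factors multiply to the projection over `T^[n] y` instead of that over `T^[n] x`;
      -- the discrepancy has to vanish in the limit.
      have e1 : k n y z * k n x y - k n x z =
          c.Nn n z * (c.Q (T^[n] y) - c.Q (T^[n] x)) * c.Mn n x := by
        simp only [hk]
        rw [mul_assoc, ← mul_assoc (c.Mn n y), c.Mn_mul_Nn, mul_sub, sub_mul, mul_assoc, mul_assoc,
          c.Q_mul_Mn]
      -- The discrepancy involves `Nn n z`, whereas `hvanish` controls `Nn n y`. This identity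
      -- compares them: its last term is eventually at most half of `‖c.Nn n z‖` and is absorbed.
      have e2 : c.Nn n z = k n y z * c.Nn n y + c.Nn n z * (c.Q (T^[n] z) - c.Q (T^[n] y)) := by
        simp only [hk]
        rw [mul_assoc, c.Mn_mul_Nn, mul_sub, c.Nn_mul_Q]
        exact (add_sub_cancel _ _).symm
      have e3 : ‖c.Nn n z‖ ≤ ‖k n y z‖ * ‖c.Nn n y‖ + ‖c.Nn n z‖ * (1 / 2) := by
        conv_lhs => rw [e2]
        refine (norm_add_le _ _).trans (add_le_add (norm_mul_le _ _) ((norm_mul_le _ _).trans ?_))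
        gcongr
        exact ((hold _ _).1).trans hn.le
      have e4 : ‖c.Nn n z‖ ≤ 2 * (‖k n y z‖ * ‖c.Nn n y‖) := by linarith
      rw [e1]
      calc _ ≤ ‖c.Nn n z‖ * (C₀ * dist (T^[n] x) (T^[n] y) ^ θ) * ‖c.Mn n x‖ := by
            refine (norm_mul_le _ _).trans ?_
            gcongr
            refine (norm_mul_le _ _).trans ?_
            gcongr
            rw [norm_sub_rev]
            exact (hold _ _).1
        _ ≤ 2 * (‖k n y z‖ * ‖c.Nn n y‖) * (C₀ * dist (T^[n] x) (T^[n] y) ^ θ) * ‖c.Mn n x‖ := by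
            gcongr
        _ = _ := by ring
    have := h0.add (hL x z (mem_stableSet_trans hy hz))
    simpa using this
  · intro x y hy
    simp only [hLQ x y hy, hLQ _ _ (stableSet_map hy)]
    refine tendsto_nhds_unique
      (((tendsto_add_atTop_iff_nat 1).2 (hL x y hy)).const_mul (c.M y)) ?_
    refine ((hL _ _ (stableSet_map hy)).mul_const (c.M x)).congr fun n => ?_
    simp only [hk, c.Nn_succ, c.Mn_succ, ← mul_assoc, c.M_mul_N, c.Q_mul_Nn]
  · intro x y
    simp only [← mul_assoc, c.Q_mul_Q]
  · intro x y
    simp only [mul_assoc, c.Q_mul_Q]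
  · refine ⟨D / (1 - ρ), by positivity, fun x y hy => ?_⟩
    have := hsub x y hy 0
    rw [norm_sub_rev, pow_zero, mul_one] at this
    simp only [hLQ x y (hloc x hy)]
    exact this.trans_eq (by ring)
  · have hcont : ContinuousOn (fun p : X × X => L p.1 p.2) {p | p.2 ∈ localStable T ε p.1} := by
      have hu : TendstoUniformlyOn (fun n (p : X × X) => k n p.1 p.2) (fun p => L p.1 p.2) atTop
          {p | p.2 ∈ localStable T ε p.1} := by
        rw [Metric.tendstoUniformlyOn_iff]
        intro e he
        have h0 : Tendsto (fun n => D * ε ^ θ * ρ ^ n / (1 - ρ)) atTop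
            (𝓝 (D * ε ^ θ * 0 / (1 - ρ))) :=
          ((tendsto_pow_atTop_nhds_zero_of_lt_one hρ0.le hρ1).const_mul _).div_const _
        rw [mul_zero, zero_div] at h0
        filter_upwards [h0.eventually_lt_const he] with n hn p hp
        rw [dist_comm, dist_eq_norm]
        refine ((hsub p.1 p.2 hp n).trans ?_).trans_lt hn
        have : dist p.1 p.2 ≤ ε := by rw [dist_comm]; exact hp 0
        gcongr
      exact hu.continuousOn (Frequently.of_forall fun n => (hkc n).continuousOn)
    have hQ := c.continuous_Q hθ
    exact ((hQ.comp continuous_snd).continuousOn.mul hcont).mul (hQ.comp continuous_fst).continuousOn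

namespace IsStableFamily

variable {c} {ε : ℝ} {K : X → X → W →L[ℝ] W} (h : c.IsStableFamily ε K)
include h

theorem equivariant_iterate {x y : X} (hy : y ∈ stableSet T x) (n : ℕ) :
    c.Mn n y * K x y = K (T^[n] x) (T^[n] y) * c.Mn n x := by
  induction n generalizing x y with
  | zero =>
    rw [Mn_zero, Mn_zero, h.Q_mul]
    exact (h.mul_Q x y).symm
  | succ n ih =>
    rw [Mn_succ, Mn_succ, mul_assoc, h.equivariant x y hy, ← mul_assoc, ih (stableSet_map hy),
      mul_assoc]
    rfl

theorem symm_mul {x y : X} (hy : y ∈ stableSet T x) : K y x * K x y = c.Q x := by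
  rw [h.comp x y x hy (mem_stableSet_comm.1 hy), h.refl]

theorem exists_bound (hθ : 0 < θ) : ∃ B, 1 ≤ B ∧ ∀ x, ∀ y ∈ localStable T ε x, ‖K x y‖ ≤ B := by
  obtain ⟨C, hC, H⟩ := h.holder
  obtain ⟨B, hB, hbd⟩ := c.bound
  refine ⟨C * |ε| ^ θ + B * B, by nlinarith [show 0 ≤ C * |ε| ^ θ by positivity],
    fun x y hy => ?_⟩
  have h1 : ‖K x y‖ ≤ ‖K x y - c.Q y * c.Q x‖ + ‖c.Q y * c.Q x‖ := by
    simpa using norm_add_le (K x y - c.Q y * c.Q x) (c.Q y * c.Q x)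
  refine h1.trans (add_le_add ((H x y hy).trans ?_) ((norm_mul_le _ _).trans ?_))
  · have : dist x y ≤ |ε| := by rw [dist_comm]; exact (hy 0).trans (le_abs_self _)
    gcongr
  · gcongr
    · exact (hbd _).1
    · exact (hbd _).1

end IsStableFamily

/-- The bolicity of the cocycle, evaluated at pairs of points, is uniformly smaller than
`exp (m x)`, up to an error term proportional to the distance. -/
def BunchedBy (m : X → ℝ) : Prop :=
  ∃ C L r, 0 < C ∧ 0 ≤ L ∧ 0 < r ∧ ∀ (n : ℕ) (x y : X), ‖c.Mn n x‖ * ‖c.Nn n y‖ ≤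
    C * Real.exp (birkhoffSum T m n x - n * r + L * ∑ k ∈ Finset.range n, dist (T^[k] x) (T^[k] y))

theorem sum_geometric_le {ρ : ℝ} (h0 : 0 ≤ ρ) (h1 : ρ < 1) (n : ℕ) :
    ∑ k ∈ Finset.range n, ρ ^ k ≤ 1 / (1 - ρ) := by
  rw [one_div, ← tsum_geometric_of_lt_one h0 h1]
  exact (summable_geometric_of_lt_one h0 h1).sum_le_tsum _ fun _ _ => by positivity

/-- The same orbit segment is traversed in opposite directions. Note the shift: the segment consists
of the preimages of order `1` to `n`, so it omits `x` itself. -/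
theorem sum_iterate_symm_iterate (T : X ≃ₜ X) (G : X → X → ℝ) (n : ℕ) (x y : X) :
    ∑ k ∈ Finset.range n, G (T^[k] (T.symm^[n] x)) (T^[k] (T.symm^[n] y)) =
      ∑ k ∈ Finset.range n, G (T.symm^[k + 1] x) (T.symm^[k + 1] y) := by
  induction n generalizing x y with
  | zero => simp
  | succ n ih =>
    rw [Finset.sum_range_succ', Finset.sum_range_succ _ n, ← ih]
    simp only [Function.iterate_succ_apply' (⇑T.symm) n, Function.iterate_succ_apply (⇑T),
      T.apply_symm_apply, Function.iterate_zero_apply]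

/-- On a local stable set the distances decay geometrically, so the error term with factor `L` stays
bounded. The remaining growth `birkhoffSum T m` is cancelled by the `η`-th power of the contraction,
leaving the decay `r`. -/
theorem BunchedBy.dominated [CompactSpace X] {c : MatrixCocycle T θ W} {m l : X → ℝ} {ε η : ℝ}
    (h : c.BunchedBy m) (hl : ContractsStable T ε l) (hε : 0 ≤ ε) (hη : 0 ≤ η)
    (hm : ∀ x, m x ≤ η * l x) : c.Dominated ε η := by
  obtain ⟨C, L, r, hC, hL, hr, H⟩ := h
  obtain ⟨s, hs, hrate⟩ := hl.exists_rate
  set ρ := Real.exp (-s)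
  have hρ0 : 0 < ρ := Real.exp_pos _
  have hρ1 : ρ < 1 := Real.exp_lt_one_iff.2 (neg_lt_zero.2 hs)
  refine ⟨C * Real.exp (L * (ε * (1 / (1 - ρ)))), r, by positivity, hr, fun x y hy n => ?_⟩
  have hx := mem_localStable_self T hε x
  have hd : ∑ k ∈ Finset.range n, dist (T^[k] x) (T^[k] y) ≤ ε * (1 / (1 - ρ)) := by
    calc _ ≤ ∑ k ∈ Finset.range n, ε * ρ ^ k := by
          refine Finset.sum_le_sum fun k _ => (hrate x x hx y hy k).trans ?_
          rw [mul_comm]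
          gcongr
          rw [dist_comm]
          exact hy 0
      _ ≤ _ := by
        rw [← Finset.mul_sum]
        gcongr
        exact sum_geometric_le hρ0.le hρ1 n
  have hdist := hl.dist_iterate_le hx hy n
  have hb : birkhoffSum T m n x ≤ η * birkhoffSum T l n x := by
    rw [birkhoffSum, birkhoffSum, Finset.mul_sum]
    exact Finset.sum_le_sum fun k _ => hm _
  calc _ ≤ C * Real.exp (η * birkhoffSum T l n x - n * r + L * (ε * (1 / (1 - ρ)))) *
        (Real.exp (-birkhoffSum T l n x) * dist x y) ^ η := by
        gcongr ?_ * ?_ ^ η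
        · refine (H n x y).trans ?_
          gcongr
    _ = _ := by
      rw [Real.mul_rpow (Real.exp_pos _).le dist_nonneg, ← Real.exp_mul, ← Real.exp_nat_mul,
        Real.exp_add, Real.exp_sub, mul_comm (-birkhoffSum T l n x), mul_neg, mul_neg, Real.exp_neg,
        Real.exp_neg]
      have := Real.exp_pos (η * birkhoffSum T l n x)
      field_simp

/-- For the inverse cocycle the exponent `m` is summed over the preimages of order `1` to `n`, while
the contraction of `T.symm` is summed over orders `0` to `n - 1`. The mismatch is one term at each
end and costs the factor `Real.exp (η * B)`. -/
theorem BunchedBy.rev_dominated [CompactSpace X] {c : MatrixCocycle T θ W} {m l : X → ℝ} {ε η : ℝ}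
    (h : c.BunchedBy m) (hθ : 0 ≤ θ) (hT : ∃ K : ℝ≥0, LipschitzWith K T.symm)
    (hl : ContractsStable T.symm ε l) (hε : 0 ≤ ε) (hη : 0 ≤ η)
    (hm : ∀ x, m x ≤ η * l x) : (c.rev hθ hT).Dominated ε η := by
  obtain ⟨C, L, r, hC, hL, hr, H⟩ := h
  obtain ⟨s, hs, hrate⟩ := hl.exists_rate
  obtain ⟨B, hB, hlB⟩ := exists_abs_le_of_continuous hl.continuous
  set ρ := Real.exp (-s)
  have hρ0 : 0 < ρ := Real.exp_pos _
  have hρ1 : ρ < 1 := Real.exp_lt_one_iff.2 (neg_lt_zero.2 hs)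
  -- The names of the two points are exchanged: reversal turns `Mn` into `Nn`, so the second point
  -- of the pair plays the part of the first one in `BunchedBy`.
  refine ⟨C * Real.exp (η * B + L * (ε * (1 / (1 - ρ)))), r, by positivity, hr,
    fun y x hx n => ?_⟩
  rw [mem_localStable_comm] at hx
  have hx' := mem_localStable_self T.symm hε x
  have hd : ∑ k ∈ Finset.range n, dist (T^[k] (T.symm^[n] x)) (T^[k] (T.symm^[n] y)) ≤
      ε * (1 / (1 - ρ)) := by
    rw [sum_iterate_symm_iterate T dist]
    calc _ ≤ ∑ k ∈ Finset.range n, ε * ρ ^ k := by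
          refine Finset.sum_le_sum fun k _ => (hrate x x hx' y hx (k + 1)).trans ?_
          rw [mul_comm]
          gcongr ?_ * ?_
          · rw [dist_comm]
            exact hx 0
          · exact pow_le_pow_of_le_one hρ0.le hρ1.le (Nat.le_succ k)
      _ ≤ _ := by
        rw [← Finset.mul_sum]
        gcongr
        exact sum_geometric_le hρ0.le hρ1 n
  have hdist := hl.dist_iterate_le hx' hx n
  have hb : birkhoffSum T m n (T.symm^[n] x) ≤ η * birkhoffSum T.symm l n x + η * B := by
    have h1 : birkhoffSum T m n (T.symm^[n] x) ≤
        η * ∑ k ∈ Finset.range n, l (T.symm^[k + 1] x) := by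
      rw [birkhoffSum, sum_iterate_symm_iterate T (fun a _ => m a) n x x, Finset.mul_sum]
      exact Finset.sum_le_sum fun k _ => hm _
    have h2 := Finset.sum_range_succ' (fun k => l (T.symm^[k] x)) n
    rw [Finset.sum_range_succ] at h2
    have h3 : ∑ k ∈ Finset.range n, l (T.symm^[k + 1] x) ≤ birkhoffSum T.symm l n x + B := by
      have h4 := le_of_abs_le (hlB (T.symm^[n] x))
      have h5 := hl.pos x
      rw [Function.iterate_zero_apply] at h2
      rw [birkhoffSum]
      linarith
    rw [← mul_add]
    exact h1.trans (by gcongr)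
  rw [rev_Mn, rev_Nn, mul_comm ‖c.Nn n _‖, dist_comm (T.symm^[n] y), dist_comm y]
  calc _ ≤ C * Real.exp (η * birkhoffSum T.symm l n x + η * B - n * r +
          L * (ε * (1 / (1 - ρ)))) * (Real.exp (-birkhoffSum T.symm l n x) * dist x y) ^ η := by
        gcongr ?_ * ?_ ^ η
        · refine (H n _ _).trans ?_
          gcongr
    _ = _ := by
      rw [Real.mul_rpow (Real.exp_pos _).le dist_nonneg, ← Real.exp_mul, ← Real.exp_nat_mul,
        Real.exp_add, Real.exp_sub, Real.exp_add, Real.exp_add, mul_comm (-birkhoffSum T.symm l n x),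
        mul_neg, mul_neg, Real.exp_neg, Real.exp_neg]
      have := Real.exp_pos (η * birkhoffSum T.symm l n x)
      field_simp

end MatrixCocycle

end MatrixCocycles

end HolderCocycle

namespace HolderCocycle

/-! ### Failure of stable and unstable holonomies to commute around small quadrilaterals. -/

section Quadrilaterals

variable {X : Type*} [MetricSpace X] {W : Type*} [NormedAddCommGroup W] [NormedSpace ℝ W]

namespace MatrixCocycle

variable {T : X ≃ₜ X} {θ : ℝ} {c : MatrixCocycle T θ W}

/-- The holonomies of the inverse cocycle along the stable sets of `T⁻¹` commute with the cocycle
itself. -/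
theorem IsStableFamily.rev_equivariant_iterate {hθ : 0 ≤ θ}
    {hT : ∃ K : ℝ≥0, LipschitzWith K T.symm} {ε : ℝ} {K : X → X → W →L[ℝ] W}
    (h : (c.rev hθ hT).IsStableFamily ε K) {x y : X} (hy : y ∈ unstableSet T x) (n : ℕ) :
    c.Mn n y * K x y = K (T^[n] x) (T^[n] y) * c.Mn n x := by
  have h1 := h.equivariant_iterate (x := T^[n] x) (y := T^[n] y) ((unstableSet_iterate_iff n).2 hy) n
  rw [rev_Mn, rev_Mn, symm_iterate_iterate, symm_iterate_iterate] at h1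
  have hQ : ∀ x y, c.Q y * K x y = K x y := h.Q_mul
  have hQ' : ∀ x y, K x y * c.Q x = K x y := h.mul_Q
  calc c.Mn n y * K x y = c.Mn n y * (K x y * c.Nn n x) * c.Mn n x := by
        rw [mul_assoc, mul_assoc (K x y), c.Nn_mul_Mn, hQ']
    _ = _ := by rw [← h1, ← mul_assoc (c.Mn n y), c.Mn_mul_Nn, hQ]

/-- Two sides of a quadrilateral made of stable and unstable holonomies almost give the same map as
the other two sides. -/
theorem exists_norm_quadrilateral_le (hθ : 0 < θ) {hT : ∃ K : ℝ≥0, LipschitzWith K T.symm} {ε : ℝ}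
    {Ks Ku : X → X → W →L[ℝ] W} (hs : c.IsStableFamily ε Ks)
    (hu : (c.rev hθ.le hT).IsStableFamily ε Ku) :
    ∃ C, 0 < C ∧ ∀ y y' q q' s, y' ∈ localUnstable T ε y → q ∈ localStable T ε y →
      q' ∈ localStable T ε y' → q' ∈ localUnstable T ε q → dist y y' ≤ s → dist q y ≤ s →
      dist q' y' ≤ s → dist q q' ≤ s → dist q' y ≤ s →
      ‖Ks q' y' * Ku q q' - Ku y y' * Ks q y‖ ≤ C * s ^ θ := by
  obtain ⟨C₁, hC₁, H₁⟩ := hs.holder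
  obtain ⟨C₂, hC₂, H₂⟩ := hu.holder
  obtain ⟨B₁, hB₁, b₁⟩ := hs.exists_bound hθ
  obtain ⟨B₂, hB₂, b₂⟩ := hu.exists_bound hθ
  obtain ⟨C₃, hC₃, H₃⟩ := c.holder
  obtain ⟨B, hB, b⟩ := c.bound
  replace b := fun x => (b x).1
  replace H₃ := fun x y => (H₃ x y).1
  refine ⟨C₁ * B₂ + B * B * C₂ + C₂ * B₁ + B * B * C₁ + B * C₃ * B, by positivity, ?_⟩
  intro y y' q q' s hyy' hqy hq'y' hqq' d₁ d₂ d₃ d₄ d₅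
  -- Each holonomy is replaced in turn by the product of the projections at its ends. The two
  -- resulting triple products differ only in their middle factor, `c.Q q'` against `c.Q y`.
  have key : Ks q' y' * Ku q q' - Ku y y' * Ks q y =
      (Ks q' y' - c.Q y' * c.Q q') * Ku q q' + c.Q y' * c.Q q' * (Ku q q' - c.Q q' * c.Q q)
      - (Ku y y' - c.Q y' * c.Q y) * Ks q y - c.Q y' * c.Q y * (Ks q y - c.Q y * c.Q q)
      + c.Q y' * (c.Q q' - c.Q y) * c.Q q := by
    have e1 : c.Q y' * c.Q q' * (c.Q q' * c.Q q) = c.Q y' * c.Q q' * c.Q q := by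
      rw [← mul_assoc, mul_assoc (c.Q y'), c.Q_mul_Q]
    have e2 : c.Q y' * c.Q y * (c.Q y * c.Q q) = c.Q y' * c.Q y * c.Q q := by
      rw [← mul_assoc, mul_assoc (c.Q y'), c.Q_mul_Q]
    rw [mul_sub (c.Q y' * c.Q q'), e1, mul_sub (c.Q y' * c.Q y), e2]
    noncomm_ring
  have hs0 : 0 ≤ s := dist_nonneg.trans d₁
  have m₁ : ‖Ks q' y' - c.Q y' * c.Q q'‖ ≤ C₁ * s ^ θ :=
    (H₁ _ _ (mem_localStable_comm.1 hq'y')).trans (by gcongr)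
  have m₂ : ‖Ku q q' - c.Q q' * c.Q q‖ ≤ C₂ * s ^ θ := (H₂ _ _ hqq').trans (by gcongr)
  have m₃ : ‖Ku y y' - c.Q y' * c.Q y‖ ≤ C₂ * s ^ θ := (H₂ _ _ hyy').trans (by gcongr)
  have m₄ : ‖Ks q y - c.Q y * c.Q q‖ ≤ C₁ * s ^ θ :=
    (H₁ _ _ (mem_localStable_comm.1 hqy)).trans (by gcongr)
  have m₅ : ‖c.Q q' - c.Q y‖ ≤ C₃ * s ^ θ := (H₃ _ _).trans (by gcongr)
  have n₁ : ‖Ku q q'‖ ≤ B₂ := b₂ _ _ hqq'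
  have n₂ : ‖Ks q y‖ ≤ B₁ := b₁ _ _ (mem_localStable_comm.1 hqy)
  have n₃ : ∀ a b, ‖c.Q a * c.Q b‖ ≤ B * B := fun a d =>
    (norm_mul_le _ _).trans (mul_le_mul (b a) (b d) (norm_nonneg _) (by positivity))
  rw [key]
  calc _ ≤ C₁ * s ^ θ * B₂ + B * B * (C₂ * s ^ θ) + C₂ * s ^ θ * B₁ + B * B * (C₁ * s ^ θ)
        + B * (C₃ * s ^ θ) * B := by
        refine (norm_add_le _ _).trans (add_le_add ((norm_sub_le _ _).trans (add_le_add
          ((norm_sub_le _ _).trans (add_le_add ((norm_add_le _ _).trans (add_le_add ?_ ?_))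
          ?_)) ?_)) ?_)
        · exact (norm_mul_le _ _).trans (by gcongr)
        · exact (norm_mul_le _ _).trans (by gcongr; exact n₃ _ _)
        · exact (norm_mul_le _ _).trans (by gcongr)
        · exact (norm_mul_le _ _).trans (by gcongr; exact n₃ _ _)
        · refine (norm_mul_le _ _).trans ?_
          gcongr
          · exact (norm_mul_le _ _).trans (by gcongr; exact b _)
          · exact b _
    _ = _ := by ring

/-- Quadrilaterals of holonomies are conjugated by the iterates of the cocycle. -/
theorem quadrilateral_eq_conj {hθ : 0 ≤ θ} {hT : ∃ K : ℝ≥0, LipschitzWith K T.symm} {ε : ℝ}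
    {Ks Ku : X → X → W →L[ℝ] W} (hs : c.IsStableFamily ε Ks)
    (hu : (c.rev hθ hT).IsStableFamily ε Ku) {y y' q q' : X} (hyy' : y' ∈ unstableSet T y)
    (hqy : q ∈ stableSet T y) (hqy' : q' ∈ stableSet T y') (hqq' : q' ∈ unstableSet T q) (n : ℕ) :
    Ks q' y' * Ku q q' - Ku y y' * Ks q y = c.Nn n y' *
      (Ks (T^[n] q') (T^[n] y') * Ku (T^[n] q) (T^[n] q') -
        Ku (T^[n] y) (T^[n] y') * Ks (T^[n] q) (T^[n] y)) * c.Mn n q := by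
  have hQu : ∀ x y, c.Q y * Ku x y = Ku x y := hu.Q_mul
  rw [mem_stableSet_comm] at hqy hqy'
  rw [mul_assoc, sub_mul, mul_assoc (Ks _ _), ← hu.rev_equivariant_iterate hqq',
    ← mul_assoc (Ks _ _), ← hs.equivariant_iterate hqy', mul_assoc (Ku _ _),
    ← hs.equivariant_iterate hqy, ← mul_assoc (Ku _ _), ← hu.rev_equivariant_iterate hyy',
    mul_assoc (c.Mn n y'), mul_assoc (c.Mn n y'), ← mul_sub, ← mul_assoc, c.Nn_mul_Mn, mul_sub,
    ← mul_assoc, ← mul_assoc, hs.Q_mul, hQu]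

end MatrixCocycle

/-- Evolution of a small quadrilateral with stable and unstable sides. -/
theorem quadrilateral_iterate {T : X ≃ₜ X} {ε₀ : ℝ} {lu ls Lu : X → ℝ}
    (h : IsHyperbolic T ε₀ lu ls) {τ δ δ' ε₁ : ℝ} (hδ : 0 ≤ δ)
    (hLu0 : ∀ x, 0 < Lu x)
    (hLu : ∀ x, ∀ x' ∈ localUnstable T ε₁ x, ∀ x'' ∈ localUnstable T ε₁ x,
      T x' ∈ localUnstable T ε₀ (T x) ∧ T x'' ∈ localUnstable T ε₀ (T x) ∧
      dist (T x') (T x'') ≤ Real.exp (Lu x) * dist x' x'')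
    (hτ : ∀ x, τ ≤ ls x) (hδ₁ : δ ≤ ε₁) (hδ₀ : δ ≤ ε₀) (hδ' : 3 * δ < δ')
    (hmod : ∀ x y, dist x y < δ' → |ls x - ls y| < τ ∧ |Lu x - Lu y| < τ)
    {y y' q q' : X} (hyy' : y' ∈ localUnstable T δ y) (hqy : q ∈ localStable T δ y)
    (hqy' : q' ∈ localStable T δ y') (hqq' : q' ∈ localUnstable T (3 * δ) q) {n : ℕ}
    (hn : Real.exp (birkhoffSum T (ls + Lu) n q) * dist y y' ≤ δ) (k : ℕ) (hk : k ≤ n) :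
    T^[k] y' ∈ localUnstable T δ (T^[k] y) ∧ T^[k] q' ∈ localUnstable T (3 * δ) (T^[k] q) ∧
    dist (T^[k] y) (T^[k] y') ≤ Real.exp (-birkhoffSum T ls k q + k * τ) * δ ∧
    dist (T^[k] q) (T^[k] y) ≤ Real.exp (-birkhoffSum T ls k q + k * τ) * δ ∧
    dist (T^[k] q') (T^[k] y') ≤ Real.exp (-birkhoffSum T ls k q + k * τ) * δ := by
  have hτ0 : 0 < τ := by
    have := (hmod y y (by rw [dist_self]; linarith)).1
    simpa using this
  have hbs : ∀ k : ℕ, (k : ℝ) * τ ≤ birkhoffSum T ls k q := fun k => by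
    simpa [birkhoffSum] using
      Finset.card_nsmul_le_sum (Finset.range k) (fun j => ls (T^[j] q)) τ fun j _ => hτ _
  have hexp1 : ∀ k : ℕ, Real.exp (-birkhoffSum T ls k q + k * τ) * δ ≤ δ := fun k => by
    refine mul_le_of_le_one_left hδ ?_
    rw [Real.exp_le_one_iff]
    linarith [hbs k]
  have hqy₀ : ∀ k, dist (T^[k] q) (T^[k] y) ≤ Real.exp (-birkhoffSum T ls k q + k * τ) * δ := by
    intro k
    refine (h.stable.dist_iterate_le (mem_localStable_self T h.eps_pos.le q)
      (localStable_mono hδ₀ q (mem_localStable_comm.1 hqy)) k).trans ?_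
    gcongr
    · nlinarith [show (0 : ℝ) ≤ k by positivity]
    · exact hqy 0
  -- All Birkhoff sums are referred to the orbit of `q`. By `hmod` each change of reference point
  -- costs at most `τ` per step, and the accumulated `k * τ` is absorbed because `τ ≤ ls`. The
  -- hypothesis `hn` keeps the unstable sides below `δ` up to time `n`, so that the expansion bound
  -- continues to apply.
  have main : ∀ k : ℕ, k ≤ n → T^[k] y' ∈ localUnstable T δ (T^[k] y) ∧
      T^[k] q' ∈ localUnstable T (3 * δ) (T^[k] q) ∧
      dist (T^[k] y) (T^[k] y') ≤ Real.exp (birkhoffSum T Lu k q + k * τ) * dist y y' ∧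
      |birkhoffSum T ls k q' - birkhoffSum T ls k q| ≤ k * τ := by
    intro k
    induction k with
    | zero => intro _; simpa using ⟨hyy', hqq'⟩
    | succ k ih =>
      intro hk
      obtain ⟨i1, i2, i3, i4⟩ := ih (by omega)
      have j1 : dist (T^[k + 1] y) (T^[k + 1] y') ≤
          Real.exp (birkhoffSum T Lu (k + 1) q + (k + 1 : ℕ) * τ) * dist y y' := by
        rw [Function.iterate_succ_apply', Function.iterate_succ_apply']
        have a1 := (hLu _ _ (mem_localUnstable_self T (hδ.trans hδ₁) _) _
          (localUnstable_mono hδ₁ _ i1)).2.2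
        have a2 : Lu (T^[k] y) ≤ Lu (T^[k] q) + τ := by
          have := (abs_lt.1 (hmod (T^[k] y) (T^[k] q) ((by
            rw [dist_comm]; exact ((hqy₀ k).trans (hexp1 k)).trans_lt (by linarith)))).2).2
          linarith
        calc _ ≤ Real.exp (Lu (T^[k] q) + τ) *
              (Real.exp (birkhoffSum T Lu k q + k * τ) * dist y y') := by
              refine a1.trans ?_
              gcongr
          _ = _ := by
              rw [← mul_assoc, ← Real.exp_add, birkhoffSum_succ]
              congr 2
              push_cast
              ring
      have j4 : |birkhoffSum T ls (k + 1) q' - birkhoffSum T ls (k + 1) q| ≤ (k + 1 : ℕ) * τ := by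
        rw [birkhoffSum_succ, birkhoffSum_succ, add_sub_add_comm]
        refine (abs_add_le _ _).trans ?_
        have := (hmod (T^[k] q') (T^[k] q) ((i2 0).trans_lt hδ')).1.le
        push_cast
        linarith
      have j1' : dist (T^[k + 1] y) (T^[k + 1] y') ≤ δ := by
        refine j1.trans (le_trans ?_ hn)
        gcongr
        rw [birkhoffSum_add']
        have b1 : birkhoffSum T Lu (k + 1) q ≤ birkhoffSum T Lu n q :=
          Finset.sum_le_sum_of_subset_of_nonneg (Finset.range_mono hk) fun _ _ _ => (hLu0 _).le
        have b2 : birkhoffSum T ls (k + 1) q ≤ birkhoffSum T ls n q :=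
          Finset.sum_le_sum_of_subset_of_nonneg (Finset.range_mono hk) fun _ _ _ => (h.ls_pos _).le
        linarith [hbs (k + 1)]
      refine ⟨?_, ?_, j1, j4⟩
      · have := localUnstable_map i1
        simp only [← Function.iterate_succ_apply'] at this
        exact this (by rwa [dist_comm])
      · have := localUnstable_map i2
        simp only [← Function.iterate_succ_apply'] at this
        refine this ?_
        have t1 := dist_triangle4 (T^[k + 1] q') (T^[k + 1] y') (T^[k + 1] y) (T^[k + 1] q)
        have t2 : dist (T^[k + 1] q') (T^[k + 1] y') ≤ δ := hqy' (k + 1)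
        have t3 : dist (T^[k + 1] q) (T^[k + 1] y) ≤ δ := hqy (k + 1)
        rw [dist_comm (T^[k + 1] y) (T^[k + 1] q), dist_comm (T^[k + 1] y')] at t1
        linarith
  obtain ⟨m1, m2, m3, m4⟩ := main k hk
  refine ⟨m1, m2, m3.trans ?_, hqy₀ k, ?_⟩
  -- Until the stopping time, growth of the unstable side is traded for the contraction rate of the
  -- stable sides, so all sides obey one common bound.
  · calc _ = Real.exp (-birkhoffSum T ls k q + k * τ) *
          (Real.exp (birkhoffSum T (ls + Lu) k q) * dist y y') := by
          rw [← mul_assoc, ← Real.exp_add, birkhoffSum_add']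
          congr 2
          ring
      _ ≤ _ := by
          gcongr
          refine le_trans ?_ hn
          gcongr
          exact Finset.sum_le_sum_of_subset_of_nonneg (Finset.range_mono hk)
            fun _ _ _ => (add_pos (h.ls_pos _) (hLu0 _)).le
  · refine (h.stable.dist_iterate_le (mem_localStable_self T h.eps_pos.le q')
      (localStable_mono hδ₀ q' (mem_localStable_comm.1 hqy')) k).trans ?_
    have := neg_le_of_abs_le m4
    gcongr
    · linarith
    · exact hqy' 0

namespace MatrixCocycle

variable [CompactSpace X] {T : X ≃ₜ X} {θ : ℝ} {c : MatrixCocycle T θ W}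

/-- Under strong bunching, the stable holonomies are `η`-Hölder along the unstable sets. -/
theorem exists_quadrilateral_holder {ε₀ : ℝ} {lu ls Lu m : X → ℝ} (hθ : 0 < θ)
    (h : IsHyperbolic T ε₀ lu ls) {Ks Ku : X → X → W →L[ℝ] W} (hs : c.IsStableFamily ε₀ Ks)
    (hu : (c.rev hθ.le h.lipschitz_symm).IsStableFamily ε₀ Ku) (hb : c.BunchedBy m)
    (hLu : IsExpansionBound T ε₀ Lu) {η : ℝ} (hη : 0 < η) (hm : ∀ x, m x ≤ η * lu x)
    (hstr : ∀ x, η * (ls x + lu x + Lu x) ≤ θ * ls x) :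
    ∃ δ C, 0 < δ ∧ 0 < C ∧ ∀ y y' q q', y' ∈ localUnstable T δ y → q ∈ localStable T δ y →
      q' ∈ localStable T δ y' → q' ∈ localUnstable T (3 * δ) q →
      ‖Ks q' y' * Ku q q' - Ku y y' * Ks q y‖ ≤ C * dist y y' ^ η := by
  obtain ⟨C₁, hC₁, H₁⟩ := exists_norm_quadrilateral_le hθ hs hu
  obtain ⟨C₂, L, r, hC₂, hL, hr, H₂⟩ := hb
  obtain ⟨hLuc, hLu0, ε₁, hε₁, hε₁', hLu⟩ := hLu
  obtain ⟨ε₂, hε₂, hε₂', br, hbr, -⟩ := h.bracket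
  obtain ⟨l₀, hl₀, hls⟩ := h.stable.exists_pos_le
  obtain ⟨D, hD, hDb⟩ := exists_abs_le_of_continuous (h.continuous_ls.add hLuc)
  have hε₀ := h.eps_pos
  -- The margin `r` of bunching is split in two: one half pays for the drift `θ * τ` per step of the
  -- side lengths, the other for the error `L * (2 * δ)` per step of the cocycle bound.
  set τ := min l₀ (r / (2 * θ)) with hτ
  have hτ0 : 0 < τ := by positivity
  have hτr : θ * τ ≤ r / 2 := by
    have : τ ≤ r / (2 * θ) := min_le_right _ _
    rw [le_div_iff₀ (by positivity)] at this
    linarith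
  obtain ⟨δ₁, hδ₁, hmod₁⟩ := exists_abs_sub_lt_of_continuous h.continuous_ls hτ0
  obtain ⟨δ₂, hδ₂, hmod₂⟩ := exists_abs_sub_lt_of_continuous hLuc hτ0
  obtain ⟨δ, hδ, e₁, e₂, e₃, e₄, e₅, e₆⟩ : ∃ δ, 0 < δ ∧ δ ≤ ε₁ ∧ 3 * δ ≤ ε₀ ∧ 3 * δ < δ₁ ∧
      3 * δ < δ₂ ∧ δ ≤ ε₂ ∧ L * (2 * δ) ≤ r / 2 := by
    refine ⟨min (min ε₁ (ε₀ / 3)) (min (min (δ₁ / 6) (δ₂ / 6)) (min ε₂ (r / (4 * (L + 1))))),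
      by positivity, ?_, ?_, ?_, ?_, ?_, ?_⟩
    · exact (min_le_left _ _).trans (min_le_left _ _)
    · linarith [(min_le_left (min ε₁ (ε₀ / 3)) (min (min (δ₁ / 6) (δ₂ / 6))
        (min ε₂ (r / (4 * (L + 1)))))).trans (min_le_right _ _)]
    · linarith [(min_le_right (min ε₁ (ε₀ / 3)) (min (min (δ₁ / 6) (δ₂ / 6))
        (min ε₂ (r / (4 * (L + 1)))))).trans ((min_le_left _ _).trans (min_le_left _ _))]
    · linarith [(min_le_right (min ε₁ (ε₀ / 3)) (min (min (δ₁ / 6) (δ₂ / 6))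
        (min ε₂ (r / (4 * (L + 1)))))).trans ((min_le_left _ _).trans (min_le_right _ _))]
    · exact (min_le_right _ _).trans ((min_le_right _ _).trans (min_le_left _ _))
    · have : min (min ε₁ (ε₀ / 3)) (min (min (δ₁ / 6) (δ₂ / 6)) (min ε₂ (r / (4 * (L + 1))))) ≤
          r / (4 * (L + 1)) := (min_le_right _ _).trans ((min_le_right _ _).trans (min_le_right _ _))
      rw [le_div_iff₀ (by positivity)] at this
      have h0 : 0 ≤ min (min ε₁ (ε₀ / 3)) (min (min (δ₁ / 6) (δ₂ / 6))
        (min ε₂ (r / (4 * (L + 1))))) := by positivity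
      nlinarith
  have hδε₀ : δ ≤ ε₀ := by linarith
  refine ⟨δ, C₂ * C₁ * (3 * δ) ^ θ * (Real.exp D / δ) ^ η, hδ, by positivity, ?_⟩
  intro y y' q q' hyy' hqy hqy' hqq'
  have hQu : ∀ x y, c.Q y * Ku x y = Ku x y := hu.Q_mul
  -- A degenerate unstable side would never reach the stopping scale. Here uniqueness of the bracket
  -- gives `q = q'`, and the quadrilateral collapses.
  rcases eq_or_ne y y' with rfl | hne
  · have hq : q = br q y ∧ q' = br q y := by
      have hdq : dist q y ≤ 2 * ε₂ := (hqy 0).trans (by linarith)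
      have := hbr q y hdq
      constructor
      · have : q ∈ localUnstable T ε₀ q ∩ localStable T ε₀ y :=
          ⟨mem_localUnstable_self T hε₀.le q, localStable_mono hδε₀ _ hqy⟩
        rwa [hbr q y hdq] at this
      · have : q' ∈ localUnstable T ε₀ q ∩ localStable T ε₀ y :=
          ⟨localUnstable_mono e₂ _ hqq', localStable_mono hδε₀ _ hqy'⟩
        rwa [hbr q y hdq] at this
    obtain rfl : q = q' := hq.1.trans hq.2.symm
    have h1 : Ku q q = c.Q q := hu.refl q
    have h2 : Ku y y = c.Q y := hu.refl y
    rw [h1, h2, hs.mul_Q, hs.Q_mul, sub_self, norm_zero]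
    positivity
  have hD0 : 0 < dist y y' := dist_pos.2 hne
  set P : ℕ → ℝ := fun n => birkhoffSum T (ls + Lu) n q with hP
  have hPn : ∀ n : ℕ, n * l₀ ≤ P n := fun n => by
    simpa [birkhoffSum, hP] using Finset.card_nsmul_le_sum (Finset.range n)
      (fun j => ls (T^[j] q) + Lu (T^[j] q)) l₀ fun j _ => by linarith [hls (T^[j] q), hLu0 (T^[j] q)]
  have hex : ∃ n, δ < Real.exp (P n) * dist y y' := by
    obtain ⟨n, hn⟩ := exists_nat_gt (δ / dist y y' / l₀)
    refine ⟨n, ?_⟩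
    rw [div_lt_iff₀ hl₀, div_lt_iff₀ hD0] at hn
    refine hn.trans_le ?_
    gcongr
    linarith [hPn n, Real.add_one_le_exp (P n)]
  -- `n` is the last time before the rescaled unstable side first exceeds `δ`. Staying below `δ`
  -- gives the geometry of the iterated quadrilateral; exceeding it one step later bounds `Real.exp
  -- (-P n)` by a multiple of `dist y y'`.
  obtain ⟨n, hn, hn'⟩ : ∃ n, Real.exp (P n) * dist y y' ≤ δ ∧
      δ < Real.exp (P (n + 1)) * dist y y' := by
    have h0 : Nat.find hex ≠ 0 := fun h0 => by
      have := Nat.find_spec hex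
      rw [h0] at this
      simp only [hP, birkhoffSum_zero, Real.exp_zero, one_mul] at this
      exact absurd (hyy' 0) (not_le.2 (by rwa [dist_comm]))
    obtain ⟨k, hk⟩ := Nat.exists_eq_succ_of_ne_zero h0
    exact ⟨k, not_lt.1 (Nat.find_min hex (by omega)), by
      rw [← Nat.succ_eq_add_one, ← hk]
      exact Nat.find_spec hex⟩
  have geom := quadrilateral_iterate h hδ.le hLu0 hLu
    (fun x => (min_le_left _ _).trans (hls x)) e₁ hδε₀ (lt_min e₃ e₄)
    (fun x y hxy => ⟨hmod₁ x y (hxy.trans_le (min_le_left _ _)),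
      hmod₂ x y (hxy.trans_le (min_le_right _ _))⟩) hyy' hqy hqy' hqq' hn
  have hsub : ∀ x, localStable T ε₀ x ⊆ stableSet T x := fun x =>
    h.stable.localStable_subset x hε₀.le
  have hsubu : ∀ x, localUnstable T ε₀ x ⊆ unstableSet T x := fun x =>
    h.unstable.localStable_subset x hε₀.le
  rw [quadrilateral_eq_conj hs hu (hsubu _ (localUnstable_mono hδε₀ _ hyy'))
    (hsub _ (localStable_mono hδε₀ _ hqy)) (hsub _ (localStable_mono hδε₀ _ hqy'))
    (hsubu _ (localUnstable_mono e₂ _ hqq')) n]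
  set s := Real.exp (-birkhoffSum T ls n q + n * τ) * δ with hs_def
  obtain ⟨g1, g2, g3, g4, g5⟩ := geom n le_rfl
  have hs0 : 0 < s := by positivity
  have bquad := H₁ (T^[n] y) (T^[n] y') (T^[n] q) (T^[n] q') (3 * s)
    (localUnstable_mono hδε₀ _ g1) (localStable_mono hδε₀ _ (localStable_iterate hqy n))
    (localStable_mono hδε₀ _ (localStable_iterate hqy' n)) (localUnstable_mono e₂ _ g2)
    (by linarith) (by linarith) (by linarith)
    (by
      have := dist_triangle4 (T^[n] q) (T^[n] y) (T^[n] y') (T^[n] q')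
      rw [dist_comm (T^[n] y') (T^[n] q')] at this
      linarith)
    (by
      have := dist_triangle (T^[n] q') (T^[n] y') (T^[n] y)
      rw [dist_comm (T^[n] y') (T^[n] y)] at this
      linarith)
  have bcoc : ‖c.Mn n q‖ * ‖c.Nn n y'‖ ≤
      C₂ * Real.exp (η * birkhoffSum T lu n q - n * r + n * (r / 2)) := by
    refine (H₂ n q y').trans ?_
    have s1 : birkhoffSum T m n q ≤ η * birkhoffSum T lu n q := by
      rw [birkhoffSum, birkhoffSum, Finset.mul_sum]
      exact Finset.sum_le_sum fun k _ => hm _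
    have s2 : ∑ k ∈ Finset.range n, dist (T^[k] q) (T^[k] y') ≤ n * (2 * δ) := by
      have : ∀ k ∈ Finset.range n, dist (T^[k] q) (T^[k] y') ≤ 2 * δ := fun k hk => by
        have t1 : dist (T^[k] q) (T^[k] y) ≤ δ := hqy k
        have t2 : dist (T^[k] y') (T^[k] y) ≤ δ := (geom k (Finset.mem_range.1 hk).le).1 0
        have := dist_triangle_right (T^[k] q) (T^[k] y') (T^[k] y)
        linarith
      simpa using Finset.sum_le_card_nsmul _ _ _ this
    have s3 : L * ∑ k ∈ Finset.range n, dist (T^[k] q) (T^[k] y') ≤ n * (r / 2) := by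
      calc _ ≤ L * (n * (2 * δ)) := by gcongr
        _ = n * (L * (2 * δ)) := by ring
        _ ≤ _ := by gcongr
    gcongr
  -- The defining inequality of the strong bunching exponent enters here, summed along the orbit of
  -- `q`.
  have hsum : η * birkhoffSum T lu n q - θ * birkhoffSum T ls n q ≤ -(η * P n) := by
    simp only [hP, birkhoffSum, Finset.mul_sum, ← Finset.sum_sub_distrib, ← Finset.sum_neg_distrib]
    refine Finset.sum_le_sum fun k _ => ?_
    have := hstr (T^[k] q)
    rw [Pi.add_apply]
    linarith
  have hPsucc : Real.exp (-P n) ≤ Real.exp D / δ * dist y y' := by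
    have t1 : P (n + 1) ≤ P n + D := by
      simp only [hP, birkhoffSum_succ]
      linarith [le_of_abs_le (hDb (T^[n] q)), show (ls + Lu) (T^[n] q) = ls (T^[n] q) + Lu (T^[n] q)
        from rfl]
    have t2 : δ ≤ Real.exp (P n + D) * dist y y' := hn'.le.trans (by gcongr)
    rw [Real.exp_add] at t2
    rw [Real.exp_neg, div_mul_eq_mul_div, le_div_iff₀ hδ, inv_mul_le_iff₀ (Real.exp_pos _)]
    linarith
  calc _ ≤ ‖c.Nn n y'‖ * (C₁ * (3 * s) ^ θ) * ‖c.Mn n q‖ := by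
        refine (norm_mul_le _ _).trans ?_
        gcongr
        exact (norm_mul_le _ _).trans (by gcongr)
    _ = (‖c.Mn n q‖ * ‖c.Nn n y'‖) * (C₁ * (3 * s) ^ θ) := by ring
    _ ≤ (C₂ * Real.exp (η * birkhoffSum T lu n q - n * r + n * (r / 2))) * (C₁ * (3 * s) ^ θ) := by
        gcongr
    _ = C₂ * C₁ * (3 * δ) ^ θ * Real.exp (η * birkhoffSum T lu n q - θ * birkhoffSum T ls n q +
          n * (θ * τ - r / 2)) := by
        rw [hs_def, show 3 * (Real.exp (-birkhoffSum T ls n q + n * τ) * δ) =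
          Real.exp (-birkhoffSum T ls n q + n * τ) * (3 * δ) by ring,
          Real.mul_rpow (Real.exp_pos _).le (by positivity), ← Real.exp_mul]
        have e : Real.exp (η * birkhoffSum T lu n q - θ * birkhoffSum T ls n q +
            n * (θ * τ - r / 2)) = Real.exp (η * birkhoffSum T lu n q - n * r + n * (r / 2)) *
              Real.exp ((-birkhoffSum T ls n q + n * τ) * θ) := by
          rw [← Real.exp_add]
          congr 1
          ring
        rw [e]
        ring
    _ ≤ C₂ * C₁ * (3 * δ) ^ θ * Real.exp (-P n * η) := by
        gcongr
        have : (n : ℝ) * (θ * τ - r / 2) ≤ 0 :=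
          mul_nonpos_of_nonneg_of_nonpos (by positivity) (by linarith)
        linarith
    _ ≤ C₂ * C₁ * (3 * δ) ^ θ * (Real.exp D / δ * dist y y') ^ η := by
        rw [Real.exp_mul]
        gcongr
    _ = _ := by
        rw [Real.mul_rpow (by positivity) dist_nonneg]
        ring

end MatrixCocycle

end Quadrilaterals

end HolderCocycle

namespace HolderCocycle

/-! ### Linear algebra: dimension and stability of linear independence. -/

section LinearAlgebra

variable {W : Type*} [NormedAddCommGroup W] [NormedSpace ℝ W]

theorem finrank_le_of_leftInverse [FiniteDimensional ℝ W] {F G : Submodule ℝ W} (A B : W →L[ℝ] W)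
    (hA : ∀ v ∈ F, A v ∈ G) (hB : ∀ v ∈ F, B (A v) = v) :
    Module.finrank ℝ F ≤ Module.finrank ℝ G := by
  refine LinearMap.finrank_le_finrank_of_injective (f := (A : W →ₗ[ℝ] W).restrict hA) ?_
  intro v w hvw
  have : A v = A w := congrArg Subtype.val hvw
  ext
  rw [← hB v v.2, this, hB w w.2]

/-- A linearly independent family stays uniformly linearly independent after a small
perturbation. -/
theorem eventually_norm_le_norm_sum {Y : Type*} [TopologicalSpace Y] {p : ℕ} {f : Fin p → Y → W}
    {y₀ : Y} (hf : ∀ i, ContinuousAt (f i) y₀) (hli : LinearIndependent ℝ fun i => f i y₀) :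
    ∃ κ, 0 < κ ∧ ∀ᶠ y in 𝓝 y₀, ∀ a : Fin p → ℝ, κ * ‖a‖ ≤ ‖∑ i, a i • f i y‖ := by
  obtain ⟨K, hK, hanti⟩ := LinearMap.exists_antilipschitzWith
    (Fintype.linearCombination ℝ fun i => f i y₀)
    (LinearMap.ker_eq_bot.2 (linearIndependent_iff_injective_fintypeLinearCombination.1 hli))
  have hK' : (0 : ℝ) < K := hK
  have h0 : Tendsto (fun y => ∑ i, ‖f i y - f i y₀‖) (𝓝 y₀) (𝓝 0) := by
    have := tendsto_finsetSum Finset.univ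
      fun i _ => tendsto_iff_norm_sub_tendsto_zero.1 (hf i)
    simpa using this
  refine ⟨1 / (2 * K), by positivity, ?_⟩
  filter_upwards [h0.eventually_lt_const (show (0 : ℝ) < 1 / (2 * K) by positivity)] with y hy a
  have h1 : ‖a‖ ≤ K * ‖∑ i, a i • f i y₀‖ := by
    simpa [Fintype.linearCombination_apply] using hanti.le_mul_dist a 0
  have h2 : ‖∑ i, a i • f i y₀‖ ≤ ‖∑ i, a i • f i y‖ + ‖a‖ * (1 / (2 * K)) := by
    have e : ∑ i, a i • f i y₀ = ∑ i, a i • f i y - ∑ i, a i • (f i y - f i y₀) := by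
      simp [smul_sub]
    rw [e]
    refine (norm_sub_le _ _).trans (add_le_add le_rfl ?_)
    calc _ ≤ ∑ i, ‖a‖ * ‖f i y - f i y₀‖ := by
          refine norm_sum_le_of_le _ fun i _ => ?_
          rw [norm_smul]
          gcongr
          exact norm_le_pi_norm a i
      _ ≤ _ := by rw [← Finset.mul_sum]; gcongr
  have h3 : ‖a‖ ≤ K * ‖∑ i, a i • f i y‖ + ‖a‖ / 2 := by
    calc ‖a‖ ≤ K * (‖∑ i, a i • f i y‖ + ‖a‖ * (1 / (2 * K))) := h1.trans (by gcongr)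
      _ = _ := by field_simp
  rw [div_mul_eq_mul_div, one_mul, div_le_iff₀ (by positivity)]
  linarith

theorem linearIndependent_of_norm_le {p : ℕ} {f : Fin p → W} {κ : ℝ} (hκ : 0 < κ)
    (h : ∀ a : Fin p → ℝ, κ * ‖a‖ ≤ ‖∑ i, a i • f i‖) : LinearIndependent ℝ f := by
  refine Fintype.linearIndependent_iff.2 fun a ha i => ?_
  have := h a
  rw [ha, norm_zero] at this
  have : ‖a‖ = 0 := le_antisymm (nonpos_of_mul_nonpos_right this hκ) (norm_nonneg _)
  rw [norm_eq_zero] at this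
  rw [this, Pi.zero_apply]

theorem exists_eq_sum_of_linearIndependent {p : ℕ} {F : Submodule ℝ W} [FiniteDimensional ℝ F]
    (hF : Module.finrank ℝ F = p) {f : Fin p → W} (hf : ∀ i, f i ∈ F)
    (hli : LinearIndependent ℝ f) {v : W} (hv : v ∈ F) : ∃ a : Fin p → ℝ, v = ∑ i, a i • f i := by
  have hspan : Submodule.span ℝ (range f) = F := by
    refine Submodule.eq_of_le_of_finrank_eq
      (Submodule.span_le.2 (by rintro _ ⟨i, rfl⟩; exact hf i)) ?_
    rw [finrank_span_eq_card hli, Fintype.card_fin, hF]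
  rw [← hspan, Submodule.mem_span_range_iff_exists_fun] at hv
  obtain ⟨a, ha⟩ := hv
  exact ⟨a, ha.symm⟩

end LinearAlgebra

/-! ### Saturated sets of vectors, the spans they generate, and brackets. -/

section Spans

variable {X : Type*} [MetricSpace X] {W : Type*} [NormedAddCommGroup W] [NormedSpace ℝ W]

namespace MatrixCocycle

variable {T : X ≃ₜ X} {θ : ℝ} (c : MatrixCocycle T θ W)

/-- A set of vectors on the bundle that is invariant under the cocycle and under its unstable
holonomies. -/
structure IsSaturated (Ku : X → X → W →L[ℝ] W) (R : Set (X × W)) : Prop where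
  nonempty : R.Nonempty
  ne_zero : ∀ p ∈ R, p.2 ≠ 0
  Q_apply : ∀ p ∈ R, c.Q p.1 p.2 = p.2
  map : ∀ p ∈ R, (T p.1, c.M p.1 p.2) ∈ R
  unstable : ∀ p ∈ R, ∀ z ∈ unstableSet T p.1, (z, Ku p.1 z p.2) ∈ R

/-- The span of the vectors in the fiber over `y` that are obtained from vectors in `R` by stable
holonomies. -/
def spanAt (T : X ≃ₜ X) (Ks : X → X → W →L[ℝ] W) (R : Set (X × W)) (y : X) : Submodule ℝ W :=
  Submodule.span ℝ {v | ∃ p ∈ R, p.1 ∈ stableSet T y ∧ v = Ks p.1 y p.2}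

variable {c} {Ks Ku : X → X → W →L[ℝ] W} {R : Set (X × W)} {ε₀ : ℝ}

namespace IsSaturated

variable (hR : c.IsSaturated Ku R)
include hR

theorem iterate {p : X × W} (hp : p ∈ R) (n : ℕ) : (T^[n] p.1, c.Mn n p.1 p.2) ∈ R := by
  induction n with
  | zero =>
    rw [Mn_zero, hR.Q_apply p hp]
    exact hp
  | succ n ih =>
    rw [Function.iterate_succ_apply', Mn_succ']
    exact hR.map _ ih

variable (hs : c.IsStableFamily ε₀ Ks)
include hs

omit hR in
theorem Q_apply_of_mem {y : X} {v : W} (hv : v ∈ spanAt T Ks R y) : c.Q y v = v := by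
  induction hv using Submodule.span_induction with
  | mem v hv =>
    obtain ⟨p, -, -, rfl⟩ := hv
    exact DFunLike.congr_fun (hs.Q_mul p.1 y) p.2
  | zero => simp
  | add _ _ _ _ h₁ h₂ => rw [map_add, h₁, h₂]
  | smul a _ _ h => rw [map_smul, h]

/-- On generators this combines equivariance of stable holonomies with invariance of `R` under the
cocycle. -/
theorem M_apply_mem {y : X} {v : W} (hv : v ∈ spanAt T Ks R y) :
    c.M y v ∈ spanAt T Ks R (T y) := by
  induction hv using Submodule.span_induction with
  | mem v hv =>
    obtain ⟨p, hp, hpy, rfl⟩ := hv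
    refine Submodule.subset_span ⟨_, hR.map p hp, stableSet_map hpy, ?_⟩
    exact DFunLike.congr_fun (hs.equivariant p.1 y (mem_stableSet_comm.1 hpy)) p.2
  | zero => simp
  | add _ _ _ _ h₁ h₂ => rw [map_add]; exact add_mem h₁ h₂
  | smul a _ _ h => rw [map_smul]; exact Submodule.smul_mem _ _ h

theorem Mn_apply_mem {y : X} {v : W} (hv : v ∈ spanAt T Ks R y) (n : ℕ) :
    c.Mn n y v ∈ spanAt T Ks R (T^[n] y) := by
  induction n with
  | zero =>
    rw [Mn_zero, Q_apply_of_mem hs hv]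
    exact hv
  | succ n ih =>
    rw [Function.iterate_succ_apply', Mn_succ']
    exact hR.M_apply_mem hs ih

omit hR in
theorem Ks_apply_mem {y y' : X} (hy : y' ∈ stableSet T y) {v : W}
    (hv : v ∈ spanAt T Ks R y) : Ks y y' v ∈ spanAt T Ks R y' := by
  induction hv using Submodule.span_induction with
  | mem v hv =>
    obtain ⟨p, hp, hpy, rfl⟩ := hv
    refine Submodule.subset_span ⟨p, hp, mem_stableSet_trans (mem_stableSet_comm.1 hy) hpy, ?_⟩
    exact DFunLike.congr_fun (hs.comp p.1 y y' (mem_stableSet_comm.1 hpy) hy) p.2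
  | zero => simp
  | add _ _ _ _ h₁ h₂ => rw [map_add]; exact add_mem h₁ h₂
  | smul a _ _ h => rw [map_smul]; exact Submodule.smul_mem _ _ h

theorem finrank_le_finrank_map [FiniteDimensional ℝ W] (y : X) :
    Module.finrank ℝ (spanAt T Ks R y) ≤ Module.finrank ℝ (spanAt T Ks R (T y)) := by
  refine finrank_le_of_leftInverse (c.M y) (c.N y) (fun v hv => hR.M_apply_mem hs hv)
    fun v hv => ?_
  exact (DFunLike.congr_fun (c.N_mul_M y) v).trans (Q_apply_of_mem hs hv)

omit hR in
theorem finrank_le_finrank_stable [FiniteDimensional ℝ W] {y y' : X} (hy : y' ∈ stableSet T y) :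
    Module.finrank ℝ (spanAt T Ks R y) ≤ Module.finrank ℝ (spanAt T Ks R y') := by
  refine finrank_le_of_leftInverse (Ks y y') (Ks y' y)
    (fun v hv => Ks_apply_mem hs hy hv) fun v hv => ?_
  exact (DFunLike.congr_fun (hs.symm_mul hy) v).trans (Q_apply_of_mem hs hv)

omit hR in
/-- After some iterates, a basis of `spanAt` is obtained from vectors on a small local stable
set. -/
theorem exists_frame [FiniteDimensional ℝ W] (y₀ : X) {p : ℕ}
    (hp : Module.finrank ℝ (spanAt T Ks R y₀) = p) {δ : ℝ} (hδ : 0 < δ) :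
    ∃ (m : ℕ) (P : Fin p → X × W),
      (∀ i, P i ∈ R) ∧ (∀ i, T^[m] (P i).1 ∈ localStable T δ (T^[m] y₀)) ∧
      LinearIndependent ℝ fun i =>
        Ks (T^[m] (P i).1) (T^[m] y₀) (c.Mn m (P i).1 (P i).2) := by
  subst hp
  obtain ⟨f, hf, hli⟩ : ∃ f : Fin (Module.finrank ℝ (spanAt T Ks R y₀)) → W,
      (∀ i, f i ∈ {v | ∃ p ∈ R, p.1 ∈ stableSet T y₀ ∧ v = Ks p.1 y₀ p.2}) ∧
      LinearIndependent ℝ f := by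
    obtain ⟨f, hf, -, hli⟩ := Submodule.exists_fun_fin_finrank_span_eq ℝ
      {v | ∃ p ∈ R, p.1 ∈ stableSet T y₀ ∧ v = Ks p.1 y₀ p.2}
    exact ⟨f, hf, hli⟩
  choose P hP hPs hPf using hf
  choose k hk using fun i => exists_iterate_mem_localStable (hPs i) hδ
  -- The sum dominates every `k i`, hence is a common time at which all generators have become
  -- locally stable.
  refine ⟨∑ i, k i, P, hP,
    fun i => hk i _ (Finset.single_le_sum (fun _ _ => Nat.zero_le _) (Finset.mem_univ i)), ?_⟩
  set m := ∑ i, k i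
  have e : (fun i => Ks (T^[m] (P i).1) (T^[m] y₀) (c.Mn m (P i).1 (P i).2)) =
      fun i => c.Mn m y₀ (f i) := by
    funext i
    rw [hPf i]
    exact (DFunLike.congr_fun (hs.equivariant_iterate (mem_stableSet_comm.1 (hPs i)) m)
      (P i).2).symm
  rw [e]
  -- `Mn` is invertible only between fibers. Independence is pulled back along `Nn`, which undoes
  -- `Mn` on vectors fixed by the projection.
  refine LinearIndependent.of_comp (c.Nn m y₀ : W →ₗ[ℝ] W) ?_
  have e' : (c.Nn m y₀ : W →ₗ[ℝ] W) ∘ (fun i => c.Mn m y₀ (f i)) = f := by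
    funext i
    exact (DFunLike.congr_fun (c.Nn_mul_Mn m y₀) (f i)).trans
      (Q_apply_of_mem hs (Submodule.subset_span ⟨P i, hP i, hPs i, hPf i⟩))
  rw [e']
  exact hli

end IsSaturated

end MatrixCocycle

/-- A bracket of a hyperbolic homeomorphism. -/
structure IsBracket (T : X ≃ₜ X) (ε₀ ε₁ C : ℝ) (br : X → X → X) : Prop where
  eps_pos : 0 < ε₁
  const_pos : 0 < C
  eq : ∀ x y, dist x y ≤ 2 * ε₁ → localUnstable T ε₀ x ∩ localStable T ε₀ y = {br x y}
  continuousOn : ContinuousOn (fun p : X × X => br p.1 p.2) {p | dist p.1 p.2 ≤ 2 * ε₁}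
  le : ∀ x y, dist x y ≤ 2 * ε₁ → max (dist (br x y) x) (dist (br x y) y) ≤ C * dist x y

theorem IsHyperbolic.exists_isBracket {T : X ≃ₜ X} {ε₀ : ℝ} {lu ls : X → ℝ}
    (h : IsHyperbolic T ε₀ lu ls) : ∃ ε₁ C br, IsBracket T ε₀ ε₁ C br := by
  obtain ⟨ε₁, h1, -, br, h2, h3, C, hC, h4⟩ := h.bracket
  exact ⟨ε₁, C, br, h1, hC, h2, h3, h4⟩

namespace IsBracket

variable {T : X ≃ₜ X} {ε₀ ε₁ C : ℝ} {br : X → X → X} (hbr : IsBracket T ε₀ ε₁ C br)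
include hbr

theorem mem_localUnstable {x y : X} (h : dist x y ≤ 2 * ε₁) : br x y ∈ localUnstable T ε₀ x :=
  ((hbr.eq x y h).symm ▸ mem_singleton (br x y)).1

theorem mem_localStable {x y : X} (h : dist x y ≤ 2 * ε₁) : br x y ∈ localStable T ε₀ y :=
  ((hbr.eq x y h).symm ▸ mem_singleton (br x y)).2

theorem eq_of_mem {x y z : X} (h : dist x y ≤ 2 * ε₁) (hu : z ∈ localUnstable T ε₀ x)
    (hs : z ∈ localStable T ε₀ y) : br x y = z := by
  have : z ∈ localUnstable T ε₀ x ∩ localStable T ε₀ y := ⟨hu, hs⟩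
  rw [hbr.eq x y h] at this
  exact this.symm

theorem continuousAt {x y : X} (h : dist x y < 2 * ε₁) :
    ContinuousAt (fun p : X × X => br p.1 p.2) (x, y) := by
  refine hbr.continuousOn.continuousAt ?_
  filter_upwards [(isOpen_lt (continuous_fst.dist continuous_snd) continuous_const).mem_nhds
    (show (x, y) ∈ {p : X × X | dist p.1 p.2 < 2 * ε₁} from h)] with p hp
  exact le_of_lt hp

end IsBracket

end Spans

end HolderCocycle

namespace HolderCocycle

/-! ### Continuous local sections of the spans and constancy of their dimension. -/

section LocalSections

variable {X : Type*} [MetricSpace X] {W : Type*} [NormedAddCommGroup W] [NormedSpace ℝ W]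

namespace MatrixCocycle

variable {T : X ≃ₜ X} {θ : ℝ} {c : MatrixCocycle T θ W} {Ks Ku : X → X → W →L[ℝ] W}
  {R : Set (X × W)} {ε₀ ε₁ C : ℝ} {lu ls : X → ℝ} {br : X → X → X}

/-- Extension of a vector `ω` over `ζ` to a neighborhood, by means of holonomies along the local
product structure. -/
def localSection (Ks Ku : X → X → W →L[ℝ] W) (br : X → X → X) (ζ : X) (ω : W) (y : X) : W :=
  Ks (br ζ y) y (Ku ζ (br ζ y) ω)

theorem continuousAt_localSection {hθ : 0 ≤ θ} {hT : ∃ K : ℝ≥0, LipschitzWith K T.symm}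
    (hbr : IsBracket T ε₀ ε₁ C br) (hs : c.IsStableFamily ε₀ Ks)
    (hu : (c.rev hθ hT).IsStableFamily ε₀ Ku) {ζ y : X} (hy : dist ζ y < 2 * ε₁) (ω : W) :
    ContinuousAt (localSection Ks Ku br ζ ω) y := by
  have hopen : IsOpen {y | dist ζ y < 2 * ε₁} :=
    isOpen_lt (continuous_const.dist continuous_id) continuous_const
  have hbrc : ContinuousOn (fun y => br ζ y) {y | dist ζ y < 2 * ε₁} := fun y hy =>
    (ContinuousAt.comp (f := fun y => (ζ, y)) (hbr.continuousAt hy)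
      (by fun_prop)).continuousWithinAt
  have h1 : ContinuousOn (fun y => Ks (br ζ y) y) {y | dist ζ y < 2 * ε₁} :=
    hs.continuousOn.comp (f := fun y => (br ζ y, y)) (hbrc.prodMk continuousOn_id)
      fun y hy => mem_localStable_comm.1 (hbr.mem_localStable (le_of_lt hy))
  have h2 : ContinuousOn (fun y => Ku ζ (br ζ y)) {y | dist ζ y < 2 * ε₁} :=
    hu.continuousOn.comp (f := fun y => (ζ, br ζ y)) (continuousOn_const.prodMk hbrc)
      fun y hy => hbr.mem_localUnstable (le_of_lt hy)
  exact (h1.clm_apply (h2.clm_apply continuousOn_const)).continuousAt (hopen.mem_nhds hy)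

/-- If `ζ` is already on the local stable set of `y`, it is its own bracket with `y`, and the
unstable leg is trivial. Thus the sections take the prescribed frame as values at the base point. -/
theorem localSection_eq {hθ : 0 ≤ θ} {hT : ∃ K : ℝ≥0, LipschitzWith K T.symm}
    (hbr : IsBracket T ε₀ ε₁ C br) (hε₀ : 0 ≤ ε₀)
    (hu : (c.rev hθ hT).IsStableFamily ε₀ Ku) {ζ y : X} (hy : dist ζ y ≤ 2 * ε₁)
    (hζ : ζ ∈ localStable T ε₀ y) {ω : W} (hω : c.Q ζ ω = ω) :
    localSection Ks Ku br ζ ω y = Ks ζ y ω := by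
  have h1 : Ku ζ ζ = c.Q ζ := hu.refl ζ
  rw [localSection, hbr.eq_of_mem hy (mem_localUnstable_self T hε₀ ζ) hζ, h1, hω]

variable [CompactSpace X]

theorem localSection_mem (h : IsHyperbolic T ε₀ lu ls) (hbr : IsBracket T ε₀ ε₁ C br)
    (hR : c.IsSaturated Ku R) {p : X × W} (hp : p ∈ R) {y : X} (hy : dist p.1 y ≤ 2 * ε₁) :
    localSection Ks Ku br p.1 p.2 y ∈ spanAt T Ks R y := by
  refine Submodule.subset_span ⟨(br p.1 y, Ku p.1 (br p.1 y) p.2), hR.unstable p hp _ ?_, ?_, rfl⟩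
  · exact h.unstable.localStable_subset _ h.eps_pos.le (hbr.mem_localUnstable hy)
  · exact h.stable.localStable_subset _ h.eps_pos.le (hbr.mem_localStable hy)

/-- Frames on small local stable sets exist only after `m` iterates, so sections must be pulled
back. Both holonomies commute with the cocycle, hence the pulled-back vector is itself a holonomy
image, through the `m`-th preimage of the bracket point. No equality of dimensions is available yet
to argue more directly. -/
theorem Nn_localSection_mem {hθ : 0 ≤ θ} (h : IsHyperbolic T ε₀ lu ls)
    (hbr : IsBracket T ε₀ ε₁ C br) (hs : c.IsStableFamily ε₀ Ks)
    (hu : (c.rev hθ h.lipschitz_symm).IsStableFamily ε₀ Ku)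
    (hR : c.IsSaturated Ku R) {p : X × W} (hp : p ∈ R) {y : X} {m : ℕ}
    (hy : dist (T^[m] p.1) (T^[m] y) ≤ 2 * ε₁) :
    c.Nn m y (localSection Ks Ku br (T^[m] p.1) (c.Mn m p.1 p.2) (T^[m] y)) ∈
      spanAt T Ks R y := by
  set q := br (T^[m] p.1) (T^[m] y) with hq
  have hqu : q ∈ unstableSet T (T^[m] p.1) :=
    h.unstable.localStable_subset _ h.eps_pos.le (hbr.mem_localUnstable hy)
  have hqs : q ∈ stableSet T (T^[m] y) :=
    h.stable.localStable_subset _ h.eps_pos.le (hbr.mem_localStable hy)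
  have hqm : T^[m] (T.symm^[m] q) = q := iterate_symm_iterate T m q
  have hqu' : T.symm^[m] q ∈ unstableSet T p.1 := by
    rwa [← unstableSet_iterate_iff m, hqm]
  have hqs' : T.symm^[m] q ∈ stableSet T y := by
    rwa [← stableSet_iterate_iff m, hqm]
  have hv : Ks (T.symm^[m] q) y (Ku p.1 (T.symm^[m] q) p.2) ∈ spanAt T Ks R y :=
    Submodule.subset_span ⟨_, hR.unstable p hp _ hqu', hqs', rfl⟩
  have e : localSection Ks Ku br (T^[m] p.1) (c.Mn m p.1 p.2) (T^[m] y) =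
      c.Mn m y (Ks (T.symm^[m] q) y (Ku p.1 (T.symm^[m] q) p.2)) := by
    have e1 := hs.equivariant_iterate (mem_stableSet_comm.1 hqs') m
    have e2 := hu.rev_equivariant_iterate hqu' m
    rw [hqm] at e1 e2
    have e1' : c.Mn m y (Ks (T.symm^[m] q) y (Ku p.1 (T.symm^[m] q) p.2)) =
        Ks q (T^[m] y) (c.Mn m (T.symm^[m] q) (Ku p.1 (T.symm^[m] q) p.2)) :=
      DFunLike.congr_fun e1 (Ku p.1 (T.symm^[m] q) p.2)
    have e2' : c.Mn m (T.symm^[m] q) (Ku p.1 (T.symm^[m] q) p.2) =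
        Ku (T^[m] p.1) q (c.Mn m p.1 p.2) := DFunLike.congr_fun e2 p.2
    rw [e1', e2']
    rfl
  rw [e]
  have e3 := (DFunLike.congr_fun (c.Nn_mul_Mn m y)
    (Ks (T.symm^[m] q) y (Ku p.1 (T.symm^[m] q) p.2))).trans (IsSaturated.Q_apply_of_mem hs hv)
  exact e3.symm ▸ hv

variable [FiniteDimensional ℝ W]

/-- Near each point, there are continuous sections of `spanAt` that form a basis at that point. -/
theorem exists_continuousAt_sections (hθ : 0 < θ) (h : IsHyperbolic T ε₀ lu ls)
    (hbr : IsBracket T ε₀ ε₁ C br) (hs : c.IsStableFamily ε₀ Ks)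
    (hu : (c.rev hθ.le h.lipschitz_symm).IsStableFamily ε₀ Ku) (hR : c.IsSaturated Ku R) (y₀ : X)
    {p : ℕ} (hp : Module.finrank ℝ (spanAt T Ks R y₀) = p) :
    ∃ s : Fin p → X → W, (∀ᶠ y in 𝓝 y₀, ∀ i, s i y ∈ spanAt T Ks R y) ∧
      (∀ i, ContinuousAt (s i) y₀) ∧ LinearIndependent ℝ fun i => s i y₀ := by
  have hε₁ := hbr.eps_pos
  obtain ⟨m, P, hP, hPs, hli⟩ := IsSaturated.exists_frame hs y₀ hp (lt_min hε₁ h.eps_pos)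
  have hd : ∀ i, dist (T^[m] (P i).1) (T^[m] y₀) < 2 * ε₁ := fun i => by
    linarith [(hPs i 0).trans (min_le_left _ _), show dist (T^[m] (P i).1) (T^[m] y₀) =
      dist (T^[0] (T^[m] (P i).1)) (T^[0] (T^[m] y₀)) from rfl]
  have hTm : Continuous T^[m] := T.continuous.iterate m
  refine ⟨fun i y => c.Nn m y (localSection Ks Ku br (T^[m] (P i).1)
    (c.Mn m (P i).1 (P i).2) (T^[m] y)), ?_, fun i => ?_, ?_⟩
  · refine eventually_all.2 fun i => ?_
    filter_upwards [(isOpen_lt (continuous_const.dist hTm) continuous_const).mem_nhds (hd i)]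
      with y hy
    exact Nn_localSection_mem h hbr hs hu hR (hP i) (le_of_lt hy)
  · exact (c.continuous_Nn hθ m).continuousAt.clm_apply
      (ContinuousAt.comp (continuousAt_localSection hbr hs hu (hd i) _) hTm.continuousAt)
  · have hQ : ∀ i, c.Q (T^[m] (P i).1) (c.Mn m (P i).1 (P i).2) = c.Mn m (P i).1 (P i).2 :=
      fun i => DFunLike.congr_fun (c.Q_mul_Mn m (P i).1) (P i).2
    have e := fun i => localSection_eq (Ks := Ks) hbr h.eps_pos.le hu (hd i).le
      (localStable_mono (min_le_right _ _) _ (hPs i)) (hQ i)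
    simp only [e]
    refine LinearIndependent.of_comp (c.Mn m y₀ : W →ₗ[ℝ] W) ?_
    convert hli using 1
    funext i
    have e1 := DFunLike.congr_fun (c.Mn_mul_Nn m y₀)
      (Ks (T^[m] (P i).1) (T^[m] y₀) (c.Mn m (P i).1 (P i).2))
    refine e1.trans ?_
    exact DFunLike.congr_fun (hs.Q_mul _ (T^[m] y₀)) _

/-- Continuous sections that are independent at a point remain so nearby. -/
theorem eventually_finrank_le (hθ : 0 < θ) (h : IsHyperbolic T ε₀ lu ls)
    (hbr : IsBracket T ε₀ ε₁ C br) (hs : c.IsStableFamily ε₀ Ks)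
    (hu : (c.rev hθ.le h.lipschitz_symm).IsStableFamily ε₀ Ku) (hR : c.IsSaturated Ku R) (y₀ : X) :
    ∀ᶠ y in 𝓝 y₀, Module.finrank ℝ (spanAt T Ks R y₀) ≤ Module.finrank ℝ (spanAt T Ks R y) := by
  obtain ⟨s, hmem, hcont, hli⟩ := exists_continuousAt_sections hθ h hbr hs hu hR y₀ rfl
  obtain ⟨κ, hκ, hev⟩ := eventually_norm_le_norm_sum hcont hli
  filter_upwards [hmem, hev] with y hy hy'
  have := (linearIndependent_of_norm_le hκ hy')
  have hle : Submodule.span ℝ (range fun i => s i y) ≤ spanAt T Ks R y :=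
    Submodule.span_le.2 (by rintro _ ⟨i, rfl⟩; exact hy i)
  have := Submodule.finrank_mono hle
  rwa [finrank_span_eq_card ‹_›, Fintype.card_fin] at this

/-- By transitivity, the dimension of `spanAt` is constant. -/
theorem exists_finrank_eq (hθ : 0 < θ) (h : IsHyperbolic T ε₀ lu ls) (hT : IsTransitive T)
    (hs : c.IsStableFamily ε₀ Ks)
    (hu : (c.rev hθ.le h.lipschitz_symm).IsStableFamily ε₀ Ku) (hR : c.IsSaturated Ku R) :
    ∃ p, 0 < p ∧ ∀ y, Module.finrank ℝ (spanAt T Ks R y) = p := by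
  obtain ⟨ε₁, C, br, hbr⟩ := h.exists_isBracket
  obtain ⟨⟨x₀, w₀⟩, h₀⟩ := hR.nonempty
  have hne : (range fun y => Module.finrank ℝ (spanAt T Ks R y)).Nonempty := ⟨_, x₀, rfl⟩
  have hbdd : BddAbove (range fun y => Module.finrank ℝ (spanAt T Ks R y)) :=
    ⟨Module.finrank ℝ W, by rintro _ ⟨y, rfl⟩; exact Submodule.finrank_le _⟩
  obtain ⟨y₀, hy₀⟩ := Nat.sSup_mem hne hbdd
  have hmax : ∀ y, Module.finrank ℝ (spanAt T Ks R y) ≤ Module.finrank ℝ (spanAt T Ks R y₀) :=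
    fun y => (le_csSup hbdd ⟨y, rfl⟩).trans_eq hy₀.symm
  set p := Module.finrank ℝ (spanAt T Ks R y₀) with hp
  have hpos : 0 < p := by
    refine lt_of_lt_of_le ?_ (hmax x₀)
    have hw : w₀ ∈ spanAt T Ks R x₀ := Submodule.subset_span
      ⟨_, h₀, mem_stableSet_self T x₀, by rw [hs.refl]; exact (hR.Q_apply _ h₀).symm⟩
    rw [Module.finrank_pos_iff_exists_ne_zero]
    exact ⟨⟨w₀, hw⟩, fun h0 => hR.ne_zero _ h₀ (congrArg Subtype.val h0)⟩
  refine ⟨p, hpos, fun y => le_antisymm (hmax y) ?_⟩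
  by_contra hy
  -- `K` is closed by semicontinuity, backward invariant because the dimension does not drop under
  -- `T`, and stably saturated because it is constant on stable sets. If nonempty, it would be
  -- everything, including the maximizer `y₀`.
  set K := {y | Module.finrank ℝ (spanAt T Ks R y) < p} with hK
  have hKc : IsClosed K := by
    rw [← isOpen_compl_iff, isOpen_iff_mem_nhds]
    intro z hz
    filter_upwards [eventually_finrank_le hθ h hbr hs hu hR z] with z' hz'
    have hz₀ : ¬ Module.finrank ℝ (spanAt T Ks R z) < p := hz
    exact not_lt.2 ((not_lt.1 hz₀).trans hz')
  have hKu := h.eq_univ_of_stable_saturated hT one_pos hKc ⟨y, not_le.1 hy⟩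
    (fun z hz => by
      have := hR.finrank_le_finrank_map hs (T.symm z)
      rw [T.apply_symm_apply] at this
      exact lt_of_le_of_lt this hz)
    (fun z hz z' hz' _ => by
      refine lt_of_le_of_lt (IsSaturated.finrank_le_finrank_stable hs ?_) hz
      exact mem_stableSet_comm.1 (h.stable.localStable_subset _ h.eps_pos.le hz'))
  have h₁ : y₀ ∈ K := hKu ▸ mem_univ y₀
  have h₂ : Module.finrank ℝ (spanAt T Ks R y₀) < p := h₁
  exact lt_irrefl _ h₂

end MatrixCocycle

end LocalSections

end HolderCocycle

namespace HolderCocycle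

/-! ### Invariance of the spans under unstable holonomies, by each of the two bunching alternatives.
-/

section UnstableInvariance

variable {X : Type*} [MetricSpace X] [CompactSpace X]

namespace MatrixCocycle

section

variable {W : Type*} [NormedAddCommGroup W] [NormedSpace ℝ W] [FiniteDimensional ℝ W]
  {T : X ≃ₜ X} {θ : ℝ} {c : MatrixCocycle T θ W} {Ks Ku : X → X → W →L[ℝ] W}
  {R : Set (X × W)} {ε₀ ε₁ C : ℝ} {lu ls : X → ℝ} {br : X → X → X}

omit [CompactSpace X] [FiniteDimensional ℝ W] in
theorem IsSaturated.mem_spanAt (hR : c.IsSaturated Ku R) (hs : c.IsStableFamily ε₀ Ks) {z : X}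
    {w : W} (hw : (z, w) ∈ R) : w ∈ spanAt T Ks R z :=
  Submodule.subset_span ⟨_, hw, mem_stableSet_self T _, by
    rw [hs.refl]
    exact (hR.Q_apply _ hw).symm⟩

omit [CompactSpace X] in
-- With constant dimension, the injective map `Mn` between spans is onto, so that its inverse also
-- respects them.
theorem IsSaturated.Nn_apply_mem (hR : c.IsSaturated Ku R) (hs : c.IsStableFamily ε₀ Ks) {p : ℕ}
    (hp : ∀ y, Module.finrank ℝ (spanAt T Ks R y) = p) {n : ℕ} {y : X} {v : W}
    (hv : v ∈ spanAt T Ks R (T^[n] y)) : c.Nn n y v ∈ spanAt T Ks R y := by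
  have hleft : ∀ v ∈ spanAt T Ks R y, c.Nn n y (c.Mn n y v) = v := fun v hv =>
    (DFunLike.congr_fun (c.Nn_mul_Mn n y) v).trans (Q_apply_of_mem hs hv)
  have hle : (spanAt T Ks R y).map (c.Mn n y : W →ₗ[ℝ] W) ≤ spanAt T Ks R (T^[n] y) :=
    Submodule.map_le_iff_le_comap.2 fun w hw => hR.Mn_apply_mem hs hw n
  have heq := Submodule.eq_of_le_of_finrank_le hle (by
    rw [hp, ← hp y]
    exact finrank_le_of_leftInverse (c.Mn n y) (c.Nn n y)
      (fun w hw => Submodule.mem_map_of_mem hw) hleft)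
  rw [← heq] at hv
  obtain ⟨w, hw, rfl⟩ := hv
  exact (hleft w hw).symm ▸ hw

/-- If the stable holonomies are `η`-Hölder along the unstable sets, so is `spanAt`, locally. -/
theorem exists_norm_sub_le_of_quadrilateral (hθ : 0 < θ) (h : IsHyperbolic T ε₀ lu ls)
    (hbr : IsBracket T ε₀ ε₁ C br) (hs : c.IsStableFamily ε₀ Ks)
    (hu : (c.rev hθ.le h.lipschitz_symm).IsStableFamily ε₀ Ku) (hR : c.IsSaturated Ku R) {p : ℕ}
    (hp : ∀ y, Module.finrank ℝ (spanAt T Ks R y) = p) {δ D η : ℝ} (hδ : 0 < δ) (hD : 0 < D)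
    (hquad : ∀ y y' q q', y' ∈ localUnstable T δ y → q ∈ localStable T δ y →
      q' ∈ localStable T δ y' → q' ∈ localUnstable T (3 * δ) q →
      ‖Ks q' y' * Ku q q' - Ku y y' * Ks q y‖ ≤ D * dist y y' ^ η) (y₀ : X) :
    ∃ (m : ℕ) (A r : ℝ), 0 ≤ A ∧ 0 < r ∧ ∀ y y', dist y (T^[m] y₀) < r → dist y' (T^[m] y₀) < r →
      y' ∈ localUnstable T δ y → ∀ v ∈ spanAt T Ks R y, ∃ v' ∈ spanAt T Ks R y',
        ‖Ku y y' v - v'‖ ≤ A * dist y y' ^ η * ‖v‖ := by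
  have hε₁ := hbr.eps_pos
  have hC := hbr.const_pos
  have hε₀ := h.eps_pos
  obtain ⟨B, hB, hKu⟩ := hu.exists_bound hθ
  -- The size is chosen so that brackets of the frame points `ζ i` with nearby points are defined
  -- and lie within `δ` of those points; then `hquad` applies.
  set ρ := min ε₁ (δ / (2 * C)) with hρ
  have hρ0 : 0 < ρ := by positivity
  have hρδ : C * (2 * ρ) ≤ δ := by
    have : ρ ≤ δ / (2 * C) := min_le_right _ _
    rw [le_div_iff₀ (by positivity)] at this
    linarith
  have hρε : ρ ≤ ε₁ := min_le_left _ _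
  obtain ⟨m, P, hP, hPs, hli⟩ := IsSaturated.exists_frame hs y₀ (hp y₀) (lt_min hρ0 hε₀)
  set η₀ := T^[m] y₀ with hη₀
  set ζ := fun i => T^[m] (P i).1 with hζ
  set ω := fun i => c.Mn m (P i).1 (P i).2 with hω
  have hζω : ∀ i, (ζ i, ω i) ∈ R := fun i => hR.iterate (hP i) m
  have hζd : ∀ i, dist (ζ i) η₀ ≤ ρ := fun i => (hPs i 0).trans (min_le_left _ _)
  have hσ : ∀ i, ContinuousAt (localSection Ks Ku br (ζ i) (ω i)) η₀ := fun i =>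
    continuousAt_localSection hbr hs hu (by linarith [hζd i]) _
  have hli' : LinearIndependent ℝ fun i => localSection Ks Ku br (ζ i) (ω i) η₀ := by
    convert hli using 2 with i
    exact localSection_eq hbr hε₀.le hu (by linarith [hζd i])
      (localStable_mono (min_le_right _ _) _ (hPs i)) (hR.Q_apply _ (hζω i))
  obtain ⟨κ, hκ, hev⟩ := eventually_norm_le_norm_sum hσ hli'
  obtain ⟨r, hr, hball⟩ := Metric.eventually_nhds_iff.1 hev
  refine ⟨m, κ⁻¹ * (D * B * ∑ i, ‖ω i‖), min r (min ρ (δ / 2)), by positivity, by positivity, ?_⟩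
  intro y y' hy hy' hyy' v hv
  have hyρ : dist y η₀ < ρ := hy.trans_le ((min_le_right _ _).trans (min_le_left _ _))
  have hyρ' : dist y' η₀ < ρ := hy'.trans_le ((min_le_right _ _).trans (min_le_left _ _))
  have hdy : dist y y' ≤ δ := by
    have h1 := hy.trans_le ((min_le_right r _).trans (min_le_right _ _))
    have h2 := hy'.trans_le ((min_le_right r _).trans (min_le_right _ _))
    have := dist_triangle_right y y' η₀
    linarith
  have hζy : ∀ i z, dist z η₀ < ρ → dist (ζ i) z ≤ 2 * ρ := fun i z hz => by
    have := dist_triangle_right (ζ i) z η₀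
    linarith [hζd i]
  have hζε : ∀ i z, dist z η₀ < ρ → dist (ζ i) z ≤ 2 * ε₁ := fun i z hz => by
    linarith [hζy i z hz]
  have hmem : ∀ i z, dist z η₀ < ρ → localSection Ks Ku br (ζ i) (ω i) z ∈ spanAt T Ks R z :=
    fun i z hz => localSection_mem h hbr hR (hζω i) (hζε i z hz)
  have hq : ∀ i z, dist z η₀ < ρ → br (ζ i) z ∈ localStable T δ z := fun i z hz => by
    refine localStable_mono ?_ _ (h.stable.mem_localStable_dist (hbr.mem_localStable (hζε i z hz))
      (mem_localStable_self T hε₀.le z))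
    refine ((le_max_right _ _).trans (hbr.le _ _ (hζε i z hz))).trans (le_trans ?_ hρδ)
    gcongr
    exact hζy i z hz
  have hqq : ∀ i, br (ζ i) y' ∈ localUnstable T (3 * δ) (br (ζ i) y) := fun i => by
    refine localUnstable_mono ?_ _ (h.unstable.mem_localStable_dist
      (hbr.mem_localUnstable (hζε i y' hyρ')) (hbr.mem_localUnstable (hζε i y hyρ)))
    have t := dist_triangle4 (br (ζ i) y') y' y (br (ζ i) y)
    have t1 : dist (br (ζ i) y') y' ≤ δ := hq i y' hyρ' 0
    have t2 : dist (br (ζ i) y) y ≤ δ := hq i y hyρ 0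
    rw [dist_comm y' y, dist_comm y (br (ζ i) y)] at t
    linarith
  have hκy := hball (hy.trans_le (min_le_left _ _))
  obtain ⟨a, rfl⟩ := exists_eq_sum_of_linearIndependent (hp y) (fun i => hmem i y hyρ)
    (linearIndependent_of_norm_le hκ hκy) hv
  -- The comparison vector has the coordinates of `v`, in the frame over `y'`.
  refine ⟨∑ i, a i • localSection Ks Ku br (ζ i) (ω i) y',
    Submodule.sum_mem _ fun i _ => Submodule.smul_mem _ _ (hmem i y' hyρ'), ?_⟩
  have hterm : ∀ i, ‖Ku y y' (localSection Ks Ku br (ζ i) (ω i) y) -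
      localSection Ks Ku br (ζ i) (ω i) y'‖ ≤ D * dist y y' ^ η * (B * ‖ω i‖) := by
    intro i
    have hu1 := hbr.mem_localUnstable (hζε i y hyρ)
    have hu2 := hbr.mem_localUnstable (hζε i y' hyρ')
    have hsub := fun x => h.unstable.localStable_subset x hε₀.le
    have hcomp : Ku (br (ζ i) y) (br (ζ i) y') (Ku (ζ i) (br (ζ i) y) (ω i)) =
        Ku (ζ i) (br (ζ i) y') (ω i) :=
      DFunLike.congr_fun (hu.comp (ζ i) (br (ζ i) y) (br (ζ i) y') (hsub _ hu1)
        (mem_unstableSet_trans (mem_unstableSet_comm.1 (hsub _ hu1)) (hsub _ hu2))) (ω i)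
    -- The sections over `y` and `y'` issue from the same vector over `ζ i`. Their bracket points
    -- lie on one unstable set, so the discrepancy is precisely a quadrilateral.
    have e : Ku y y' (localSection Ks Ku br (ζ i) (ω i) y) -
        localSection Ks Ku br (ζ i) (ω i) y' =
        -((Ks (br (ζ i) y') y' * Ku (br (ζ i) y) (br (ζ i) y') - Ku y y' * Ks (br (ζ i) y) y)
          (Ku (ζ i) (br (ζ i) y) (ω i))) := by
      have e0 : (Ks (br (ζ i) y') y' * Ku (br (ζ i) y) (br (ζ i) y') - Ku y y' * Ks (br (ζ i) y) y)
          (Ku (ζ i) (br (ζ i) y) (ω i)) =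
          Ks (br (ζ i) y') y' (Ku (br (ζ i) y) (br (ζ i) y') (Ku (ζ i) (br (ζ i) y) (ω i))) -
          Ku y y' (Ks (br (ζ i) y) y (Ku (ζ i) (br (ζ i) y) (ω i))) := rfl
      rw [e0, hcomp, neg_sub]
      rfl
    rw [e, norm_neg]
    refine (ContinuousLinearMap.le_opNorm _ _).trans ?_
    gcongr
    · exact hquad y y' _ _ hyy' (hq i y hyρ) (hq i y' hyρ') (hqq i)
    · exact (ContinuousLinearMap.le_opNorm _ _).trans (by gcongr; exact hKu _ _ hu1)
  have hsum : Ku y y' (∑ i, a i • localSection Ks Ku br (ζ i) (ω i) y) -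
      ∑ i, a i • localSection Ks Ku br (ζ i) (ω i) y' =
      ∑ i, a i • (Ku y y' (localSection Ks Ku br (ζ i) (ω i) y) -
        localSection Ks Ku br (ζ i) (ω i) y') := by
    simp only [map_sum, map_smul, smul_sub, Finset.sum_sub_distrib]
  rw [hsum]
  have ha : ‖a‖ ≤ κ⁻¹ * ‖∑ i, a i • localSection Ks Ku br (ζ i) (ω i) y‖ := by
    rw [← div_eq_inv_mul, le_div_iff₀ hκ, mul_comm]
    exact hκy a
  calc _ ≤ ∑ i, ‖a‖ * (D * dist y y' ^ η * (B * ‖ω i‖)) := by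
        refine norm_sum_le_of_le _ fun i _ => ?_
        rw [norm_smul]
        gcongr
        · exact norm_le_pi_norm a i
        · exact hterm i
    _ = ‖a‖ * (D * dist y y' ^ η * (B * ∑ i, ‖ω i‖)) := by
        simp only [← Finset.mul_sum]
    _ ≤ κ⁻¹ * ‖∑ i, a i • localSection Ks Ku br (ζ i) (ω i) y‖ *
          (D * dist y y' ^ η * (B * ∑ i, ‖ω i‖)) := by gcongr
    _ = _ := by ring

/-- Under strong bunching, `spanAt` is invariant under the unstable holonomies. -/
theorem Ku_apply_mem_of_quadrilateral (hθ : 0 < θ) (h : IsHyperbolic T ε₀ lu ls)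
    (hs : c.IsStableFamily ε₀ Ks)
    (hu : (c.rev hθ.le h.lipschitz_symm).IsStableFamily ε₀ Ku) (hR : c.IsSaturated Ku R) {p : ℕ}
    (hp : ∀ y, Module.finrank ℝ (spanAt T Ks R y) = p) {δ D η : ℝ} (hδ : 0 < δ) (hD : 0 < D)
    (hquad : ∀ y y' q q', y' ∈ localUnstable T δ y → q ∈ localStable T δ y →
      q' ∈ localStable T δ y' → q' ∈ localUnstable T (3 * δ) q →
      ‖Ks q' y' * Ku q q' - Ku y y' * Ks q y‖ ≤ D * dist y y' ^ η)
    (hdom : (c.rev hθ.le h.lipschitz_symm).Dominated ε₀ η) {y y' : X}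
    (hyy' : y' ∈ localUnstable T ε₀ y) {v : W} (hv : v ∈ spanAt T Ks R y) :
    Ku y y' v ∈ spanAt T Ks R y' := by
  obtain ⟨ε₁, C, br, hbr⟩ := h.exists_isBracket
  have hε₀ := h.eps_pos
  obtain ⟨C₁, s, hC₁, hs0, hdom⟩ := hdom
  have hsub := fun x => h.unstable.localStable_subset x hε₀.le
  -- The constants of the local estimate depend on the region, so one region visited infinitely
  -- often by the backward orbit is needed.
  obtain ⟨y₀, hy₀⟩ := exists_clusterPt_of_compactSpace (map (fun n => T.symm^[n] y) atTop)
  obtain ⟨m, A, r, hA, hr, H⟩ := exists_norm_sub_le_of_quadrilateral hθ h hbr hs hu hR hp hδ hD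
    hquad y₀
  have hTm : Continuous T^[m] := T.continuous.iterate m
  -- The estimate holds near `T^[m] y₀` rather than `y₀`; shifting the return times by `m`
  -- compensates.
  have hfreq : ∃ᶠ n in atTop, dist (T.symm^[n] y) (T^[m] y₀) < r / 2 := by
    have h1 := MapClusterPt.frequently (u := fun n => T.symm^[n] y) hy₀
      (p := fun z => dist (T^[m] z) (T^[m] y₀) < r / 2)
      ((isOpen_lt (hTm.dist continuous_const) continuous_const).mem_nhds
        (by rw [mem_ofPred_eq, dist_self]; positivity))
    rw [frequently_atTop] at h1 ⊢
    intro N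
    obtain ⟨n, hn, hn'⟩ := h1 (N + m)
    refine ⟨n - m, by omega, ?_⟩
    obtain ⟨k, rfl⟩ : ∃ k, n = m + k := ⟨n - m, by omega⟩
    rw [Function.iterate_add_apply, iterate_symm_iterate] at hn'
    rwa [Nat.add_sub_cancel_left]
  have hdist : Tendsto (fun n => dist (T.symm^[n] y') (T.symm^[n] y)) atTop (𝓝 0) := hsub _ hyy'
  have hev : ∀ᶠ n in atTop, dist (T.symm^[n] y') (T.symm^[n] y) < min (r / 2) δ :=
    hdist.eventually_lt_const (by positivity)
  have hexp : Tendsto (fun n : ℕ => A * (C₁ * Real.exp (-s) ^ n * dist y y' ^ η) * ‖v‖) atTop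
      (𝓝 0) := by
    simpa using ((((tendsto_pow_atTop_nhds_zero_of_lt_one (Real.exp_pos _).le
      (Real.exp_lt_one_iff.2 (neg_lt_zero.2 hs0))).const_mul C₁).mul_const
      (dist y y' ^ η)).const_mul A).mul_const ‖v‖
  -- It suffices to approximate `Ku y y' v` by vectors of the span: transport back to a return time,
  -- correct the vector there, and push forward again.
  have hcl : IsClosed (spanAt T Ks R y' : Set W) := Submodule.closed_of_finiteDimensional _
  rw [← SetLike.mem_coe, ← hcl.closure_eq, Metric.mem_closure_iff]
  intro e he
  obtain ⟨n, hn, hn1, hn2⟩ :=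
    (hfreq.and_eventually (hev.and (hexp.eventually_lt_const he))).exists
  set z := T.symm^[n] y with hz
  set z' := T.symm^[n] y' with hz'
  have hTz : T^[n] z = y := iterate_symm_iterate T n y
  have hTz' : T^[n] z' = y' := iterate_symm_iterate T n y'
  have hzz' : z' ∈ localUnstable T ε₀ z := localUnstable_symm_iterate hyy' n
  have hzδ : z' ∈ localUnstable T δ z := localUnstable_mono (hn1.le.trans (min_le_right _ _)) _
    (h.unstable.mem_localStable_dist hzz' (mem_localUnstable_self T hε₀.le z))
  have hv₁ : c.Nn n z v ∈ spanAt T Ks R z := hR.Nn_apply_mem hs hp (by rwa [hTz])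
  obtain ⟨w, hw, hw'⟩ := H z z' (hn.trans (half_lt_self hr)) (by
    have := dist_triangle z' z (T^[m] y₀)
    linarith [hn1.trans_le (min_le_left _ _)]) hzδ _ hv₁
  refine ⟨c.Mn n z' w, ?_, ?_⟩
  · rw [← hTz']
    exact hR.Mn_apply_mem hs hw n
  have hconj : Ku y y' v = c.Mn n z' (Ku z z' (c.Nn n z v)) := by
    have e1 := DFunLike.congr_fun (hu.rev_equivariant_iterate (hsub _ hzz') n) (c.Nn n z v)
    rw [hTz, hTz'] at e1
    refine Eq.trans ?_ e1.symm
    have e2 := DFunLike.congr_fun (c.Mn_mul_Nn n z) v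
    rw [hTz, IsSaturated.Q_apply_of_mem hs hv] at e2
    exact congrArg (Ku y y') e2.symm
  rw [dist_eq_norm, hconj, ← map_sub]
  refine lt_of_le_of_lt ?_ hn2
  have hd := hdom y y' hyy' n
  rw [rev_Mn, rev_Nn] at hd
  calc _ ≤ ‖c.Mn n z'‖ * (A * dist z z' ^ η * (‖c.Nn n z‖ * ‖v‖)) := by
        refine (ContinuousLinearMap.le_opNorm _ _).trans ?_
        gcongr
        refine hw'.trans ?_
        gcongr
        exact ContinuousLinearMap.le_opNorm _ _
    _ = A * (‖c.Nn n z‖ * ‖c.Mn n z'‖ * dist z z' ^ η) * ‖v‖ := by ring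
    _ ≤ _ := by gcongr

end

section

variable {W : Type*} [NormedAddCommGroup W] [InnerProductSpace ℝ W] [FiniteDimensional ℝ W]
  {T : X ≃ₜ X} {θ : ℝ} {c : MatrixCocycle T θ W} {Ks Ku : X → X → W →L[ℝ] W}
  {R : Set (X × W)} {ε₀ : ℝ} {lu ls : X → ℝ}

/-- If `spanAt` is one-dimensional, it is invariant under the unstable holonomies. -/
theorem Ku_apply_mem_of_finrank_eq_one (hθ : 0 < θ) (h : IsHyperbolic T ε₀ lu ls)
    (hT : IsTransitive T) (hs : c.IsStableFamily ε₀ Ks)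
    (hu : (c.rev hθ.le h.lipschitz_symm).IsStableFamily ε₀ Ku) (hR : c.IsSaturated Ku R)
    (hp : ∀ y, Module.finrank ℝ (spanAt T Ks R y) = 1) :
    ∃ ρ, 0 < ρ ∧ ∀ y y', y' ∈ localUnstable T ε₀ y → dist y y' < ρ → ∀ v ∈ spanAt T Ks R y,
    Ku y y' v ∈ spanAt T Ks R y' := by
  obtain ⟨ε₁, C, br, hbr⟩ := h.exists_isBracket
  have hε₁ := hbr.eps_pos
  have hε₀ := h.eps_pos
  have hsub := fun x => h.unstable.localStable_subset x hε₀.le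
  have htend : ∀ y y', y' ∈ localUnstable T ε₀ y → dist y y' < 2 * ε₁ →
      Tendsto (fun a => br a y') (𝓝 y) (𝓝 y') := by
    intro y y' hyy' hd
    have h1 : ContinuousAt (fun a => br a y') y :=
      ContinuousAt.comp (f := fun a => (a, y')) (hbr.continuousAt hd) (by fun_prop)
    have h2 : br y y' = y' := hbr.eq_of_mem hd.le hyy' (mem_localStable_self T hε₀.le y')
    rw [ContinuousAt, h2] at h1
    exact h1
  have hnear : ∀ y y' : X, dist y y' < 2 * ε₁ → ∀ᶠ a in 𝓝 y, dist a y' < 2 * ε₁ := fun y y' hd =>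
    (isOpen_lt (continuous_id.dist continuous_const) continuous_const).mem_nhds hd
  set S : Set X := Prod.fst '' R with hS
  have hSu : ∀ a ∈ S, ∀ b ∈ unstableSet T a, b ∈ S := by
    rintro _ ⟨q, hq, rfl⟩ b hb
    exact ⟨_, hR.unstable q hq b hb, rfl⟩
  -- The closure is forward invariant, and unstably saturated: a point `y'` of the unstable set of a
  -- limit `y` is the limit of the brackets of nearby `a ∈ S` with `y'`, and these lie in `S`.
  have hSdense : closure S = univ := by
    refine h.eq_univ_of_unstable_saturated hT (show 0 < 2 * ε₁ by positivity) isClosed_closure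
      (hR.nonempty.image _).closure (fun y hy => ?_) (fun y hy y' hyy' hd => ?_)
    · have : MapsTo T S S := by
        rintro _ ⟨q, hq, rfl⟩
        exact ⟨_, hR.map q hq, rfl⟩
      exact this.closure T.continuous hy
    · rw [dist_comm] at hd
      have hfr : ∃ᶠ a in 𝓝 y, br a y' ∈ S := by
        refine ((mem_closure_iff_frequently.1 hy).and_eventually (hnear y y' hd)).mono ?_
        rintro a ⟨ha, had⟩
        exact hSu a ha _ (hsub _ (hbr.mem_localUnstable (le_of_lt had)))
      exact mem_closure_iff_frequently.2 ((htend y y' hyy' hd).frequently hfr)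
  refine ⟨2 * ε₁, by positivity, fun y y' hyy' hd v hv => ?_⟩
  obtain ⟨s, hsmem, hscont, hsli⟩ := exists_continuousAt_sections hθ h hbr hs hu hR y (hp y)
  obtain ⟨s', hsmem', hscont', hsli'⟩ := exists_continuousAt_sections hθ h hbr hs hu hR y' (hp y')
  have hfac : ∀ {z : X} {w v : W}, w ∈ spanAt T Ks R z → w ≠ 0 → v ∈ spanAt T Ks R z →
      ∃ t : ℝ, v = t • w := by
    intro z w v hw hw0 hv
    obtain ⟨t, ht⟩ := (finrank_eq_one_iff_of_nonzero' (⟨w, hw⟩ : spanAt T Ks R z)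
      (fun h0 => hw0 (congrArg Subtype.val h0))).1 (hp z) ⟨v, hv⟩
    exact ⟨t, (congrArg Subtype.val ht).symm⟩
  -- One-dimensionality is essential: a single vector of `R` over `a` generates the span, and its
  -- unstable translates are in `R`.
  have hS' : ∀ a ∈ S, ∀ b ∈ unstableSet T a, ∀ v ∈ spanAt T Ks R a, Ku a b v ∈ spanAt T Ks R b := by
    rintro _ ⟨⟨z, w⟩, hq, rfl⟩ b hb v hv
    obtain ⟨t, rfl⟩ := hfac (hR.mem_spanAt hs hq) (hR.ne_zero _ hq) hv
    have hw : Ku z b w ∈ spanAt T Ks R b := hR.mem_spanAt hs (hR.unstable _ hq b hb)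
    have e : Ku z b (t • w) = t • Ku z b w := map_smul _ _ _
    exact e ▸ Submodule.smul_mem _ t hw
  -- Proportionality is written as an identity continuous in both vectors, so that it passes to the
  -- limit along `S`.
  have hinner : ∀ {z : X} {w v : W}, w ∈ spanAt T Ks R z → v ∈ spanAt T Ks R z → w ≠ 0 →
      (‖w‖ ^ 2) • v = (inner ℝ w v) • w := by
    intro z w v hw hv hw0
    obtain ⟨t, rfl⟩ := hfac hw hw0 hv
    rw [inner_smul_right, real_inner_self_eq_norm_sq, smul_smul, mul_comm]
  have hne' : ∀ᶠ b in 𝓝 y', s' 0 b ≠ 0 := (hscont' 0).eventually_ne (hsli'.ne_zero 0)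
  have hYS : (𝓝[S] y).NeBot := mem_closure_iff_nhdsWithin_neBot.1 (hSdense ▸ mem_univ y)
  have hlim : Tendsto (fun a => br a y') (𝓝[S] y) (𝓝 y') :=
    (htend y y' hyy' hd).mono_left nhdsWithin_le_nhds
  have hKlim : Tendsto (fun a => Ku a (br a y')) (𝓝[S] y) (𝓝 (Ku y y')) := by
    have h1 := hu.continuousOn (y, y') hyy'
    refine Tendsto.comp (f := fun a => (a, br a y')) h1 (tendsto_nhdsWithin_iff.2 ⟨?_, ?_⟩)
    · exact (tendsto_nhdsWithin_of_tendsto_nhds tendsto_id).prodMk_nhds hlim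
    · filter_upwards [nhdsWithin_le_nhds (hnear y y' hd)] with a ha
      exact hbr.mem_localUnstable (le_of_lt ha)
  have hs0 : Tendsto (s 0) (𝓝[S] y) (𝓝 (s 0 y)) := (hscont 0).mono_left nhdsWithin_le_nhds
  have hs0' : Tendsto (fun a => s' 0 (br a y')) (𝓝[S] y) (𝓝 (s' 0 y')) := (hscont' 0).tendsto.comp hlim
  have hKs : Tendsto (fun a => Ku a (br a y') (s 0 a)) (𝓝[S] y) (𝓝 (Ku y y' (s 0 y))) :=
    (isBoundedBilinearMap_apply.continuous.tendsto (Ku y y', s 0 y)).comp (hKlim.prodMk_nhds hs0)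
  have key : (‖s' 0 y'‖ ^ 2) • Ku y y' (s 0 y) = (inner ℝ (s' 0 y') (Ku y y' (s 0 y))) • s' 0 y' := by
    refine tendsto_nhds_unique_of_eventuallyEq ((hs0'.norm.pow 2).smul hKs)
      ((hs0'.inner hKs).smul hs0') ?_
    filter_upwards [self_mem_nhdsWithin, nhdsWithin_le_nhds hsmem, hlim.eventually hsmem',
      hlim.eventually hne', nhdsWithin_le_nhds (hnear y y' hd)] with a ha h1 h2 h3 h4
    exact hinner (h2 0) (hS' a ha _ (hsub _ (hbr.mem_localUnstable (le_of_lt h4))) _ (h1 0)) h3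
  obtain ⟨t, rfl⟩ := hfac (hsmem.self_of_nhds 0) (hsli.ne_zero 0) hv
  rw [map_smul]
  refine Submodule.smul_mem _ _ ?_
  have hn : ‖s' 0 y'‖ ^ 2 ≠ 0 := pow_ne_zero 2 (norm_ne_zero_iff.2 (hsli'.ne_zero 0))
  rw [← inv_smul_smul₀ hn (Ku y y' (s 0 y)), key]
  exact Submodule.smul_mem _ _ (Submodule.smul_mem _ _ (hsmem'.self_of_nhds 0))

omit [FiniteDimensional ℝ W] in
/-- If `spanAt` is invariant under the unstable holonomies, the spaces over nearby points are
related by linear maps that are Hölder-close to the identity. -/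
theorem exists_transport_spanAt (hθ : 0 < θ) (h : IsHyperbolic T ε₀ lu ls)
    (hs : c.IsStableFamily ε₀ Ks) (hu : (c.rev hθ.le h.lipschitz_symm).IsStableFamily ε₀ Ku)
    {ρ : ℝ} (hρ : 0 < ρ) (hinv : ∀ y y', y' ∈ localUnstable T ε₀ y → dist y y' < ρ →
      ∀ v ∈ spanAt T Ks R y, Ku y y' v ∈ spanAt T Ks R y') :
    ∃ δ D, 0 < δ ∧ 0 < D ∧ ∀ y y', dist y y' < δ → ∃ K : W →L[ℝ] W,
      (∀ v ∈ spanAt T Ks R y, K v ∈ spanAt T Ks R y') ∧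
      ‖K - c.Q y' * c.Q y‖ ≤ D * dist y y' ^ θ := by
  obtain ⟨ε₁, C, br, hbr⟩ := h.exists_isBracket
  have hε₁ := hbr.eps_pos
  have hε₀ := h.eps_pos
  have hC := hbr.const_pos
  obtain ⟨C₁, hC₁, H₁⟩ := hs.holder
  obtain ⟨C₂, hC₂, H₂⟩ := hu.holder
  obtain ⟨C₃, hC₃, H₃⟩ := c.holder
  obtain ⟨B, hB, b⟩ := c.bound
  obtain ⟨B₂, hB₂, b₂⟩ := hu.exists_bound hθ
  replace b := fun x => (b x).1
  replace H₃ := fun x y => (H₃ x y).1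
  refine ⟨min (2 * ε₁) (ρ / C), C ^ θ * (C₁ * B₂ + B * B * C₂ + B * C₃ * B), by positivity,
    by positivity, fun y y' hd => ?_⟩
  have hd1 : dist y y' ≤ 2 * ε₁ := hd.le.trans (min_le_left _ _)
  set r := br y y'
  have hru : r ∈ localUnstable T ε₀ y := hbr.mem_localUnstable hd1
  have hrs : r ∈ localStable T ε₀ y' := hbr.mem_localStable hd1
  have hr1 : dist y r ≤ C * dist y y' := by
    rw [dist_comm]
    exact (le_max_left _ _).trans (hbr.le y y' hd1)
  have hr2 : dist r y' ≤ C * dist y y' := (le_max_right _ _).trans (hbr.le y y' hd1)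
  have hrρ : dist y r < ρ := by
    have := hd.trans_le (min_le_right _ _)
    rw [lt_div_iff₀ hC] at this
    linarith
  -- The unstable leg preserves the spans by `hinv`, the stable leg by construction.
  refine ⟨Ks r y' * Ku y r, fun v hv => ?_, ?_⟩
  · exact IsSaturated.Ks_apply_mem hs (mem_stableSet_comm.1
      (h.stable.localStable_subset _ hε₀.le hrs)) (hinv y r hru hrρ v hv)
  have key : Ks r y' * Ku y r - c.Q y' * c.Q y =
      (Ks r y' - c.Q y' * c.Q r) * Ku y r + c.Q y' * c.Q r * (Ku y r - c.Q r * c.Q y)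
      + c.Q y' * (c.Q r - c.Q y) * c.Q y := by
    have e1 : c.Q y' * c.Q r * (c.Q r * c.Q y) = c.Q y' * c.Q r * c.Q y := by
      rw [← mul_assoc, mul_assoc (c.Q y'), c.Q_mul_Q]
    have e2 : c.Q y' * (c.Q r - c.Q y) * c.Q y = c.Q y' * c.Q r * c.Q y - c.Q y' * c.Q y := by
      rw [mul_sub, sub_mul, mul_assoc _ (c.Q y) (c.Q y), c.Q_mul_Q]
    rw [mul_sub (c.Q y' * c.Q r), e1, e2]
    noncomm_ring
  have m₁ : ‖Ks r y' - c.Q y' * c.Q r‖ ≤ C₁ * (C * dist y y') ^ θ :=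
    (H₁ _ _ (mem_localStable_comm.1 hrs)).trans (by gcongr)
  have m₂ : ‖Ku y r - c.Q r * c.Q y‖ ≤ C₂ * (C * dist y y') ^ θ :=
    (H₂ _ _ hru).trans (by gcongr)
  have m₃ : ‖c.Q r - c.Q y‖ ≤ C₃ * (C * dist y y') ^ θ :=
    (H₃ _ _).trans (by rw [dist_comm]; gcongr)
  have n₁ : ‖c.Q y' * c.Q r‖ ≤ B * B :=
    (norm_mul_le _ _).trans (mul_le_mul (b _) (b _) (norm_nonneg _) (by positivity))
  rw [key]
  calc _ ≤ C₁ * (C * dist y y') ^ θ * B₂ + B * B * (C₂ * (C * dist y y') ^ θ) +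
        B * (C₃ * (C * dist y y') ^ θ) * B := by
        refine (norm_add_le _ _).trans (add_le_add ((norm_add_le _ _).trans (add_le_add ?_ ?_)) ?_)
        · exact (norm_mul_le _ _).trans (by gcongr; exact b₂ _ _ hru)
        · exact (norm_mul_le _ _).trans (by gcongr)
        · refine (norm_mul_le _ _).trans ?_
          gcongr
          · exact (norm_mul_le _ _).trans (by gcongr; exact b _)
          · exact b _
    _ = _ := by
      rw [Real.mul_rpow hC.le dist_nonneg]
      ring

end

end MatrixCocycle

end UnstableInvariance

end HolderCocycle

namespace HolderCocycle

/-! ### Calculus of bounded Hölder functions. -/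

section BoundedHolder

variable {Z : Type*} [PseudoMetricSpace Z] {V V₁ V₂ : Type*} [NormedAddCommGroup V]

/-- Bounded `θ`-Hölder functions on a set. -/
def BddHolderOn (θ : ℝ) (f : Z → V) (s : Set Z) : Prop :=
  ∃ C, 0 ≤ C ∧ (∀ x ∈ s, ‖f x‖ ≤ C) ∧ ∀ x ∈ s, ∀ y ∈ s, ‖f x - f y‖ ≤ C * dist x y ^ θ

namespace BddHolderOn

variable {θ : ℝ} {s : Set Z}

theorem of_holderOnWith [CompactSpace Z] {θ : ℝ≥0} {f : Z → V} {C : ℝ≥0}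
    (h : HolderOnWith C θ f s) : BddHolderOn θ f s := by
  rcases s.eq_empty_or_nonempty with rfl | ⟨x₀, hx₀⟩
  · exact ⟨0, le_rfl, by simp, by simp⟩
  have hb : Bornology.IsBounded (univ : Set Z) := isCompact_univ.isBounded
  have h1 : ∀ x ∈ s, ∀ y ∈ s, ‖f x - f y‖ ≤ C * dist x y ^ (θ : ℝ) := fun x hx y hy => by
    rw [← dist_eq_norm]
    exact h.dist_le hx hy
  have h0 : 0 ≤ (C : ℝ) * Metric.diam (univ : Set Z) ^ (θ : ℝ) := by positivity
  refine ⟨‖f x₀‖ + C * Metric.diam (univ : Set Z) ^ (θ : ℝ) + C, by positivity, fun x hx => ?_,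
    fun x hx y hy => (h1 x hx y hy).trans ?_⟩
  · have h2 : ‖f x‖ ≤ ‖f x₀‖ + ‖f x - f x₀‖ := by simpa using norm_add_le (f x₀) (f x - f x₀)
    have h3 : ‖f x - f x₀‖ ≤ C * Metric.diam (univ : Set Z) ^ (θ : ℝ) :=
      (h1 x hx x₀ hx₀).trans (by
        gcongr
        exact Metric.dist_le_diam_of_mem hb (mem_univ x) (mem_univ x₀))
    linarith [C.coe_nonneg]
  · gcongr
    linarith [norm_nonneg (f x₀)]

theorem exists_holderOnWith {θ : ℝ≥0} {f : Z → V} (h : BddHolderOn θ f s) :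
    ∃ C : ℝ≥0, HolderOnWith C θ f s := by
  obtain ⟨C, hC, -, h⟩ := h
  lift C to ℝ≥0 using hC
  refine ⟨C, fun x hx y hy => ?_⟩
  rw [edist_nndist, edist_nndist, ← ENNReal.coe_rpow_of_nonneg _ θ.coe_nonneg, ← ENNReal.coe_mul,
    ENNReal.coe_le_coe, ← NNReal.coe_le_coe]
  simpa [dist_eq_norm] using h x hx y hy

theorem congr {f g : Z → V} (h : BddHolderOn θ f s) (hfg : ∀ x ∈ s, g x = f x) :
    BddHolderOn θ g s := by
  obtain ⟨C, hC, h1, h2⟩ := h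
  refine ⟨C, hC, fun x hx => ?_, fun x hx y hy => ?_⟩
  · rw [hfg x hx]
    exact h1 x hx
  · rw [hfg x hx, hfg y hy]
    exact h2 x hx y hy

theorem mono {f : Z → V} {t : Set Z} (h : BddHolderOn θ f s) (hts : t ⊆ s) :
    BddHolderOn θ f t := by
  obtain ⟨C, hC, h1, h2⟩ := h
  exact ⟨C, hC, fun x hx => h1 x (hts hx), fun x hx y hy => h2 x (hts hx) y (hts hy)⟩

theorem const (v : V) : BddHolderOn θ (fun _ : Z => v) s :=
  ⟨‖v‖, norm_nonneg _, fun _ _ => le_rfl, fun x _ y _ => by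
    rw [sub_self, norm_zero]
    positivity⟩

theorem add {f g : Z → V} (hf : BddHolderOn θ f s) (hg : BddHolderOn θ g s) :
    BddHolderOn θ (fun x => f x + g x) s := by
  obtain ⟨C, hC, h1, h2⟩ := hf
  obtain ⟨D, hD, h3, h4⟩ := hg
  refine ⟨C + D, add_nonneg hC hD,
    fun x hx => (norm_add_le _ _).trans (add_le_add (h1 x hx) (h3 x hx)), fun x hx y hy => ?_⟩
  rw [add_sub_add_comm, add_mul]
  exact (norm_add_le _ _).trans (add_le_add (h2 x hx y hy) (h4 x hx y hy))

theorem sum {ι : Type*} (t : Finset ι) {f : ι → Z → V} (hf : ∀ i ∈ t, BddHolderOn θ (f i) s) :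
    BddHolderOn θ (fun x => ∑ i ∈ t, f i x) s := by
  classical
  induction t using Finset.induction_on with
  | empty => simpa using const (0 : V)
  | insert i t hi ih =>
    simp only [Finset.sum_insert hi]
    exact (hf i (Finset.mem_insert_self i t)).add (ih fun j hj => hf j (Finset.mem_insert_of_mem hj))

theorem comp_lipschitz {Y : Type*} [PseudoMetricSpace Y] (hθ : 0 ≤ θ) {f : Z → V}
    (hf : BddHolderOn θ f s) {φ : Y → Z} (hφ : ∃ K : ℝ≥0, LipschitzWith K φ) :
    BddHolderOn θ (fun y => f (φ y)) (φ ⁻¹' s) := by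
  obtain ⟨C, hC, h1, h2⟩ := hf
  obtain ⟨K, hK⟩ := hφ
  have h0 : 0 ≤ C * (K : ℝ) ^ θ := by positivity
  refine ⟨C + C * (K : ℝ) ^ θ, by positivity, fun x hx => (h1 _ hx).trans (by linarith),
    fun x hx y hy => (h2 _ hx _ hy).trans ?_⟩
  calc _ ≤ C * (K * dist x y) ^ θ := by gcongr; exact hK.dist_le_mul x y
    _ = C * (K : ℝ) ^ θ * dist x y ^ θ := by
      rw [Real.mul_rpow K.coe_nonneg dist_nonneg, mul_assoc]
    _ ≤ _ := by gcongr; linarith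

theorem continuousOn (hθ : 0 < θ) {f : Z → V} (hf : BddHolderOn θ f s) : ContinuousOn f s := by
  obtain ⟨C, hC, -, h2⟩ := hf
  intro y hy
  rw [ContinuousWithinAt, tendsto_iff_norm_sub_tendsto_zero]
  have h0 : Tendsto (fun x => C * dist x y ^ θ) (𝓝[s] y) (𝓝 (C * dist y y ^ θ)) := by
    refine Tendsto.mono_left ?_ nhdsWithin_le_nhds
    exact ((tendsto_id.dist tendsto_const_nhds).rpow_const (Or.inr hθ.le)).const_mul C
  rw [dist_self, Real.zero_rpow hθ.ne', mul_zero] at h0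
  refine squeeze_zero' (Eventually.of_forall fun _ => norm_nonneg _) ?_ h0
  filter_upwards [self_mem_nhdsWithin] with x hx
  exact h2 x hx y hy

variable [NormedSpace ℝ V] [NormedAddCommGroup V₁] [NormedSpace ℝ V₁] [NormedAddCommGroup V₂]
  [NormedSpace ℝ V₂]

/-- The source of all product rules below. Boundedness is part of `BddHolderOn` because products of
Hölder functions need it. -/
theorem bilin (B : V₁ →L[ℝ] V₂ →L[ℝ] V) {f : Z → V₁} {g : Z → V₂} (hf : BddHolderOn θ f s)
    (hg : BddHolderOn θ g s) : BddHolderOn θ (fun x => B (f x) (g x)) s := by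
  obtain ⟨C, hC, h1, h2⟩ := hf
  obtain ⟨D, hD, h3, h4⟩ := hg
  refine ⟨‖B‖ * (2 * (C * D)), by positivity, fun x hx => ?_, fun x hx y hy => ?_⟩
  · calc _ ≤ ‖B‖ * ‖f x‖ * ‖g x‖ := B.le_opNorm₂ _ _
      _ ≤ ‖B‖ * C * D := by gcongr; exacts [h1 x hx, h3 x hx]
      _ ≤ _ := by
        have : 0 ≤ ‖B‖ * (C * D) := by positivity
        linarith
  · have e : B (f x) (g x) - B (f y) (g y) = B (f x - f y) (g x) + B (f y) (g x - g y) := by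
      simp
    rw [e]
    calc _ ≤ ‖B‖ * ‖f x - f y‖ * ‖g x‖ + ‖B‖ * ‖f y‖ * ‖g x - g y‖ :=
          (norm_add_le _ _).trans (add_le_add (B.le_opNorm₂ _ _) (B.le_opNorm₂ _ _))
      _ ≤ ‖B‖ * (C * dist x y ^ θ) * D + ‖B‖ * C * (D * dist x y ^ θ) := by
          gcongr
          exacts [h2 x hx y hy, h3 x hx, h1 y hy, h4 x hx y hy]
      _ = _ := by ring

theorem smul {f : Z → ℝ} {g : Z → V} (hf : BddHolderOn θ f s) (hg : BddHolderOn θ g s) :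
    BddHolderOn θ (fun x => f x • g x) s := hf.bilin (ContinuousLinearMap.lsmul ℝ ℝ) hg

theorem mul {f g : Z → ℝ} (hf : BddHolderOn θ f s) (hg : BddHolderOn θ g s) :
    BddHolderOn θ (fun x => f x * g x) s := hf.smul hg

theorem clm_comp {f : Z → V₁ →L[ℝ] V₂} {g : Z → V →L[ℝ] V₁} (hf : BddHolderOn θ f s)
    (hg : BddHolderOn θ g s) : BddHolderOn θ (fun x => (f x) ∘L (g x)) s :=
  hf.bilin (ContinuousLinearMap.compL ℝ V V₁ V₂) hg

/-- Extension by zero: a product with a function that vanishes outside `t` is Hölder if the other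
factor is Hölder on `t`. -/
theorem smul_of_zero {f : Z → ℝ} {g : Z → V} {t : Set Z} (hf : BddHolderOn θ f s)
    (hg : BddHolderOn θ g (s ∩ t)) (hft : ∀ x ∉ t, f x = 0) :
    BddHolderOn θ (fun x => f x • g x) s := by
  obtain ⟨E, hE, h5, h6⟩ := (hf.mono inter_subset_left).smul hg
  obtain ⟨C, hC, h1, h2⟩ := hf
  obtain ⟨D, hD, h3, h4⟩ := hg
  have key : ∀ x ∈ s, x ∈ t → ∀ y ∈ s, y ∉ t → ‖f x • g x‖ ≤ C * D * dist x y ^ θ := by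
    intro x hx hxt y hy hyt
    have := h2 x hx y hy
    rw [hft y hyt, sub_zero] at this
    rw [norm_smul]
    calc _ ≤ C * dist x y ^ θ * D := by gcongr; exact h3 x ⟨hx, hxt⟩
      _ = _ := by ring
  refine ⟨E + C * D, by positivity, fun x hx => ?_, fun x hx y hy => ?_⟩
  · by_cases hxt : x ∈ t
    · exact (h5 x ⟨hx, hxt⟩).trans (by linarith [mul_nonneg hC hD])
    · simp only [hft x hxt, zero_smul, norm_zero]
      positivity
  · have hE' : 0 ≤ E * dist x y ^ θ := by positivity
    have hCD' : 0 ≤ C * D * dist x y ^ θ := by positivity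
    rw [add_mul]
    by_cases hxt : x ∈ t <;> by_cases hyt : y ∈ t
    · linarith [h6 x ⟨hx, hxt⟩ y ⟨hy, hyt⟩]
    · simp only [hft y hyt, zero_smul, sub_zero]
      linarith [key x hx hxt y hy hyt]
    · simp only [hft x hxt, zero_smul, zero_sub, norm_neg]
      rw [dist_comm] at hE' hCD' ⊢
      linarith [key y hy hyt x hx hxt]
    · simp only [hft x hxt, hft y hyt, zero_smul, sub_zero, norm_zero]
      positivity

end BddHolderOn

end BoundedHolder

/-! ### Embedding of the bundle in a trivial bundle by a Hölder partition of unity. -/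

section Embedding

variable {X : Type*} [MetricSpace X] {d : ℕ} {E : X → Type*}
  [TopologicalSpace (TotalSpace (Model d) E)] [∀ x, AddCommGroup (E x)] [∀ x, Module ℝ (E x)]
  {θ : ℝ≥0}

noncomputable instance (A : HolderAtlas d E θ) : Fintype A.ι := @Fintype.ofFinite _ A.finite

noncomputable instance (A : HolderAtlas d E θ) : DecidableEq A.ι := Classical.decEq _

/-- Hölder functions subordinate to the atlas, with `∑ i, ρ i * σ i = 1`. -/
structure HolderPartition (A : HolderAtlas d E θ) where
  σ : A.ι → X → ℝ
  ρ : A.ι → X → ℝ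
  holder_σ : ∀ i, BddHolderOn (θ : ℝ) (σ i) univ
  holder_ρ : ∀ i, BddHolderOn (θ : ℝ) (ρ i) univ
  σ_eq_zero : ∀ i, ∀ x ∉ (A.chart i).baseSet, σ i x = 0
  ρ_eq_zero : ∀ i, ∀ x ∉ (A.chart i).baseSet, ρ i x = 0
  sum_eq_one : ∀ x, ∑ i, ρ i x * σ i x = 1

/-- Shrink the cover to closed sets and separate these from the complements of the chart domains.
The sum `S` of squares of the separating functions is at least one, so dividing by it keeps Hölder
regularity. Two families are needed: one cuts off the charts in the inclusion, the other their
inverses in the retraction. -/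
theorem HolderAtlas.exists_holderPartition [CompactSpace X] (A : HolderAtlas d E θ)
    (hX : HolderNormal X θ) : Nonempty (HolderPartition A) := by
  obtain ⟨K, hKu, hKc, hKs⟩ := exists_subset_iUnion_closed_subset (s := (univ : Set X))
    (u := fun i => (A.chart i).baseSet) isClosed_univ (fun i => (A.chart i).open_baseSet)
    (fun x _ => toFinite _) (fun x _ => mem_iUnion.2 (A.cover x))
  have hf : ∀ i, ∃ f : X → ℝ, (∃ C : ℝ≥0, HolderWith C θ f) ∧ (∀ x, f x ∈ Icc (0 : ℝ) 1) ∧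
      (∀ x ∈ (A.chart i).baseSetᶜ, f x = 0) ∧ (∀ x ∈ K i, f x = 1) := fun i =>
    hX _ _ (A.chart i).open_baseSet.isClosed_compl.isCompact (hKc i).isCompact
      (disjoint_compl_left_iff_subset.2 (hKs i))
  choose f hfH hfI hf0 hf1 using hf
  have hfB : ∀ i, BddHolderOn (θ : ℝ) (f i) univ := fun i => by
    obtain ⟨C, hC⟩ := hfH i
    exact BddHolderOn.of_holderOnWith (hC.holderOnWith _)
  set S : X → ℝ := fun x => ∑ i, f i x * f i x with hS
  have hSB : BddHolderOn (θ : ℝ) S univ := BddHolderOn.sum _ fun i _ => (hfB i).mul (hfB i)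
  have hS1 : ∀ x, 1 ≤ S x := fun x => by
    obtain ⟨i, hi⟩ := mem_iUnion.1 (hKu (mem_univ x))
    calc (1 : ℝ) = f i x * f i x := by rw [hf1 i x hi, mul_one]
      _ ≤ S x := Finset.single_le_sum (f := fun i => f i x * f i x)
        (fun j _ => mul_self_nonneg _) (Finset.mem_univ i)
  have hinv : BddHolderOn (θ : ℝ) (fun x => (S x)⁻¹) univ := by
    obtain ⟨C, hC, -, h2⟩ := hSB
    refine ⟨C + 1, by positivity, fun x _ => ?_, fun x hx y hy => ?_⟩
    · have : (S x)⁻¹ ≤ 1 := inv_le_one_of_one_le₀ (hS1 x)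
      rw [Real.norm_of_nonneg (inv_nonneg.2 (by linarith [hS1 x]))]
      linarith
    · have hx0 : (0 : ℝ) < S x := by linarith [hS1 x]
      have hy0 : (0 : ℝ) < S y := by linarith [hS1 y]
      have e : (S x)⁻¹ - (S y)⁻¹ = (S y - S x) * ((S x)⁻¹ * (S y)⁻¹) := by field_simp
      have h3 : (S x)⁻¹ * (S y)⁻¹ ≤ 1 :=
        mul_le_one₀ (inv_le_one_of_one_le₀ (hS1 x)) (inv_nonneg.2 hy0.le)
          (inv_le_one_of_one_le₀ (hS1 y))
      rw [e, norm_mul, norm_sub_rev, Real.norm_of_nonneg (by positivity : 0 ≤ (S x)⁻¹ * (S y)⁻¹)]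
      have h4 := h2 x hx y hy
      have h5 : 0 ≤ dist x y ^ (θ : ℝ) := by positivity
      nlinarith [norm_nonneg (S x - S y)]
  exact ⟨{
    σ := f
    ρ := fun i x => (S x)⁻¹ * f i x
    holder_σ := hfB
    holder_ρ := fun i => hinv.mul (hfB i)
    σ_eq_zero := fun i x hx => hf0 i x hx
    ρ_eq_zero := fun i x hx => by rw [hf0 i x hx, mul_zero]
    sum_eq_one := fun x => by
      simp only [mul_assoc, ← Finset.mul_sum]
      exact inv_mul_cancel₀ (by linarith [hS1 x]) }⟩

/-- The fiber of the trivial bundle in which the given bundle is embedded. -/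
abbrev HolderAtlas.Ambient (A : HolderAtlas d E θ) : Type := EuclideanSpace ℝ (A.ι × Fin d)

namespace HolderAtlas

variable (A : HolderAtlas d E θ)

/-- The inclusion of a summand of the ambient space. -/
noncomputable def inj (i : A.ι) : Model d →L[ℝ] A.Ambient :=
  LinearMap.toContinuousLinearMap
    { toFun := fun v => WithLp.toLp 2 fun p => if p.1 = i then v p.2 else 0
      map_add' := fun v w => by ext p; by_cases h : p.1 = i <;> simp [h]
      map_smul' := fun c v => by ext p; by_cases h : p.1 = i <;> simp [h] }

/-- The projection to a summand of the ambient space. -/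
noncomputable def prj (i : A.ι) : A.Ambient →L[ℝ] Model d :=
  LinearMap.toContinuousLinearMap
    { toFun := fun w => WithLp.toLp 2 fun k => w (i, k)
      map_add' := fun v w => by ext p; simp
      map_smul' := fun c v => by ext p; simp }

theorem prj_inj_self (i : A.ι) (v : Model d) : A.prj i (A.inj i v) = v := by
  ext k
  simp [prj, inj]

theorem prj_inj_ne {i j : A.ι} (h : i ≠ j) (v : Model d) :
    A.prj i (A.inj j v) = 0 := by
  ext k
  simp [prj, inj, h]

end HolderAtlas

namespace HolderPartition

variable {A : HolderAtlas d E θ} (P : HolderPartition A)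

/-- The inclusion of the fiber over `x` into the ambient space. -/
noncomputable def incl (x : X) : E x →ₗ[ℝ] A.Ambient :=
  ∑ i, P.σ i x • ((A.inj i : Model d →ₗ[ℝ] A.Ambient) ∘ₗ (A.chart i).linearMapAt ℝ x)

/-- The retraction of the ambient space to the fiber over `x`. -/
noncomputable def retr (x : X) : A.Ambient →ₗ[ℝ] E x :=
  ∑ i, P.ρ i x • ((A.chart i).symmₗ ℝ x ∘ₗ (A.prj i : A.Ambient →ₗ[ℝ] Model d))

theorem incl_apply (x : X) (v : E x) :
    P.incl x v = ∑ i, P.σ i x • A.inj i ((A.chart i).linearMapAt ℝ x v) := by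
  simp [incl]

theorem retr_apply (x : X) (w : A.Ambient) :
    P.retr x w = ∑ i, P.ρ i x • (A.chart i).symmₗ ℝ x (A.prj i w) := by
  simp [retr]

/-- Each summand of the inclusion is undone by the inverse of its own chart, and the weights `ρ i x
* σ i x` sum to one. -/
theorem retr_incl (x : X) (v : E x) : P.retr x (P.incl x v) = v := by
  have h1 : ∀ i, A.prj i (P.incl x v) = P.σ i x • (A.chart i).linearMapAt ℝ x v := fun i => by
    rw [incl_apply, map_sum, Finset.sum_eq_single i]
    · rw [map_smul, A.prj_inj_self]
    · intro j _ hj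
      rw [map_smul, A.prj_inj_ne hj.symm, smul_zero]
    · simp
  rw [retr_apply]
  have h2 : ∀ i, P.ρ i x • (A.chart i).symmₗ ℝ x (A.prj i (P.incl x v)) =
      (P.ρ i x * P.σ i x) • v := fun i => by
    by_cases hx : x ∈ (A.chart i).baseSet
    · rw [h1, map_smul, (A.chart i).symmₗ_linearMapAt hx, smul_smul]
    · rw [P.ρ_eq_zero i x hx, zero_smul, zero_mul, zero_smul]
  simp only [h2, ← Finset.sum_smul, P.sum_eq_one, one_smul]

/-- The operator on the ambient space that represents a linear map between two fibers. -/
noncomputable def conj {x y : X} (L : E x →ₗ[ℝ] E y) : A.Ambient →L[ℝ] A.Ambient :=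
  LinearMap.toContinuousLinearMap (P.incl y ∘ₗ L ∘ₗ P.retr x)

theorem conj_apply {x y : X} (L : E x →ₗ[ℝ] E y) (w : A.Ambient) :
    P.conj L w = P.incl y (L (P.retr x w)) := rfl

/-- Since `retr` is a left inverse of `incl`, passing to operators is multiplicative. It is not
unital: the identity of a fiber becomes a projection, the `Q` of the matrix cocycle. -/
theorem conj_mul_conj {x y z : X} (L : E x →ₗ[ℝ] E y) (L' : E y →ₗ[ℝ] E z) :
    P.conj L' * P.conj L = P.conj (L' ∘ₗ L) := by
  ext1 w
  change P.conj L' (P.conj L w) = _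
  rw [conj_apply, conj_apply, conj_apply, retr_incl]
  rfl

theorem conj_sub {x y : X} (L L' : E x →ₗ[ℝ] E y) :
    P.conj (L - L') = P.conj L - P.conj L' := by
  ext1 w
  rw [sub_apply, conj_apply, conj_apply, conj_apply, LinearMap.sub_apply,
    map_sub]

theorem retr_conj {x y : X} (L : E x →ₗ[ℝ] E y) (w : A.Ambient) :
    P.retr y (P.conj L w) = L (P.retr x w) := by
  rw [conj_apply, retr_incl]

theorem conj_incl {x y : X} (L : E x →ₗ[ℝ] E y) (v : E x) :
    P.conj L (P.incl x v) = P.incl y (L v) := by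
  rw [conj_apply, retr_incl]

theorem conj_eq_sum {x y : X} (L : E x →ₗ[ℝ] E y) :
    P.conj L = ∑ i, ∑ j, (P.ρ i x * P.σ j y) •
      (A.inj j ∘L coordRep (A.chart i) (A.chart j) L ∘L A.prj i) := by
  ext1 w
  rw [conj_apply, retr_apply, map_sum, map_sum, sum_apply]
  refine Finset.sum_congr rfl fun i _ => ?_
  rw [map_smul, map_smul, incl_apply, Finset.smul_sum, sum_apply]
  refine Finset.sum_congr rfl fun j _ => ?_
  rw [smul_smul]
  rfl

/-- A family of linear maps with Hölder coordinate representations is represented by a Hölder family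
of operators. -/
theorem bddHolderOn_conj {Z : Type*} [PseudoMetricSpace Z] [CompactSpace Z] {p q : Z → X}
    (hp : ∃ K : ℝ≥0, LipschitzWith K p) (hq : ∃ K : ℝ≥0, LipschitzWith K q)
    (L : ∀ z, E (p z) →ₗ[ℝ] E (q z))
    (hL : ∀ i j, ∃ C : ℝ≥0, HolderOnWith C θ (fun z => coordRep (A.chart i) (A.chart j) (L z))
      (p ⁻¹' (A.chart i).baseSet ∩ q ⁻¹' (A.chart j).baseSet)) :
    BddHolderOn (θ : ℝ) (fun z => P.conj (L z)) univ := by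
  simp only [conj_eq_sum]
  refine BddHolderOn.sum _ fun i _ => BddHolderOn.sum _ fun j _ => ?_
  refine BddHolderOn.smul_of_zero (((P.holder_ρ i).comp_lipschitz θ.coe_nonneg hp).mul
    ((P.holder_σ j).comp_lipschitz θ.coe_nonneg hq)) (t := p ⁻¹' (A.chart i).baseSet ∩
      q ⁻¹' (A.chart j).baseSet) ?_ fun z hz => ?_
  · obtain ⟨C, hC⟩ := hL i j
    refine ((BddHolderOn.const (A.inj j)).clm_comp
      ((BddHolderOn.of_holderOnWith hC).clm_comp (BddHolderOn.const (A.prj i)))).mono ?_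
    exact inter_subset_right
  · rw [mem_inter_iff, not_and_or] at hz
    rcases hz with hz | hz
    · rw [P.ρ_eq_zero i _ hz, zero_mul]
    · rw [P.σ_eq_zero j _ hz, mul_zero]

/-- Regard a vector over `x` as an ambient vector and retract it to the fiber over `y`. In charts
this is a finite sum of products of a Hölder function of `x` and one of `y`. -/
theorem isTransport [CompactSpace X] : IsTransport A fun x y => P.retr y ∘ₗ P.incl x := by
  refine ⟨fun x => LinearMap.ext fun v => P.retr_incl x v, fun i j => ?_⟩
  have hfst : ∃ K : ℝ≥0, LipschitzWith K (Prod.fst : X × X → X) := ⟨1, LipschitzWith.prod_fst⟩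
  have hsnd : ∃ K : ℝ≥0, LipschitzWith K (Prod.snd : X × X → X) := ⟨1, LipschitzWith.prod_snd⟩
  have hA := fun i j => BddHolderOn.of_holderOnWith (A.holder i j).choose_spec
  have h1 : BddHolderOn (θ : ℝ) (fun p : X × X => ∑ k,
      (P.ρ k p.2 • coordRep (A.chart k) (A.chart j) (LinearMap.id : E p.2 →ₗ[ℝ] E p.2)) ∘L
      (P.σ k p.1 • coordRep (A.chart i) (A.chart k) (LinearMap.id : E p.1 →ₗ[ℝ] E p.1)))
      ((A.chart i).baseSet ×ˢ (A.chart j).baseSet) := by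
    refine BddHolderOn.sum _ fun k _ => BddHolderOn.clm_comp ?_ ?_
    · refine (BddHolderOn.comp_lipschitz θ.coe_nonneg (s := (A.chart j).baseSet)
        (f := fun y => P.ρ k y • coordRep (A.chart k) (A.chart j) (LinearMap.id : E y →ₗ[ℝ] E y))
        ?_ hsnd).mono fun p hp => hp.2
      refine ((P.holder_ρ k).mono (subset_univ _)).smul_of_zero (t := (A.chart k).baseSet) ?_
        (P.ρ_eq_zero k)
      rw [inter_comm]
      exact hA k j
    · refine (BddHolderOn.comp_lipschitz θ.coe_nonneg (s := (A.chart i).baseSet)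
        (f := fun x => P.σ k x • coordRep (A.chart i) (A.chart k) (LinearMap.id : E x →ₗ[ℝ] E x))
        ?_ hfst).mono fun p hp => hp.1
      exact ((P.holder_σ k).mono (subset_univ _)).smul_of_zero (t := (A.chart k).baseSet)
        (hA i k) (P.σ_eq_zero k)
  refine BddHolderOn.exists_holderOnWith (h1.congr fun p _ => ?_)
  ext1 v
  rw [sum_apply]
  have e : coordRep (A.chart i) (A.chart j) (P.retr p.2 ∘ₗ P.incl p.1) v =
    (A.chart j).linearMapAt ℝ p.2 (P.retr p.2 (P.incl p.1 ((A.chart i).symmₗ ℝ p.1 v))) := rfl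
  rw [e, retr_apply, map_sum]
  refine Finset.sum_congr rfl fun k _ => ?_
  have h2 : A.prj k (P.incl p.1 ((A.chart i).symmₗ ℝ p.1 v)) =
      P.σ k p.1 • (A.chart k).linearMapAt ℝ p.1 ((A.chart i).symmₗ ℝ p.1 v) := by
    rw [incl_apply, map_sum, Finset.sum_eq_single k]
    · rw [map_smul, A.prj_inj_self]
    · intro j _ hj
      rw [map_smul, A.prj_inj_ne hj.symm, smul_zero]
    · simp
  rw [h2, map_smul]
  rfl

theorem continuous_incl [CompactSpace X] (hθ : 0 < θ) :
    Continuous fun v : TotalSpace (Model d) E => P.incl v.proj v.snd := by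
  refine continuous_iff_continuousAt.2 fun v₀ => ?_
  obtain ⟨j, hj⟩ := A.cover v₀.proj
  set e := A.chart j with he
  have hopen : IsOpen e.source := e.open_source
  have hv₀ : v₀ ∈ e.source := e.mem_source.2 hj
  have h1 : ∀ i, ContinuousOn (fun x => P.σ i x •
      coordRep e (A.chart i) (LinearMap.id : E x →ₗ[ℝ] E x)) e.baseSet := fun i =>
    BddHolderOn.continuousOn (θ := θ) (by exact_mod_cast hθ)
      (((P.holder_σ i).mono (subset_univ _)).smul_of_zero (t := (A.chart i).baseSet)
        (BddHolderOn.of_holderOnWith (A.holder j i).choose_spec) (P.σ_eq_zero i))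
  have hproj : ContinuousOn (fun v : TotalSpace (Model d) E => v.proj) e.source :=
    (continuous_fst.comp_continuousOn e.continuousOn).congr fun v hv => (e.coe_fst hv).symm
  have h2 : ContinuousOn (fun v : TotalSpace (Model d) E => ∑ i, A.inj i
      ((P.σ i v.proj • coordRep e (A.chart i) (LinearMap.id : E v.proj →ₗ[ℝ] E v.proj))
        (e v).2)) e.source := by
    refine continuousOn_finsetSum _ fun i _ => (A.inj i).continuous.comp_continuousOn ?_
    refine ContinuousOn.clm_apply ?_ (continuous_snd.comp_continuousOn e.continuousOn)
    exact (h1 i).comp hproj fun v hv => e.mem_source.1 hv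
  refine (h2.congr fun v hv => ?_).continuousAt (hopen.mem_nhds hv₀)
  have hx : v.proj ∈ e.baseSet := e.mem_source.1 hv
  rw [incl_apply]
  refine Finset.sum_congr rfl fun i _ => ?_
  have h3 : e.symmₗ ℝ v.proj (e v).2 = v.snd := by
    have h4 := e.symmₗ_linearMapAt (R := ℝ) hx v.snd
    rwa [e.coe_linearMapAt_of_mem hx] at h4
  rw [smul_apply, map_smul]
  have h5 : coordRep e (A.chart i) (LinearMap.id : E v.proj →ₗ[ℝ] E v.proj) (e v).2 =
      (A.chart i).linearMapAt ℝ v.proj (e.symmₗ ℝ v.proj (e v).2) := rfl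
  rw [h5, h3]

theorem continuous_retr [CompactSpace X] (hθ : 0 < θ) :
    Continuous fun p : X × A.Ambient => (⟨p.1, P.retr p.1 p.2⟩ : TotalSpace (Model d) E) := by
  refine continuous_iff_continuousAt.2 fun p₀ => ?_
  obtain ⟨j, hj⟩ := A.cover p₀.1
  set e := A.chart j with he
  have hopen : IsOpen (Prod.fst ⁻¹' e.baseSet : Set (X × A.Ambient)) :=
    e.open_baseSet.preimage continuous_fst
  have h1 : ∀ i, ContinuousOn (fun x => P.ρ i x •
      coordRep (A.chart i) e (LinearMap.id : E x →ₗ[ℝ] E x)) e.baseSet := fun i => by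
    refine BddHolderOn.continuousOn (θ := θ) (by exact_mod_cast hθ)
      (((P.holder_ρ i).mono (subset_univ _)).smul_of_zero (t := (A.chart i).baseSet)
        ?_ (P.ρ_eq_zero i))
    rw [inter_comm]
    exact BddHolderOn.of_holderOnWith (A.holder i j).choose_spec
  have h2 : ContinuousOn (fun p : X × A.Ambient => (p.1, ∑ i,
      (P.ρ i p.1 • coordRep (A.chart i) e (LinearMap.id : E p.1 →ₗ[ℝ] E p.1)) (A.prj i p.2)))
      (Prod.fst ⁻¹' e.baseSet) := by
    refine continuousOn_fst.prodMk (continuousOn_finsetSum _ fun i _ => ContinuousOn.clm_apply ?_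
      ((A.prj i).continuous.comp continuous_snd).continuousOn)
    exact (h1 i).comp continuousOn_fst fun p hp => hp
  have h3 : ContinuousOn (fun p : X × A.Ambient => e.toOpenPartialHomeomorph.symm (p.1, ∑ i,
      (P.ρ i p.1 • coordRep (A.chart i) e (LinearMap.id : E p.1 →ₗ[ℝ] E p.1)) (A.prj i p.2)))
      (Prod.fst ⁻¹' e.baseSet) :=
    e.toOpenPartialHomeomorph.continuousOn_symm.comp h2 fun p hp => e.mem_target.2 hp
  refine (h3.congr fun p hp => ?_).continuousAt (hopen.mem_nhds hj)
  have h4 : ∑ i, (P.ρ i p.1 • coordRep (A.chart i) e (LinearMap.id : E p.1 →ₗ[ℝ] E p.1))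
      (A.prj i p.2) = e.linearMapAt ℝ p.1 (P.retr p.1 p.2) := by
    rw [retr_apply, map_sum]
    refine Finset.sum_congr rfl fun i _ => ?_
    rw [map_smul]
    rfl
  rw [h4, ← e.mk_symm hp, ← e.symmₗ_apply (R := ℝ) hp, e.symmₗ_linearMapAt hp]

end HolderPartition

end Embedding

end HolderCocycle

namespace HolderCocycle

/-! ### Elementary properties of Riemannian norms. -/

section Norms

variable {X : Type*} {d : ℕ} {E : X → Type*}
  [TopologicalSpace (TotalSpace (Model d) E)] [∀ x, AddCommGroup (E x)] [∀ x, Module ℝ (E x)]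

namespace RiemannianNorm

variable (g : RiemannianNorm d E)

theorem norm_nonneg {x : X} (v : E x) : 0 ≤ g.norm v := Real.sqrt_nonneg _

theorem norm_zero (x : X) : g.norm (0 : E x) = 0 := by simp [norm]

theorem norm_pos {x : X} {v : E x} (hv : v ≠ 0) : 0 < g.norm v := Real.sqrt_pos.2 (g.pos x v hv)

theorem norm_smul {x : X} (a : ℝ) (v : E x) : g.norm (a • v) = |a| * g.norm v := by
  rw [norm, norm, map_smul, map_smul, LinearMap.smul_apply, smul_eq_mul, smul_eq_mul, ← mul_assoc,
    Real.sqrt_mul (mul_self_nonneg a), Real.sqrt_mul_self_eq_abs]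

theorem opNorm_nonneg {x y : X} (L : E x →ₗ[ℝ] E y) : 0 ≤ g.opNorm L :=
  Real.sInf_nonneg fun _ hc => hc.1

theorem opNorm_le {x y : X} {L : E x →ₗ[ℝ] E y} {c : ℝ} (hc : 0 ≤ c)
    (h : ∀ v, g.norm (L v) ≤ c * g.norm v) : g.opNorm L ≤ c :=
  csInf_le ⟨0, fun _ hc => hc.1⟩ ⟨hc, h⟩

/-- Some bound must be assumed: `opNorm` is an `sInf`, which is the junk value zero on the empty
set. -/
theorem norm_apply_le_opNorm {x y : X} {L : E x →ₗ[ℝ] E y}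
    (hL : ∃ c, 0 ≤ c ∧ ∀ v, g.norm (L v) ≤ c * g.norm v) (v : E x) :
    g.norm (L v) ≤ g.opNorm L * g.norm v := by
  by_cases hv : v = 0
  · rw [hv, map_zero, g.norm_zero, g.norm_zero, mul_zero]
  · rw [← div_le_iff₀ (g.norm_pos hv)]
    exact le_csInf hL fun c hc => (div_le_iff₀ (g.norm_pos hv)).2 (hc.2 v)

end RiemannianNorm

end Norms

/-! ### Comparison of Riemannian norms with the ambient norm. -/

section NormEquivalence

variable {X : Type*} [MetricSpace X] {d : ℕ} {E : X → Type*}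
  [TopologicalSpace (TotalSpace (Model d) E)] [∀ x, AddCommGroup (E x)] [∀ x, Module ℝ (E x)]
  {θ : ℝ≥0} {A : HolderAtlas d E θ} (P : HolderPartition A) (g : RiemannianNorm d E)

namespace HolderPartition

theorem continuous_norm_retr [CompactSpace X] (hθ : 0 < θ) :
    Continuous fun p : X × A.Ambient => g.norm (P.retr p.1 p.2) :=
  g.continuous_norm.comp (P.continuous_retr hθ)

theorem continuous_incl_retr [CompactSpace X] (hθ : 0 < θ) :
    Continuous fun p : X × A.Ambient => P.incl p.1 (P.retr p.1 p.2) :=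
  (P.continuous_incl hθ).comp (P.continuous_retr hθ)

theorem incl_injective (x : X) : Function.Injective (P.incl x) :=
  Function.LeftInverse.injective (P.retr_incl x)

theorem incl_ne_zero {x : X} {v : E x} (hv : v ≠ 0) : P.incl x v ≠ 0 := fun h =>
  hv (P.incl_injective x (by rw [h, map_zero]))

/-- A Riemannian norm is equivalent to the norm induced by the embedding. -/
theorem exists_norm_equiv [CompactSpace X] (hθ : 0 < θ) : ∃ c, 1 ≤ c ∧
    (∀ x w, g.norm (P.retr x w) ≤ c * ‖w‖) ∧ ∀ x v, ‖P.incl x v‖ ≤ c * g.norm v := by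
  have hcomp : IsCompact ((univ : Set X) ×ˢ Metric.sphere (0 : A.Ambient) 1) :=
    isCompact_univ.prod (isCompact_sphere _ _)
  have hc1 := P.continuous_norm_retr g hθ
  obtain ⟨C, hC⟩ := (hcomp.image hc1).bddAbove
  -- These are the unit ambient vectors that lie in the embedded fibers. The retraction is injective
  -- on them, so the Riemannian norm has a positive minimum.
  have hS : IsCompact (((univ : Set X) ×ˢ Metric.sphere (0 : A.Ambient) 1) ∩
      {p | P.incl p.1 (P.retr p.1 p.2) = p.2}) :=
    hcomp.inter_right (isClosed_eq (P.continuous_incl_retr hθ) continuous_snd)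
  obtain ⟨m, hm, hmle⟩ : ∃ m, 0 < m ∧ ∀ p ∈ ((univ : Set X) ×ˢ Metric.sphere (0 : A.Ambient) 1) ∩
      {p | P.incl p.1 (P.retr p.1 p.2) = p.2}, m ≤ g.norm (P.retr p.1 p.2) := by
    rcases eq_empty_or_nonempty (((univ : Set X) ×ˢ Metric.sphere (0 : A.Ambient) 1) ∩
      {p | P.incl p.1 (P.retr p.1 p.2) = p.2}) with h | h
    · exact ⟨1, one_pos, by simp [h]⟩
    · obtain ⟨p, hp, hmin⟩ := hS.exists_isMinOn h hc1.continuousOn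
      refine ⟨_, g.norm_pos fun h0 => ?_, fun q hq => hmin hq⟩
      have h1 : P.incl p.1 (P.retr p.1 p.2) = p.2 := hp.2
      have h2 : ‖p.2‖ = 1 := by simpa using hp.1.2
      rw [h0, map_zero] at h1
      rw [← h1, _root_.norm_zero] at h2
      exact zero_ne_one h2
  refine ⟨max 1 (max C m⁻¹), le_max_left _ _, fun x w => ?_, fun x v => ?_⟩
  · by_cases hw : w = 0
    · rw [hw, map_zero, g.norm_zero, _root_.norm_zero, mul_zero]
    have hw' := norm_pos_iff.2 hw
    have h1 : g.norm (P.retr x (‖w‖⁻¹ • w)) ≤ C := hC ⟨(x, ‖w‖⁻¹ • w), ⟨mem_univ _, by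
      simp [_root_.norm_smul, hw]⟩, rfl⟩
    rw [map_smul, g.norm_smul, abs_of_pos (inv_pos.2 hw'), inv_mul_le_iff₀ hw', mul_comm] at h1
    exact h1.trans (by gcongr; exact (le_max_left _ _).trans (le_max_right _ _))
  · by_cases hv : v = 0
    · rw [hv, map_zero, g.norm_zero, _root_.norm_zero, mul_zero]
    have hw := P.incl_ne_zero hv
    have hw' := norm_pos_iff.2 hw
    have h1 := hmle (x, ‖P.incl x v‖⁻¹ • P.incl x v) ⟨⟨mem_univ _, by
      simp [_root_.norm_smul, hw]⟩, by
        rw [mem_ofPred_eq, map_smul, map_smul, P.retr_incl]⟩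
    rw [map_smul, P.retr_incl, g.norm_smul, abs_of_pos (inv_pos.2 hw'), le_inv_mul_iff₀ hw',
      ← le_div_iff₀ hm, div_eq_inv_mul] at h1
    refine h1.trans ?_
    have := g.norm_nonneg v
    gcongr
    exact (le_max_right _ _).trans (le_max_right _ _)

theorem norm_apply_le_of_norm_conj_le {c D : ℝ} (hc : 0 ≤ c)
    (h1 : ∀ x w, g.norm (P.retr x w) ≤ c * ‖w‖) (h2 : ∀ x (v : E x), ‖P.incl x v‖ ≤ c * g.norm v)
    {x y : X} {L : E x →ₗ[ℝ] E y} (hL : ‖P.conj L‖ ≤ D) (v : E x) :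
    g.norm (L v) ≤ c * D * c * g.norm v := by
  have e : L v = P.retr y (P.conj L (P.incl x v)) := by rw [P.conj_incl, P.retr_incl]
  calc g.norm (L v) ≤ c * ‖P.conj L (P.incl x v)‖ := by rw [e]; exact h1 _ _
    _ ≤ c * (D * (c * g.norm v)) := by
      gcongr
      exact (P.conj L).le_of_opNorm_le_of_le hL (h2 x v)
    _ = _ := by ring

theorem norm_conj_le {c D : ℝ} (hc : 0 ≤ c) (hD : 0 ≤ D)
    (h1 : ∀ x w, g.norm (P.retr x w) ≤ c * ‖w‖) (h2 : ∀ x (v : E x), ‖P.incl x v‖ ≤ c * g.norm v)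
    {x y : X} {L : E x →ₗ[ℝ] E y} (hL : ∀ v, g.norm (L v) ≤ D * g.norm v) :
    ‖P.conj L‖ ≤ c * D * c := by
  refine ContinuousLinearMap.opNorm_le_bound _ (by positivity) fun w => ?_
  rw [P.conj_apply]
  calc _ ≤ c * g.norm (L (P.retr x w)) := h2 _ _
    _ ≤ c * (D * (c * ‖w‖)) := by
      gcongr
      exact (hL _).trans (by gcongr; exact h1 _ _)
    _ = _ := by ring

include P in
theorem exists_norm_apply_le [CompactSpace X] (hθ : 0 < θ) {x y : X} (L : E x →ₗ[ℝ] E y) :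
    ∃ c, 0 ≤ c ∧ ∀ v, g.norm (L v) ≤ c * g.norm v := by
  obtain ⟨c, hc, h1, h2⟩ := P.exists_norm_equiv g hθ
  exact ⟨c * ‖P.conj L‖ * c, by positivity,
    P.norm_apply_le_of_norm_conj_le g (by linarith) h1 h2 le_rfl⟩

/-- Bounds for the norms of a continuous family of linear maps between fibers persist under
perturbation. -/
theorem eventually_norm_apply_le [CompactSpace X] (hθ : 0 < θ) {p q : X → X} (hp : Continuous p)
    (hq : Continuous q) (L : ∀ x, E (p x) →ₗ[ℝ] E (q x)) (hL : Continuous fun x => P.conj (L x))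
    {x₀ : X} {a : ℝ} (h : ∀ v, v ≠ 0 → g.norm (L x₀ v) < a * g.norm v) :
    ∀ᶠ x in 𝓝 x₀, ∀ v, g.norm (L x v) ≤ a * g.norm v := by
  have hcomp : IsCompact ((univ : Set X) ×ˢ Metric.sphere (0 : A.Ambient) 1) :=
    isCompact_univ.prod (isCompact_sphere _ _)
  have c1 : Continuous fun z : X × A.Ambient => g.norm (P.retr (p z.1) z.2) :=
    (P.continuous_norm_retr g hθ).comp ((hp.comp continuous_fst).prodMk continuous_snd)
  have c2 : Continuous fun z : X × A.Ambient => P.incl (p z.1) (P.retr (p z.1) z.2) :=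
    (P.continuous_incl_retr hθ).comp ((hp.comp continuous_fst).prodMk continuous_snd)
  have c3 : Continuous fun z : X × A.Ambient => g.norm (P.retr (q z.1) (P.conj (L z.1) z.2)) :=
    (P.continuous_norm_retr g hθ).comp ((hq.comp continuous_fst).prodMk
      ((hL.comp continuous_fst).clm_apply continuous_snd))
  -- The base points over which some embedded unit vector violates the strict bound form the
  -- projection of a compact set, hence a closed set.
  have hbad := (((hcomp.inter_right (isClosed_eq c2 continuous_snd)).inter_right
    (isClosed_le (c1.const_mul a) c3)).image continuous_fst).isClosed
  have hx₀ : x₀ ∉ Prod.fst '' (((univ : Set X) ×ˢ Metric.sphere (0 : A.Ambient) 1 ∩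
      {z | P.incl (p z.1) (P.retr (p z.1) z.2) = z.2}) ∩
      {z | a * g.norm (P.retr (p z.1) z.2) ≤ g.norm (P.retr (q z.1) (P.conj (L z.1) z.2))}) := by
    rintro ⟨⟨x, w⟩, ⟨⟨⟨-, hw⟩, hw'⟩, hle⟩, rfl⟩
    rw [mem_ofPred_eq] at hw' hle
    simp only [P.retr_conj] at hle hw' h
    refine (h (P.retr (p x) w) fun h0 => ?_).not_ge hle
    rw [h0, map_zero] at hw'
    simp [← hw'] at hw
  filter_upwards [hbad.isOpen_compl.mem_nhds hx₀] with x hx v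
  by_contra! hlt
  have hv : v ≠ 0 := by
    rintro rfl
    rw [map_zero, g.norm_zero, g.norm_zero, mul_zero] at hlt
    exact hlt.false
  have hw := P.incl_ne_zero hv
  have hw' := norm_pos_iff.2 hw
  refine hx ⟨(x, ‖P.incl (p x) v‖⁻¹ • P.incl (p x) v), ⟨⟨⟨mem_univ _, ?_⟩, ?_⟩, ?_⟩, rfl⟩
  · simp [_root_.norm_smul, hw]
  · rw [mem_ofPred_eq, map_smul, map_smul, P.retr_incl]
  · rw [mem_ofPred_eq]
    simp only [P.retr_conj]
    rw [map_smul, P.retr_incl, map_smul, g.norm_smul, g.norm_smul, mul_left_comm]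
    gcongr

end HolderPartition

end NormEquivalence

/-! ### Hölder regularity of inverses. -/

section Inverse

variable {X : Type*} [MetricSpace X] {W : Type*} [NormedAddCommGroup W] [NormedSpace ℝ W]

/-- The inverses of a Hölder family of isomorphisms form a Hölder family. -/
theorem BddHolderOn.of_inverse [CompactSpace X] {T : X → X} (hT : ∃ K : ℝ≥0, LipschitzWith K T)
    {θ : ℝ} (hθ : 0 < θ) {Q M N : X → W →L[ℝ] W} (hQ : BddHolderOn θ Q univ)
    (hM : BddHolderOn θ M univ) (hNM : ∀ x, N x * M x = Q x) (hMN : ∀ x, M x * N x = Q (T x))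
    (hQN : ∀ x, Q x * N x = N x) (hNQ : ∀ x, N x * Q (T x) = N x) : BddHolderOn θ N univ := by
  have hQT : BddHolderOn θ (fun x => Q (T x)) univ := hQ.comp_lipschitz hθ.le hT
  have cM := continuousOn_univ.1 (hM.continuousOn hθ)
  have cQ := continuousOn_univ.1 (hQT.continuousOn hθ)
  obtain ⟨B, hB, hQB, hQh⟩ := hQ
  obtain ⟨B', hB', -, hQTh⟩ := hQT
  obtain ⟨D, hD, -, hMh⟩ := hM
  have key : ∀ x y, N y - N x =
      N y * (Q (T y) - Q (T x)) + N y * (M x - M y) * N x + (Q y - Q x) * N x := fun x y => by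
    rw [mul_sub, mul_sub, sub_mul, sub_mul, hNQ, hNM, mul_assoc, hMN, hQN x]
    abel
  -- The resolvent-type identity `key` contains `N y` on both sides. Near `x` its coefficient is
  -- below one half and can be absorbed, which bounds `N` locally; compactness makes the bound
  -- global.
  have hbd : ∃ b, 0 ≤ b ∧ ∀ x ∈ (univ : Set X), ‖N x‖ ≤ b := by
    refine isCompact_univ.induction_on (p := fun s => ∃ b, 0 ≤ b ∧ ∀ x ∈ s, ‖N x‖ ≤ b)
      ⟨0, le_rfl, by simp⟩ (fun s t hst ⟨b, hb, h⟩ => ⟨b, hb, fun x hx => h x (hst hx)⟩)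
      (fun s t ⟨b, hb, h⟩ ⟨b', hb', h'⟩ => ⟨max b b', hb.trans (le_max_left _ _), fun x hx =>
        hx.elim (fun hx => (h x hx).trans (le_max_left _ _))
          fun hx => (h' x hx).trans (le_max_right _ _)⟩) fun x _ => ?_
    have ht : Tendsto (fun y => ‖Q (T y) - Q (T x)‖ + ‖M x - M y‖ * ‖N x‖) (𝓝 x) (𝓝 0) := by
      have : Continuous fun y => ‖Q (T y) - Q (T x)‖ + ‖M x - M y‖ * ‖N x‖ :=
        (cQ.sub continuous_const).norm.add ((continuous_const.sub cM).norm.mul continuous_const)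
      simpa using this.tendsto x
    refine ⟨_, mem_nhdsWithin_of_mem_nhds (ht.eventually_lt_const (u := 1 / 2) (by norm_num)),
      2 * (B * ‖N x‖), by positivity, fun y hy => ?_⟩
    have hy' : ‖Q (T y) - Q (T x)‖ + ‖M x - M y‖ * ‖N x‖ < 1 / 2 := hy
    have e : N y = N y * (Q (T y) - Q (T x)) + N y * (M x - M y) * N x + Q y * N x := by
      have := key x y
      rw [sub_mul, hQN x, ← add_sub_assoc] at this
      exact sub_left_inj.1 this
    have h1 : ‖N y‖ ≤ ‖N y‖ * (‖Q (T y) - Q (T x)‖ + ‖M x - M y‖ * ‖N x‖) + B * ‖N x‖ := by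
      calc ‖N y‖ = ‖N y * (Q (T y) - Q (T x)) + N y * (M x - M y) * N x + Q y * N x‖ := by rw [← e]
        _ ≤ ‖N y‖ * ‖Q (T y) - Q (T x)‖ + ‖N y‖ * ‖M x - M y‖ * ‖N x‖ + B * ‖N x‖ := by
          refine norm_add₃_le.trans (add_le_add (add_le_add (norm_mul_le _ _) ?_) ?_)
          · exact (norm_mul_le _ _).trans (by gcongr; exact norm_mul_le _ _)
          · exact (norm_mul_le _ _).trans (by gcongr; exact hQB y (mem_univ y))
        _ = _ := by ring
    nlinarith [norm_nonneg (N y)]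
  obtain ⟨b, hb, hN⟩ := hbd
  refine ⟨b + (b * B' + b * D * b + B * b), by positivity, fun x hx => (hN x hx).trans ?_,
    fun y hy x hx => ?_⟩
  · have : 0 ≤ b * B' + b * D * b + B * b := by positivity
    linarith
  · have h0 : 0 ≤ dist y x ^ θ := by positivity
    have h1 := hN y hy
    have h2 := hN x hx
    calc _ ≤ ‖N y‖ * ‖Q (T y) - Q (T x)‖ + ‖N y‖ * ‖M x - M y‖ * ‖N x‖ + ‖Q y - Q x‖ * ‖N x‖ := by
          rw [key x y]
          refine norm_add₃_le.trans (add_le_add (add_le_add (norm_mul_le _ _) ?_) (norm_mul_le _ _))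
          exact (norm_mul_le _ _).trans (by gcongr; exact norm_mul_le _ _)
      _ ≤ b * (B' * dist y x ^ θ) + b * (D * dist y x ^ θ) * b + B * dist y x ^ θ * b := by
          gcongr
          · exact hQTh y hy x hx
          · rw [norm_sub_rev]
            exact hMh y hy x hx
          · exact hQh y hy x hx
      _ ≤ _ := by nlinarith

end Inverse

end HolderCocycle

namespace HolderCocycle

/-! ### The matrix cocycle of an automorphism, and its bunching. -/

section Cocycle

variable {X : Type*} [MetricSpace X] [CompactSpace X] {d : ℕ} {E : X → Type*}
  [TopologicalSpace (TotalSpace (Model d) E)] [∀ x, AddCommGroup (E x)] [∀ x, Module ℝ (E x)]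
  {θ : ℝ≥0} {A : HolderAtlas d E θ} (P : HolderPartition A) {T : X ≃ₜ X}
  {Φ : ∀ x, E x ≃ₗ[ℝ] E (T x)}

namespace HolderPartition

theorem bddHolderOn_conj_id :
    BddHolderOn (θ : ℝ) (fun x => P.conj (LinearMap.id : E x →ₗ[ℝ] E x)) univ :=
  P.bddHolderOn_conj ⟨1, LipschitzWith.id⟩ ⟨1, LipschitzWith.id⟩ (fun _ => LinearMap.id) A.holder

theorem bddHolderOn_conj_automorphism (hΦ : IsHolderAutomorphism A Φ) :
    BddHolderOn (θ : ℝ) (fun x => P.conj (Φ x : E x →ₗ[ℝ] E (T x))) univ :=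
  P.bddHolderOn_conj ⟨1, LipschitzWith.id⟩ hΦ.1 (fun x => (Φ x : E x →ₗ[ℝ] E (T x))) hΦ.2

theorem bddHolderOn_conj_symm (hθ : 0 < θ) (hΦ : IsHolderAutomorphism A Φ) :
    BddHolderOn (θ : ℝ) (fun x => P.conj ((Φ x).symm : E (T x) →ₗ[ℝ] E x)) univ := by
  refine BddHolderOn.of_inverse (T := T) hΦ.1 (by exact_mod_cast hθ) P.bddHolderOn_conj_id
    (P.bddHolderOn_conj_automorphism hΦ) ?_ ?_ ?_ ?_ <;> intro x <;> rw [P.conj_mul_conj] <;>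
    congr 1 <;> ext v <;> simp

/-- The matrix cocycle that represents an automorphism. -/
noncomputable def cocycle (hθ : 0 < θ) (hΦ : IsHolderAutomorphism A Φ) :
    MatrixCocycle T θ A.Ambient where
  Q x := P.conj (LinearMap.id : E x →ₗ[ℝ] E x)
  M x := P.conj (Φ x : E x →ₗ[ℝ] E (T x))
  N x := P.conj ((Φ x).symm : E (T x) →ₗ[ℝ] E x)
  Q_mul_Q x := by rw [P.conj_mul_conj]; congr 1
  N_mul_M x := by rw [P.conj_mul_conj]; congr 1; ext v; simp
  M_mul_N x := by rw [P.conj_mul_conj]; congr 1; ext v; simp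
  M_mul_Q x := by rw [P.conj_mul_conj]; congr 1
  Q_mul_M x := by rw [P.conj_mul_conj]; congr 1
  Q_mul_N x := by rw [P.conj_mul_conj]; congr 1
  N_mul_Q x := by rw [P.conj_mul_conj]; congr 1
  bound := by
    obtain ⟨B, hB, h1, -⟩ := P.bddHolderOn_conj_id
    obtain ⟨C, hC, h2, -⟩ := P.bddHolderOn_conj_automorphism hΦ
    obtain ⟨D, hD, h3, -⟩ := P.bddHolderOn_conj_symm hθ hΦ
    exact ⟨1 + (B + C + D), by linarith, fun x => ⟨(h1 x (mem_univ x)).trans (by linarith),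
      (h2 x (mem_univ x)).trans (by linarith), (h3 x (mem_univ x)).trans (by linarith)⟩⟩
  holder := by
    obtain ⟨B, hB, -, h1⟩ := P.bddHolderOn_conj_id
    obtain ⟨C, hC, -, h2⟩ := P.bddHolderOn_conj_automorphism hΦ
    obtain ⟨D, hD, -, h3⟩ := P.bddHolderOn_conj_symm hθ hΦ
    refine ⟨1 + (B + C + D), by linarith, fun x y => ?_⟩
    have h0 : 0 ≤ dist x y ^ (θ : ℝ) := by positivity
    exact ⟨(h1 x (mem_univ x) y (mem_univ y)).trans (by gcongr; linarith),
      (h2 x (mem_univ x) y (mem_univ y)).trans (by gcongr; linarith),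
      (h3 x (mem_univ x) y (mem_univ y)).trans (by gcongr; linarith)⟩

variable (hθ : 0 < θ) (hΦ : IsHolderAutomorphism A Φ)

theorem cocycle_Q (x : X) : (P.cocycle hθ hΦ).Q x = P.conj (LinearMap.id : E x →ₗ[ℝ] E x) := rfl

theorem cocycle_M (x : X) : (P.cocycle hθ hΦ).M x = P.conj (Φ x : E x →ₗ[ℝ] E (T x)) := rfl

theorem cocycle_N (x : X) :
    (P.cocycle hθ hΦ).N x = P.conj ((Φ x).symm : E (T x) →ₗ[ℝ] E x) := rfl

theorem cocycle_Mn (n : ℕ) (x : X) : (P.cocycle hθ hΦ).Mn n x = P.conj (iter Φ n x) := by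
  induction n generalizing x with
  | zero => rfl
  | succ n ih =>
    rw [MatrixCocycle.Mn_succ, ih, cocycle_M, P.conj_mul_conj]
    rfl

variable (g : RiemannianNorm d E)

theorem norm_retr_cocycle_Mn_le {α : X → ℝ} (hα0 : ∀ x, 0 ≤ α x)
    (hα : ∀ x v, g.norm (Φ x v) ≤ α x * g.norm v) (n : ℕ) (x : X) (w : A.Ambient) :
    g.norm (P.retr (T^[n] x) ((P.cocycle hθ hΦ).Mn n x w)) ≤
      (∏ k ∈ Finset.range n, α (T^[k] x)) * g.norm (P.retr x w) := by
  rw [cocycle_Mn, P.retr_conj]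
  generalize P.retr x w = v
  induction n generalizing x with
  | zero =>
    rw [Finset.prod_range_zero, one_mul]
    exact le_rfl
  | succ n ih =>
    rw [Finset.prod_range_succ', mul_assoc]
    refine (ih (T x) (Φ x v)).trans ?_
    have : 0 ≤ ∏ k ∈ Finset.range n, α (T^[k] (T x)) := Finset.prod_nonneg fun _ _ => hα0 _
    exact mul_le_mul_of_nonneg_left (hα x v) this

theorem norm_retr_cocycle_Nn_le {β : X → ℝ} (hβ0 : ∀ x, 0 ≤ β x)
    (hβ : ∀ x v, g.norm ((Φ x).symm v) ≤ β x * g.norm v) (n : ℕ) (x : X) (w : A.Ambient) :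
    g.norm (P.retr x ((P.cocycle hθ hΦ).Nn n x w)) ≤
      (∏ k ∈ Finset.range n, β (T^[k] x)) * g.norm (P.retr (T^[n] x) w) := by
  induction n generalizing x with
  | zero =>
    rw [MatrixCocycle.Nn_zero, cocycle_Q, P.retr_conj, Finset.prod_range_zero, one_mul]
    exact le_rfl
  | succ n ih =>
    rw [Finset.prod_range_succ', mul_comm _ (β _), mul_assoc, MatrixCocycle.Nn_succ, cocycle_N,
      mul_apply_eq_comp, P.retr_conj]
    exact (hβ x _).trans (mul_le_mul_of_nonneg_left (ih (T x)) (hβ0 x))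

include P in
/-- The pointwise bunching condition is an open condition, uniformly on `X`. -/
theorem exists_opNorm_mul_opNorm_le {m : X → ℝ} (hm : Continuous m)
    (hΦ : IsHolderAutomorphism A Φ) (hθ : 0 < θ) (h : ∀ x, Real.log (g.bol (Φ x)) < m x) :
    ∃ τ L, 0 < τ ∧ 0 ≤ L ∧ ∀ x y, g.opNorm (Φ x : E x →ₗ[ℝ] E (T x)) *
      g.opNorm ((Φ y).symm : E (T y) →ₗ[ℝ] E y) ≤ Real.exp (m x - τ + L * dist x y) := by
  set α : X → ℝ := fun x => g.opNorm (Φ x : E x →ₗ[ℝ] E (T x)) with hα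
  set β : X → ℝ := fun x => g.opNorm ((Φ x).symm : E (T x) →ₗ[ℝ] E x) with hβ
  have hα0 : ∀ x, 0 ≤ α x := fun x => g.opNorm_nonneg _
  have hβ0 : ∀ x, 0 ≤ β x := fun x => g.opNorm_nonneg _
  obtain ⟨c, hc, hc1, hc2⟩ := P.exists_norm_equiv g hθ
  have hM := P.bddHolderOn_conj_automorphism hΦ
  have hN := P.bddHolderOn_conj_symm hθ hΦ
  have cM := continuousOn_univ.1 (hM.continuousOn (by exact_mod_cast hθ))
  have cN := continuousOn_univ.1 (hN.continuousOn (by exact_mod_cast hθ))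
  have hloc : ∀ x₀, ∃ τ δ, 0 < τ ∧ 0 < δ ∧ ∀ x y, dist x x₀ < δ → dist y x₀ < δ →
      α x * β y ≤ Real.exp (m x - τ) := by
    intro x₀
    set τ := (m x₀ - Real.log (g.bol (Φ x₀))) / 3 with hτ
    have hτ0 : 0 < τ := by have := h x₀; simp only [hτ]; linarith
    have h1 : α x₀ * β x₀ < Real.exp (m x₀ - 2 * τ) := by
      -- This form of the inequality also covers vanishing bolicity, which occurs for the zero
      -- bundle.
      refine (Real.le_exp_log (g.bol (Φ x₀))).trans_lt (Real.exp_lt_exp.2 ?_)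
      simp only [hτ] at hτ0 ⊢
      linarith
    have h2 : Tendsto (fun s => (α x₀ + s) * (β x₀ + s)) (𝓝[>] 0) (𝓝 (α x₀ * β x₀)) := by
      have : Continuous fun s => (α x₀ + s) * (β x₀ + s) := by fun_prop
      simpa using (this.tendsto 0).mono_left nhdsWithin_le_nhds
    obtain ⟨s, hs, hs0⟩ := ((h2.eventually_lt_const h1).and self_mem_nhdsWithin).exists
    have hs0 : 0 < s := hs0
    have h3 : ∀ᶠ x in 𝓝 x₀, ∀ v, g.norm ((Φ x : E x →ₗ[ℝ] E (T x)) v) ≤ (α x₀ + s) * g.norm v :=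
      P.eventually_norm_apply_le g hθ continuous_id T.continuous
        (fun x => (Φ x : E x →ₗ[ℝ] E (T x))) cM fun v hv => by
          refine (g.norm_apply_le_opNorm (P.exists_norm_apply_le g hθ _) v).trans_lt ?_
          have := g.norm_pos hv
          gcongr
          exact lt_add_of_pos_right _ hs0
    have h4 : ∀ᶠ x in 𝓝 x₀, ∀ v, g.norm (((Φ x).symm : E (T x) →ₗ[ℝ] E x) v) ≤
        (β x₀ + s) * g.norm v :=
      P.eventually_norm_apply_le g hθ T.continuous continuous_id
        (fun x => ((Φ x).symm : E (T x) →ₗ[ℝ] E x)) cN fun v hv => by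
          refine (g.norm_apply_le_opNorm (P.exists_norm_apply_le g hθ _) v).trans_lt ?_
          have := g.norm_pos hv
          gcongr
          exact lt_add_of_pos_right _ hs0
    have h5 : ∀ᶠ x in 𝓝 x₀, m x₀ - τ < m x :=
      hm.continuousAt.eventually_const_lt (sub_lt_self _ hτ0)
    obtain ⟨δ, hδ, hball⟩ := Metric.eventually_nhds_iff.1 (h3.and (h4.and h5))
    refine ⟨τ, δ, hτ0, hδ, fun x y hx hy => ?_⟩
    obtain ⟨hx3, -, hx5⟩ := hball hx
    obtain ⟨-, hy4, -⟩ := hball hy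
    have ha := add_nonneg (hα0 x₀) hs0.le
    have hb := add_nonneg (hβ0 x₀) hs0.le
    calc α x * β y ≤ (α x₀ + s) * (β x₀ + s) :=
          mul_le_mul (g.opNorm_le ha hx3) (g.opNorm_le hb hy4) (hβ0 y) ha
      _ ≤ Real.exp (m x₀ - 2 * τ) := hs.le
      _ ≤ _ := Real.exp_le_exp.2 (by linarith)
  obtain ⟨τ, δ, hτ, hδ, hunif⟩ : ∃ τ δ, 0 < τ ∧ 0 < δ ∧ ∀ x ∈ (univ : Set X), ∀ y, dist x y < δ →
      α x * β y ≤ Real.exp (m x - τ) := by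
    refine isCompact_univ.induction_on (p := fun s => ∃ τ δ, 0 < τ ∧ 0 < δ ∧ ∀ x ∈ s, ∀ y,
      dist x y < δ → α x * β y ≤ Real.exp (m x - τ)) ⟨1, 1, one_pos, one_pos, by simp⟩
      (fun s t hst ⟨τ, δ, hτ, hδ, H⟩ => ⟨τ, δ, hτ, hδ, fun x hx => H x (hst hx)⟩) ?_ fun x₀ _ => ?_
    · rintro s t ⟨τ, δ, hτ, hδ, H⟩ ⟨τ', δ', hτ', hδ', H'⟩
      refine ⟨min τ τ', min δ δ', lt_min hτ hτ', lt_min hδ hδ', fun x hx y hxy => ?_⟩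
      rcases hx with hx | hx
      · refine (H x hx y (hxy.trans_le (min_le_left _ _))).trans (Real.exp_le_exp.2 ?_)
        linarith [min_le_left τ τ']
      · refine (H' x hx y (hxy.trans_le (min_le_right _ _))).trans (Real.exp_le_exp.2 ?_)
        linarith [min_le_right τ τ']
    · obtain ⟨τ, δ, hτ, hδ, H⟩ := hloc x₀
      refine ⟨Metric.ball x₀ (δ / 2), mem_nhdsWithin_of_mem_nhds
        (Metric.ball_mem_nhds _ (half_pos hδ)), τ, δ / 2, hτ, half_pos hδ, fun x hx y hxy => ?_⟩
      rw [Metric.mem_ball] at hx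
      refine H x y (by linarith) ?_
      linarith [dist_triangle_left y x₀ x]
  obtain ⟨B, hB, hMB, -⟩ := hM
  obtain ⟨B', hB', hNB, -⟩ := hN
  obtain ⟨S, -, hS⟩ := exists_abs_le_of_continuous hm
  set D := c * B * c * (c * B' * c) + 1 with hD
  have hD1 : 1 ≤ D := by
    have : 0 ≤ c * B * c * (c * B' * c) := by positivity
    linarith
  have hαβ : ∀ x y, α x * β y ≤ D := fun x y => by
    have h1 : α x ≤ c * B * c := g.opNorm_le (by positivity)
      (P.norm_apply_le_of_norm_conj_le g (by linarith) hc1 hc2 (hMB x (mem_univ x)))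
    have h2 : β y ≤ c * B' * c := g.opNorm_le (by positivity)
      (P.norm_apply_le_of_norm_conj_le g (by linarith) hc1 hc2 (hNB y (mem_univ y)))
    have := mul_le_mul h1 h2 (hβ0 y) (by positivity)
    linarith
  have hS' : ∀ x, 0 ≤ S := fun x => (abs_nonneg _).trans (hS x)
  have hlog := Real.log_nonneg hD1
  -- The distance term is needed only for pairs at distance at least `δ`; there this slope makes the
  -- right side exceed the global bound `D`.
  refine ⟨τ, (Real.log D + |S| + τ) / δ, hτ, by positivity, fun x y => ?_⟩
  by_cases hxy : dist x y < δ
  · refine (hunif x (mem_univ x) y hxy).trans (Real.exp_le_exp.2 ?_)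
    have : 0 ≤ (Real.log D + |S| + τ) / δ * dist x y := by positivity
    linarith
  · push Not at hxy
    refine (hαβ x y).trans ((Real.log_le_iff_le_exp (by linarith)).1 ?_)
    have h1 : Real.log D + |S| + τ ≤ (Real.log D + |S| + τ) / δ * dist x y := by
      rw [div_mul_eq_mul_div, le_div_iff₀ hδ]
      gcongr
    have h2 := (neg_le_abs (m x)).trans (hS x)
    linarith [le_abs_self S]

/-- Multiply the two-point estimate along both orbits. The products are formed in the Riemannian
norm, so the comparison with the ambient norm costs the fixed factor `c ^ 4` and not a factor per
step. -/
theorem bunchedBy_cocycle {m : X → ℝ} (hm : Continuous m)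
    (h : ∀ x, Real.log (g.bol (Φ x)) < m x) : (P.cocycle hθ hΦ).BunchedBy m := by
  obtain ⟨τ, L, hτ, hL, H⟩ := P.exists_opNorm_mul_opNorm_le g hm hΦ hθ h
  obtain ⟨c, hc, hc1, hc2⟩ := P.exists_norm_equiv g hθ
  set α : X → ℝ := fun x => g.opNorm (Φ x : E x →ₗ[ℝ] E (T x)) with hα
  set β : X → ℝ := fun x => g.opNorm ((Φ x).symm : E (T x) →ₗ[ℝ] E x) with hβ
  have hα0 : ∀ x, 0 ≤ α x := fun x => g.opNorm_nonneg _
  have hβ0 : ∀ x, 0 ≤ β x := fun x => g.opNorm_nonneg _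
  have hMn : ∀ n x, ‖(P.cocycle hθ hΦ).Mn n x‖ ≤ c * (∏ k ∈ Finset.range n, α (T^[k] x)) * c := by
    intro n x
    have h0 : 0 ≤ ∏ k ∈ Finset.range n, α (T^[k] x) := Finset.prod_nonneg fun _ _ => hα0 _
    refine ContinuousLinearMap.opNorm_le_bound _ (by positivity) fun w => ?_
    rw [← MatrixCocycle.Q_mul_Mn, mul_apply_eq_comp, cocycle_Q, P.conj_apply]
    calc _ ≤ c * g.norm (P.retr (T^[n] x) ((P.cocycle hθ hΦ).Mn n x w)) := hc2 _ _
      _ ≤ c * ((∏ k ∈ Finset.range n, α (T^[k] x)) * (c * ‖w‖)) := by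
        gcongr
        exact (P.norm_retr_cocycle_Mn_le hθ hΦ g hα0 (fun x v =>
          g.norm_apply_le_opNorm (P.exists_norm_apply_le g hθ _) v) n x w).trans
            (by gcongr; exact hc1 _ _)
      _ = _ := by ring
  have hNn : ∀ n x, ‖(P.cocycle hθ hΦ).Nn n x‖ ≤ c * (∏ k ∈ Finset.range n, β (T^[k] x)) * c := by
    intro n x
    have h0 : 0 ≤ ∏ k ∈ Finset.range n, β (T^[k] x) := Finset.prod_nonneg fun _ _ => hβ0 _
    refine ContinuousLinearMap.opNorm_le_bound _ (by positivity) fun w => ?_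
    rw [← MatrixCocycle.Q_mul_Nn, mul_apply_eq_comp, cocycle_Q, P.conj_apply]
    calc _ ≤ c * g.norm (P.retr x ((P.cocycle hθ hΦ).Nn n x w)) := hc2 _ _
      _ ≤ c * ((∏ k ∈ Finset.range n, β (T^[k] x)) * (c * ‖w‖)) := by
        gcongr
        exact (P.norm_retr_cocycle_Nn_le hθ hΦ g hβ0 (fun x v =>
          g.norm_apply_le_opNorm (P.exists_norm_apply_le g hθ _) v) n x w).trans
            (by gcongr; exact hc1 _ _)
      _ = _ := by ring
  refine ⟨c ^ 4, L, τ, by positivity, hL, hτ, fun n x y => ?_⟩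
  have h1 : (∏ k ∈ Finset.range n, α (T^[k] x)) * ∏ k ∈ Finset.range n, β (T^[k] y) ≤
      Real.exp (birkhoffSum T m n x - n * τ +
        L * ∑ k ∈ Finset.range n, dist (T^[k] x) (T^[k] y)) := by
    rw [← Finset.prod_mul_distrib]
    refine (Finset.prod_le_prod (fun k _ => mul_nonneg (hα0 _) (hβ0 _)) fun k _ => H _ _).trans ?_
    rw [← Real.exp_sum, Finset.sum_add_distrib, Finset.sum_sub_distrib, ← Finset.mul_sum]
    simp [birkhoffSum]
  calc _ ≤ (c * (∏ k ∈ Finset.range n, α (T^[k] x)) * c) *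
        (c * (∏ k ∈ Finset.range n, β (T^[k] y)) * c) :=
        mul_le_mul (hMn n x) (hNn n y) (norm_nonneg _) ((norm_nonneg _).trans (hMn n x))
    _ = c ^ 4 * ((∏ k ∈ Finset.range n, α (T^[k] x)) * ∏ k ∈ Finset.range n, β (T^[k] y)) := by ring
    _ ≤ _ := by gcongr

end HolderPartition

end Cocycle

end HolderCocycle

namespace HolderCocycle

/-! ### Translation between holonomies of the bundle and of its matrix cocycle. -/

section Holonomies

variable {X : Type*} [MetricSpace X] [CompactSpace X] {d : ℕ} {E : X → Type*}
  [TopologicalSpace (TotalSpace (Model d) E)] [∀ x, AddCommGroup (E x)] [∀ x, Module ℝ (E x)]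
  {θ : ℝ≥0} {A : HolderAtlas d E θ} (P : HolderPartition A) {T : X ≃ₜ X}
  {Φ : ∀ x, E x ≃ₗ[ℝ] E (T x)}

namespace HolderPartition

omit [CompactSpace X] in
theorem incl_retr (x : X) (w : A.Ambient) :
    P.incl x (P.retr x w) = P.conj (LinearMap.id : E x →ₗ[ℝ] E x) w := rfl

variable (hθ : 0 < θ) (hΦ : IsHolderAutomorphism A Φ) {V Vloc : X → Set X}

theorem isHolonomy_of_matrix [∀ x, TopologicalSpace (E x)] [FiberBundle (Model d) E]
    (g : RiemannianNorm d E) {K : X → X → A.Ambient →L[ℝ] A.Ambient}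
    (refl : ∀ x, K x x = (P.cocycle hθ hΦ).Q x)
    (comp : ∀ x y z, y ∈ V x → z ∈ V y → K y z * K x y = K x z)
    (equivariant : ∀ x y, y ∈ V x →
      (P.cocycle hθ hΦ).M y * K x y = K (T x) (T y) * (P.cocycle hθ hΦ).M x)
    (Q_mul : ∀ x y, (P.cocycle hθ hΦ).Q y * K x y = K x y)
    (holder : ∃ C, 0 < C ∧ ∀ x, ∀ y ∈ Vloc x,
      ‖K x y - (P.cocycle hθ hΦ).Q y * (P.cocycle hθ hΦ).Q x‖ ≤ C * dist x y ^ (θ : ℝ))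
    (cont : ContinuousOn (fun p : X × X => K p.1 p.2) {p | p.2 ∈ Vloc p.1}) :
    IsHolonomy A Φ V Vloc fun x y =>
      P.retr y ∘ₗ (K x y : A.Ambient →ₗ[ℝ] A.Ambient) ∘ₗ P.incl x := by
  refine ⟨fun x => ?_, fun x y z hy hz => ?_, fun x y hy => ?_, ?_, ?_⟩
  · ext v
    change P.retr x (K x x (P.incl x v)) = v
    rw [refl, cocycle_Q, P.retr_conj, P.retr_incl]
    rfl
  · ext v
    change P.retr z (K y z (P.incl y (P.retr y (K x y (P.incl x v))))) =
      P.retr z (K x z (P.incl x v))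
    rw [incl_retr, ← P.cocycle_Q hθ hΦ, ← mul_apply_eq_comp ((P.cocycle hθ hΦ).Q y), Q_mul,
      ← comp x y z hy hz]
    rfl
  · ext v
    change Φ y (P.retr y (K x y (P.incl x v))) = P.retr (T y) (K (T x) (T y) (P.incl (T x) (Φ x v)))
    have h1 := P.retr_conj (Φ y : E y →ₗ[ℝ] E (T y)) (K x y (P.incl x v))
    have h2 := P.conj_incl (Φ x : E x →ₗ[ℝ] E (T x)) v
    simp only [LinearEquiv.coe_coe] at h1 h2
    rw [← h1, ← h2, ← P.cocycle_M hθ hΦ, ← P.cocycle_M hθ hΦ]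
    exact congrArg (P.retr (T y)) (DFunLike.congr_fun (equivariant x y hy) (P.incl x v))
  · obtain ⟨c, hc, hc1, hc2⟩ := P.exists_norm_equiv g hθ
    obtain ⟨C, hC, H⟩ := holder
    refine ⟨_, g, P.isTransport, c * C * c, by positivity, fun x y hy => ?_⟩
    refine g.opNorm_le (by positivity) fun v => ?_
    have e : (P.retr y ∘ₗ (K x y : A.Ambient →ₗ[ℝ] A.Ambient) ∘ₗ P.incl x -
        P.retr y ∘ₗ P.incl x) v = P.retr y
          ((K x y - (P.cocycle hθ hΦ).Q y * (P.cocycle hθ hΦ).Q x) (P.incl x v)) := by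
      rw [LinearMap.sub_apply, sub_apply, map_sub, mul_apply_eq_comp, cocycle_Q, cocycle_Q,
        P.conj_incl, P.retr_conj]
      rfl
    rw [e]
    calc _ ≤ c * ‖(K x y - (P.cocycle hθ hΦ).Q y * (P.cocycle hθ hΦ).Q x) (P.incl x v)‖ := hc1 _ _
      _ ≤ c * (C * dist x y ^ (θ : ℝ) * (c * g.norm v)) := by
        gcongr
        exact ContinuousLinearMap.le_of_opNorm_le_of_le _ (H x y hy) (hc2 x v)
      _ = _ := by ring
  · have hproj : Continuous fun q : TotalSpace (Model d) E × X => (q.1.proj, q.2) :=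
      ((FiberBundle.continuous_proj (Model d) E).comp continuous_fst).prodMk continuous_snd
    have h1 : ContinuousOn (fun q : TotalSpace (Model d) E × X => K q.1.proj q.2)
        {q | q.2 ∈ Vloc q.1.proj} := cont.comp hproj.continuousOn fun q hq => hq
    have h2 : Continuous fun q : TotalSpace (Model d) E × X => P.incl q.1.proj q.1.snd :=
      (P.continuous_incl hθ).comp continuous_fst
    exact (P.continuous_retr hθ).comp_continuousOn
      (continuousOn_snd.prodMk (h1.clm_apply h2.continuousOn))

variable {H : ∀ x y, E x →ₗ[ℝ] E y}

include hΦ in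
-- The transport maps attached to a holonomy are arbitrary. Being Hölder in both points and trivial
-- on the diagonal, they are Hölder-close to the product of the projections.
theorem norm_conj_holonomy_sub_le (hH : IsHolonomy A Φ V Vloc H) :
    ∃ C, 0 < C ∧ ∀ x, ∀ y ∈ Vloc x,
      ‖P.conj (H x y) - (P.cocycle hθ hΦ).Q y * (P.cocycle hθ hΦ).Q x‖ ≤
        C * dist x y ^ (θ : ℝ) := by
  obtain ⟨I, g, hI, C, hC, hHI⟩ := hH.holder
  obtain ⟨c, hc, hc1, hc2⟩ := P.exists_norm_equiv g hθ
  obtain ⟨D, hD, -, hIh⟩ := P.bddHolderOn_conj (p := Prod.fst) (q := Prod.snd)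
    ⟨1, LipschitzWith.prod_fst⟩ ⟨1, LipschitzWith.prod_snd⟩ (fun z : X × X => I z.1 z.2) hI.2
  obtain ⟨B, hB, hQB⟩ := (P.cocycle hθ hΦ).bound
  obtain ⟨F, hF, hQh⟩ := (P.cocycle hθ hΦ).holder
  refine ⟨c * C * c + D + F * B, by positivity, fun x y hy => ?_⟩
  set Q := (P.cocycle hθ hΦ).Q with hQ
  have h0 : 0 ≤ dist x y ^ (θ : ℝ) := by positivity
  have h1 : ‖P.conj (H x y - I x y)‖ ≤ c * (C * dist x y ^ (θ : ℝ)) * c := by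
    refine P.norm_conj_le g (by positivity) (by positivity) hc1 hc2 fun v => ?_
    refine (g.norm_apply_le_opNorm (P.exists_norm_apply_le g hθ _) v).trans ?_
    have := g.norm_nonneg v
    gcongr
    exact hHI x y hy
  have h2 : ‖P.conj (I x y) - Q x‖ ≤ D * dist x y ^ (θ : ℝ) := by
    have := hIh (x, y) (mem_univ _) (x, x) (mem_univ _)
    simp only [hI.1] at this
    rwa [Prod.dist_eq, dist_self, max_eq_right dist_nonneg, dist_comm] at this
  have h3 : ‖(Q x - Q y) * Q x‖ ≤ F * dist x y ^ (θ : ℝ) * B :=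
    (norm_mul_le _ _).trans (mul_le_mul (hQh x y).1 (hQB x).1 (norm_nonneg _) (by positivity))
  have e : P.conj (H x y) - Q y * Q x =
      P.conj (H x y - I x y) + (P.conj (I x y) - Q x) + (Q x - Q y) * Q x := by
    rw [P.conj_sub, sub_mul, (P.cocycle hθ hΦ).Q_mul_Q]
    abel
  rw [e]
  refine norm_add₃_le.trans ((add_le_add (add_le_add h1 h2) h3).trans_eq ?_)
  ring

include hθ in
theorem continuousOn_conj_holonomy (hH : IsHolonomy A Φ V Vloc H) :
    ContinuousOn (fun p : X × X => P.conj (H p.1 p.2)) {p | p.2 ∈ Vloc p.1} := by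
  rw [continuousOn_clm_apply]
  intro w
  simp only [P.conj_apply]
  have h1 : Continuous fun p : X × X =>
      ((⟨p.1, P.retr p.1 w⟩ : TotalSpace (Model d) E), p.2) :=
    ((P.continuous_retr hθ).comp (continuous_fst.prodMk continuous_const)).prodMk continuous_snd
  have h2 := hH.continuous.comp h1.continuousOn (s := {p : X × X | p.2 ∈ Vloc p.1})
    fun p hp => hp
  exact (P.continuous_incl hθ).comp_continuousOn h2

/-- Spannability speaks of any holonomies with the characteristic properties, not only those
constructed above, so they all have to be turned into operator families. -/
theorem isStableFamily_conj {ε₀ : ℝ} (hH : IsStableHolonomy A Φ ε₀ H) :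
    (P.cocycle hθ hΦ).IsStableFamily ε₀ fun x y => P.conj (H x y) where
  refl x := by rw [hH.refl, cocycle_Q]
  comp x y z hy hz := by rw [P.conj_mul_conj, hH.comp x y z hy hz]
  equivariant x y hy := by
    rw [cocycle_M, cocycle_M, P.conj_mul_conj, P.conj_mul_conj, hH.equivariant x y hy]
  Q_mul x y := by rw [cocycle_Q, P.conj_mul_conj, LinearMap.id_comp]
  mul_Q x y := by rw [cocycle_Q, P.conj_mul_conj, LinearMap.comp_id]
  holder := P.norm_conj_holonomy_sub_le hθ hΦ hH
  continuousOn := P.continuousOn_conj_holonomy hθ hH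

theorem isStableFamily_rev_conj {ε₀ : ℝ} (hθ' : 0 ≤ (θ : ℝ))
    (hT : ∃ K : ℝ≥0, LipschitzWith K T.symm) (hH : IsUnstableHolonomy A Φ ε₀ H) :
    ((P.cocycle hθ hΦ).rev hθ' hT).IsStableFamily ε₀ fun x y => P.conj (H x y) where
  refl x := by rw [hH.refl]; rfl
  comp x y z hy hz := by rw [P.conj_mul_conj, hH.comp x y z hy hz]
  equivariant x y hy := by
    set c := P.cocycle hθ hΦ with hc
    change c.N (T.symm y) * P.conj (H x y) =
      P.conj (H (T.symm x) (T.symm y)) * c.N (T.symm x)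
    have hy' : T.symm y ∈ unstableSet T (T.symm x) := (unstableSet_symm_iterate_iff 1).2 hy
    set F : X → X → A.Ambient →L[ℝ] A.Ambient := fun x y => P.conj (H x y) with hF
    change c.N (T.symm y) * F x y = F (T.symm x) (T.symm y) * c.N (T.symm x)
    -- Equivariance under the inverse cocycle follows from that under `M` at the preimages,
    -- multiplied by `N` on both sides.
    have h1 : c.M (T.symm y) * F (T.symm x) (T.symm y) =
        F (T (T.symm x)) (T (T.symm y)) * c.M (T.symm x) := by
      rw [hF, hc, cocycle_M, cocycle_M, P.conj_mul_conj, P.conj_mul_conj, hH.equivariant _ _ hy']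
    have h2 : c.Q (T.symm y) * F (T.symm x) (T.symm y) = F (T.symm x) (T.symm y) := by
      rw [hF, hc, cocycle_Q, P.conj_mul_conj, LinearMap.id_comp]
    have h3 : F x y * c.Q x = F x y := by
      rw [hF, hc, cocycle_Q, P.conj_mul_conj, LinearMap.comp_id]
    have h4 := congrArg (fun Z => c.N (T.symm y) * Z * c.N (T.symm x)) h1
    simp only [T.apply_symm_apply, mul_assoc, c.M_mul_N] at h4
    rw [h3, ← mul_assoc, c.N_mul_M, ← mul_assoc, h2] at h4
    exact h4.symm
  Q_mul x y := by
    change (P.cocycle hθ hΦ).Q y * _ = _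
    rw [cocycle_Q, P.conj_mul_conj, LinearMap.id_comp]
  mul_Q x y := by
    change _ * (P.cocycle hθ hΦ).Q x = _
    rw [cocycle_Q, P.conj_mul_conj, LinearMap.comp_id]
  holder := P.norm_conj_holonomy_sub_le hθ hΦ hH
  continuousOn := P.continuousOn_conj_holonomy hθ hH

end HolderPartition

end Holonomies

end HolderCocycle

namespace HolderCocycle

/-! ### The saturated set generated by one vector. -/

section Saturated

variable {X : Type*} [MetricSpace X] {W : Type*} [NormedAddCommGroup W] [NormedSpace ℝ W]
  {T : X ≃ₜ X} {θ : ℝ} {c : MatrixCocycle T θ W}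

/-- The set of all vectors obtained from a given nonzero vector by unstable holonomies and iteration
is saturated. -/
theorem MatrixCocycle.isSaturated_of_ne_zero {hθ : 0 ≤ θ}
    {hT : ∃ K : ℝ≥0, LipschitzWith K T.symm} {ε : ℝ} {Ku : X → X → W →L[ℝ] W}
    (hu : (c.rev hθ hT).IsStableFamily ε Ku) {x : X} {w : W} (hQ : c.Q x w = w) (hw : w ≠ 0) :
    c.IsSaturated Ku {z | ∃ x' ∈ unstableSet T x, ∃ n, z = (T^[n] x', c.Mn n x' (Ku x x' w))} where
  nonempty := ⟨_, x, mem_stableSet_self T.symm x, 0, rfl⟩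
  ne_zero := by
    rintro _ ⟨x', hx', n, rfl⟩ h0
    have h1 : Ku x x' w = 0 := by
      have h2 := congrArg (c.Nn n x') h0
      rw [map_zero, ← mul_apply_eq_comp, c.Nn_mul_Mn, ← mul_apply_eq_comp] at h2
      rwa [show c.Q x' * Ku x x' = Ku x x' from hu.Q_mul x x'] at h2
    have h2 := congrArg (Ku x' x) h1
    rw [map_zero, ← mul_apply_eq_comp, hu.comp x x' x hx' (mem_stableSet_comm.1 hx'),
      hu.refl] at h2
    exact hw (hQ.symm.trans h2)
  Q_apply := by
    rintro _ ⟨x', hx', n, rfl⟩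
    exact DFunLike.congr_fun (c.Q_mul_Mn n x') _
  map := by
    rintro _ ⟨x', hx', n, rfl⟩
    refine ⟨x', hx', n + 1, ?_⟩
    rw [Function.iterate_succ_apply', c.Mn_succ']
    rfl
  unstable := by
    rintro _ ⟨x', hx', n, rfl⟩ z hz
    obtain ⟨x'', rfl⟩ : ∃ x'', T^[n] x'' = z := ⟨_, iterate_symm_iterate T n z⟩
    have hx'' : x'' ∈ unstableSet T x' := (unstableSet_iterate_iff n).1 hz
    refine ⟨x'', mem_stableSet_trans hx' hx'', n, ?_⟩
    rw [← mul_apply_eq_comp (Ku _ _), ← hu.rev_equivariant_iterate hx'', mul_apply_eq_comp,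
      ← hu.comp x x' x'' hx' hx'', mul_apply_eq_comp]

end Saturated

/-! ### From families of subspaces of the ambient space to Hölder subbundles. -/

section Subbundles

variable {X : Type*} [MetricSpace X] {d : ℕ} {E : X → Type*}
  [TopologicalSpace (TotalSpace (Model d) E)] [∀ x, AddCommGroup (E x)] [∀ x, Module ℝ (E x)]
  {θ : ℝ≥0} {A : HolderAtlas d E θ} (P : HolderPartition A)

theorem range_eq_of_finrank_le {V V' : Type*} [AddCommGroup V] [Module ℝ V] [AddCommGroup V']
    [Module ℝ V'] [FiniteDimensional ℝ V'] {F : V →ₗ[ℝ] V'} (hF : Function.Injective F)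
    {S : Submodule ℝ V'} (hS : ∀ v, F v ∈ S)
    (h : Module.finrank ℝ S ≤ Module.finrank ℝ V) : LinearMap.range F = S := by
  refine Submodule.eq_of_le_of_finrank_le ?_ (h.trans_eq (LinearMap.finrank_range_of_inj hF).symm)
  rintro _ ⟨v, rfl⟩
  exact hS v

theorem HolderAtlas.finrank_eq (A : HolderAtlas d E θ) (x : X) : Module.finrank ℝ (E x) = d := by
  obtain ⟨i, hi⟩ := A.cover x
  rw [((A.chart i).linearEquivAt ℝ x hi).finrank_eq, finrank_euclideanSpace_fin]

namespace HolderPartition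

include P in
theorem finiteDimensional (x : X) : FiniteDimensional ℝ (E x) :=
  FiniteDimensional.of_injective (P.incl x) (P.incl_injective x)

/-- Vectors fixed by the projection are recovered from their retractions by `incl`. -/
theorem finrank_map_retr {x : X} {S : Submodule ℝ A.Ambient}
    (hS : ∀ v ∈ S, P.conj (LinearMap.id : E x →ₗ[ℝ] E x) v = v) :
    Module.finrank ℝ (S.map (P.retr x)) = Module.finrank ℝ S := by
  have := P.finiteDimensional x
  refine le_antisymm (Submodule.finrank_map_le _ _) ?_
  refine (Submodule.finrank_mono (t := (S.map (P.retr x)).map (P.incl x)) fun v hv => ?_).trans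
    (Submodule.finrank_map_le _ _)
  exact ⟨_, ⟨v, hv, rfl⟩, hS v hv⟩

/-- A family of subspaces of constant dimension is a Hölder subbundle if nearby subspaces are related
by maps that are Hölder-close to the transport maps. -/
theorem isHolderSubbundle_map_retr [CompactSpace X] (hθ : 0 < θ) (g : RiemannianNorm d E)
    {S : X → Submodule ℝ A.Ambient} {p : ℕ} (hp : ∀ x, Module.finrank ℝ (S x) = p)
    (hS : ∀ x, ∀ v ∈ S x, P.conj (LinearMap.id : E x →ₗ[ℝ] E x) v = v)
    (htr : ∃ δ D, 0 < δ ∧ 0 < D ∧ ∀ x y, dist x y < δ → ∃ K : A.Ambient →L[ℝ] A.Ambient,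
      (∀ v ∈ S x, K v ∈ S y) ∧ ‖K - P.conj (LinearMap.id : E y →ₗ[ℝ] E y) *
        P.conj (LinearMap.id : E x →ₗ[ℝ] E x)‖ ≤ D * dist x y ^ (θ : ℝ)) :
    IsHolderSubbundle A p fun x => (S x).map (P.retr x) := by
  have hθ' : (0 : ℝ) < θ := by exact_mod_cast hθ
  refine ⟨fun x => (P.finrank_map_retr (hS x)).trans (hp x), _, g, P.isTransport, ?_⟩
  obtain ⟨δ, D, hδ, hD, H⟩ := htr
  obtain ⟨c, hc, hc1, hc2⟩ := P.exists_norm_equiv g hθ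
  obtain ⟨F, hF, -, hQh⟩ := P.bddHolderOn_conj_id
  set Q : X → A.Ambient →L[ℝ] A.Ambient := fun x => P.conj (LinearMap.id : E x →ₗ[ℝ] E x) with hQ
  -- Below this distance both `K` and `Q y` move vectors of `S x` by at most half their norm.
  set δ' := (1 / (2 * (D + F))) ^ (θ : ℝ)⁻¹ with hδ'
  have hδ'0 : 0 < δ' := by positivity
  refine ⟨min δ δ', 2 * c * c * D, lt_min hδ hδ'0, fun x y hxy => ?_⟩
  obtain ⟨K, hK, hKd⟩ := H x y (hxy.trans_le (min_le_left _ _))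
  have := P.finiteDimensional x
  have := P.finiteDimensional y
  have h0 : 0 ≤ dist x y ^ (θ : ℝ) := by positivity
  have hsmall : (D + F) * dist x y ^ (θ : ℝ) ≤ 1 / 2 := by
    have h1 : dist x y ^ (θ : ℝ) ≤ δ' ^ (θ : ℝ) :=
      Real.rpow_le_rpow dist_nonneg (hxy.le.trans (min_le_right _ _)) hθ'.le
    rw [hδ', Real.rpow_inv_rpow (by positivity) hθ'.ne', le_div_iff₀ (by positivity)] at h1
    linarith
  have hlow : ∀ z, Q y z = z → ‖z‖ ≤ c * g.norm (P.retr y z) := fun z hz => by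
    have h1 := hc2 y (P.retr y z)
    rwa [show P.incl y (P.retr y z) = z from hz] at h1
  have hQQ : ∀ w ∈ S x, ‖Q y w - w‖ ≤ F * dist x y ^ (θ : ℝ) * ‖w‖ := fun w hw => by
    have h1 : Q y w - w = (Q y - Q x) w := by rw [sub_apply, show Q x w = w from hS x w hw]
    rw [h1]
    refine ContinuousLinearMap.le_of_opNorm_le _ ?_ w
    rw [norm_sub_rev]
    exact hQh x (mem_univ x) y (mem_univ y)
  have hKQ : ∀ w ∈ S x, ‖K w - Q y w‖ ≤ D * dist x y ^ (θ : ℝ) * ‖w‖ := fun w hw => by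
    have h1 : K w - Q y w = (K - Q y * Q x) w := by
      rw [sub_apply, mul_apply_eq_comp, show Q x w = w from hS x w hw]
    rw [h1]
    exact ContinuousLinearMap.le_of_opNorm_le _ hKd w
  let B := ((stdOrthonormalBasis ℝ (S x)).reindex (finCongr (hp x))).repr.symm
  have hB : ∀ v, ‖(B v : A.Ambient)‖ = ‖v‖ := fun v => B.norm_map v
  let ι : EuclideanSpace ℝ (Fin p) →ₗ[ℝ] A.Ambient :=
    (S x).subtype ∘ₗ (B.toLinearEquiv : EuclideanSpace ℝ (Fin p) →ₗ[ℝ] S x)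
  have hι : ∀ v, ι v ∈ S x := fun v => (B v).2
  have hιn : ∀ v, ‖ι v‖ = ‖v‖ := hB
  -- `ι` is isometric, the operators at most halve norms on `S x`, and the retraction loses at most
  -- a factor `c` on embedded vectors. Scaling by `2 * c` therefore makes both frames expanding, as
  -- `grassDist` demands.
  let F₁ : EuclideanSpace ℝ (Fin p) →ₗ[ℝ] E y :=
    (2 * c) • (P.retr y ∘ₗ (K : A.Ambient →ₗ[ℝ] A.Ambient) ∘ₗ ι)
  let F₂ : EuclideanSpace ℝ (Fin p) →ₗ[ℝ] E y :=
    (2 * c) • (P.retr y ∘ₗ (Q y : A.Ambient →ₗ[ℝ] A.Ambient) ∘ₗ ι)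
  have hF₁ : ∀ v, F₁ v = (2 * c) • P.retr y (K (ι v)) := fun v => rfl
  have hF₂ : ∀ v, F₂ v = (2 * c) • P.retr y (Q y (ι v)) := fun v => rfl
  have hsm : ∀ v : E y, g.norm ((2 * c) • v) = 2 * (c * g.norm v) := fun v => by
    rw [g.norm_smul, abs_of_pos (by positivity), mul_assoc]
  have hexp : ∀ v, ∀ z, Q y z = z → ‖z - ι v‖ ≤ 1 / 2 * ‖ι v‖ →
      ‖v‖ ≤ g.norm ((2 * c) • P.retr y z) := fun v z hz hzv => by
    rw [hsm]
    have h1 := hlow z hz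
    have h2 := norm_sub_norm_le (ι v) z
    rw [norm_sub_rev] at h2
    rw [hιn] at h2 hzv
    linarith
  have hE₁ : ∀ v, ‖v‖ ≤ g.norm (F₁ v) := fun v => by
    refine hexp v (K (ι v)) (hS y _ (hK _ (hι v))) ?_
    have h1 := hQQ _ (hι v)
    have h2 := hKQ _ (hι v)
    have h3 := norm_sub_le_norm_sub_add_norm_sub (K (ι v)) (Q y (ι v)) (ι v)
    have h4 := mul_le_mul_of_nonneg_right hsmall (norm_nonneg (ι v))
    linarith
  have hE₂ : ∀ v, ‖v‖ ≤ g.norm (F₂ v) := fun v => by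
    refine hexp v (Q y (ι v)) ?_ ?_
    · rw [← mul_apply_eq_comp, hQ]
      simp only [P.conj_mul_conj, LinearMap.id_comp]
    · have h1 := hQQ _ (hι v)
      have h4 := mul_le_mul_of_nonneg_right hsmall (norm_nonneg (ι v))
      have h5 : 0 ≤ D * dist x y ^ (θ : ℝ) * ‖ι v‖ := by positivity
      linarith
  have hinj : ∀ G : EuclideanSpace ℝ (Fin p) →ₗ[ℝ] E y, (∀ v, ‖v‖ ≤ g.norm (G v)) →
      Function.Injective G := fun G hG => (injective_iff_map_eq_zero G).2 fun v hv => by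
    have h1 := hG v
    rw [hv, g.norm_zero] at h1
    exact norm_le_zero_iff.1 h1
  refine csInf_le ⟨0, fun _ hc => hc.1⟩ ⟨by positivity, F₁, F₂, ?_, ?_, hE₁, hE₂, fun v => ?_⟩
  · refine range_eq_of_finrank_le (hinj F₁ hE₁) (fun v => ?_) ?_
    · exact Submodule.smul_mem _ _ ⟨_, hK _ (hι v), rfl⟩
    · rw [P.finrank_map_retr (hS y), hp, finrank_euclideanSpace_fin]
  · refine range_eq_of_finrank_le (hinj F₂ hE₂) (fun v => ?_) ?_
    · refine Submodule.smul_mem _ _ ⟨_, ⟨_, hι v, rfl⟩, ?_⟩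
      have h1 : P.incl x (P.retr x (ι v)) = ι v := hS x _ (hι v)
      change P.retr y (P.incl x (P.retr x (ι v))) = P.retr y (Q y (ι v))
      rw [h1]
      exact (P.retr_conj (LinearMap.id : E y →ₗ[ℝ] E y) (ι v)).symm
    · refine (Submodule.finrank_map_le _ _).trans ?_
      rw [P.finrank_map_retr (hS x), hp, finrank_euclideanSpace_fin]
  · rw [hF₁, hF₂, ← smul_sub, hsm, ← map_sub]
    calc _ ≤ 2 * (c * (c * (D * dist x y ^ (θ : ℝ) * ‖ι v‖))) := by
          gcongr
          exact (hc1 _ _).trans (by gcongr; exact hKQ _ (hι v))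
      _ = _ := by rw [hιn]; ring

end HolderPartition

end Subbundles

end HolderCocycle

namespace HolderCocycle

/-! ### Assembly: exponents, existence of holonomies, reduction, and the theorem. -/

section Spannability

variable {X : Type*} [MetricSpace X] [CompactSpace X] {d : ℕ} {E : X → Type*}
  [TopologicalSpace (TotalSpace (Model d) E)] [∀ x, AddCommGroup (E x)] [∀ x, Module ℝ (E x)]
  {θ : ℝ≥0} {A : HolderAtlas d E θ} {T : X ≃ₜ X} {Φ : ∀ x, E x ≃ₗ[ℝ] E (T x)}
  {lu ls : X → ℝ} {ε₀ η₀ : ℝ}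

omit [CompactSpace X] in
-- Puts the two alternatives of strong bunching in one form, with `η = θ` for rank at most two; only
-- the proof of unstable invariance tells them apart.
theorem IsStronglyBunched.exists_exponent (hθ : 0 < θ)
    (hη₀ : IsStrongBunchingExponent T ε₀ lu ls θ η₀) (h : IsStronglyBunched d Φ θ lu ls η₀) :
    ∃ η : ℝ, 0 < η ∧ η ≤ θ ∧ IsBunched d Φ lu ls η θ ∧ (d ≤ 2 ∨ η = η₀) := by
  rcases h with ⟨hd, h⟩ | h
  · exact ⟨θ, by exact_mod_cast hθ, le_rfl, h, Or.inl hd⟩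
  · exact ⟨η₀, hη₀.1, hη₀.2.1, h, Or.inr rfl⟩

omit [CompactSpace X] in
theorem IsStrongBunchingExponent.exists_isExpansionBound (hT : IsHyperbolic T ε₀ lu ls)
    (hη₀ : IsStrongBunchingExponent T ε₀ lu ls θ η₀) : ∃ Lu : X → ℝ, IsExpansionBound T ε₀ Lu ∧
      ∀ x, η₀ * (ls x + lu x + Lu x) ≤ θ * ls x := by
  obtain ⟨-, -, Lu, hLu, h⟩ := hη₀
  refine ⟨Lu, hLu, fun x => ?_⟩
  have h1 := hT.lu_pos x
  have h2 := hT.ls_pos x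
  have h3 := hLu.2.1 x
  exact (le_div_iff₀ (by positivity)).1 (h x)

namespace HolderPartition

variable (P : HolderPartition A) (hθ : 0 < θ) (hΦ : IsHolderAutomorphism A Φ)

theorem exists_isStableHolonomy [∀ x, TopologicalSpace (E x)] [FiberBundle (Model d) E]
    (g : RiemannianNorm d E) (hT : IsHyperbolic T ε₀ lu ls)
    (hdom : (P.cocycle hθ hΦ).Dominated ε₀ θ) : ∃ H, IsStableHolonomy A Φ ε₀ H := by
  obtain ⟨K, hK⟩ := (P.cocycle hθ hΦ).exists_isStableFamily (by exact_mod_cast hθ) hT.eps_pos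
    (fun x => hT.stable.localStable_subset x hT.eps_pos.le) hdom
  exact ⟨_, P.isHolonomy_of_matrix hθ hΦ g hK.refl hK.comp hK.equivariant hK.Q_mul hK.holder
    hK.continuousOn⟩

theorem exists_isUnstableHolonomy [∀ x, TopologicalSpace (E x)] [FiberBundle (Model d) E]
    (g : RiemannianNorm d E) (hT : IsHyperbolic T ε₀ lu ls) (hθ' : 0 ≤ (θ : ℝ))
    (hdom : ((P.cocycle hθ hΦ).rev hθ' hT.lipschitz_symm).Dominated ε₀ θ) :
    ∃ H, IsUnstableHolonomy A Φ ε₀ H := by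
  obtain ⟨K, hK⟩ := ((P.cocycle hθ hΦ).rev hθ' hT.lipschitz_symm).exists_isStableFamily
    (by exact_mod_cast hθ) hT.eps_pos
    (fun x => hT.unstable.localStable_subset x hT.eps_pos.le) hdom
  refine ⟨_, P.isHolonomy_of_matrix hθ hΦ g hK.refl hK.comp (fun x y hy => ?_) hK.Q_mul hK.holder
    hK.continuousOn⟩
  have h1 := hK.rev_equivariant_iterate hy 1
  rwa [MatrixCocycle.Mn_one, MatrixCocycle.Mn_one] at h1

variable {P hθ hΦ} {Ks Ku : X → X → A.Ambient →L[ℝ] A.Ambient} {R : Set (X × A.Ambient)}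

open MatrixCocycle in
/-- A proper invariant family of subspaces with Hölder transport maps yields a reduction. -/
theorem isReducible_of_finrank_spanAt (g : RiemannianNorm d E)
    (hs : (P.cocycle hθ hΦ).IsStableFamily ε₀ Ks) (hR : (P.cocycle hθ hΦ).IsSaturated Ku R)
    {p : ℕ} (hp0 : 0 < p) (hpd : p < d) (hp : ∀ y, Module.finrank ℝ (spanAt T Ks R y) = p)
    (htr : ∃ δ D, 0 < δ ∧ 0 < D ∧ ∀ y y', dist y y' < δ → ∃ K : A.Ambient →L[ℝ] A.Ambient,
      (∀ v ∈ spanAt T Ks R y, K v ∈ spanAt T Ks R y') ∧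
      ‖K - (P.cocycle hθ hΦ).Q y' * (P.cocycle hθ hΦ).Q y‖ ≤ D * dist y y' ^ (θ : ℝ)) :
    IsReducible A Φ := by
  have hQ : ∀ x, ∀ v ∈ spanAt T Ks R x, P.conj (LinearMap.id : E x →ₗ[ℝ] E x) v = v :=
    fun x v hv => IsSaturated.Q_apply_of_mem hs hv
  refine ⟨p, fun x => (spanAt T Ks R x).map (P.retr x), hp0, hpd,
    P.isHolderSubbundle_map_retr hθ g hp hQ htr, fun x => ?_⟩
  have := P.finiteDimensional (T x)
  refine Submodule.eq_of_le_of_finrank_eq ?_ ?_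
  · rintro _ ⟨_, ⟨v, hv, rfl⟩, rfl⟩
    exact ⟨_, hR.M_apply_mem hs hv, P.retr_conj (Φ x : E x →ₗ[ℝ] E (T x)) v⟩
  · rw [LinearEquiv.finrank_map_eq, P.finrank_map_retr (hQ x), P.finrank_map_retr (hQ (T x)), hp, hp]

open MatrixCocycle in
/-- For a strongly bunched automorphism, the spans of the vectors obtained from a saturated set are
invariant under the local unstable holonomies. -/
theorem exists_Ku_apply_mem {m : X → ℝ} {η : ℝ} (hθ' : 0 < (θ : ℝ)) (hη : 0 < η)
    (hb : (P.cocycle hθ hΦ).BunchedBy m)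
    (hm : ∀ x, m x ≤ η * lu x) (hT : IsHyperbolic T ε₀ lu ls) (hT' : IsTransitive T)
    (hη₀ : IsStrongBunchingExponent T ε₀ lu ls θ η₀) (hd : d ≤ 2 ∨ η = η₀)
    (hs : (P.cocycle hθ hΦ).IsStableFamily ε₀ Ks)
    (hu : ((P.cocycle hθ hΦ).rev hθ'.le hT.lipschitz_symm).IsStableFamily ε₀ Ku)
    (hR : (P.cocycle hθ hΦ).IsSaturated Ku R) {p : ℕ} (hp0 : 0 < p) (hpd : p < d)
    (hp : ∀ y, Module.finrank ℝ (spanAt T Ks R y) = p) :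
    ∃ ρ, 0 < ρ ∧ ∀ y y', y' ∈ localUnstable T ε₀ y → dist y y' < ρ → ∀ v ∈ spanAt T Ks R y,
      Ku y y' v ∈ spanAt T Ks R y' := by
  rcases hd with hd | rfl
  -- A nonzero proper subspace of a fiber of dimension at most two is a line.
  · obtain rfl : p = 1 := by omega
    exact Ku_apply_mem_of_finrank_eq_one hθ' hT hT' hs hu hR hp
  · obtain ⟨Lu, hLu, hstr⟩ := hη₀.exists_isExpansionBound hT
    obtain ⟨δ, D, hδ, hD, hquad⟩ := exists_quadrilateral_holder hθ' hT hs hu hb hLu hη hm hstr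
    exact ⟨1, one_pos, fun y y' hy' _ v hv => Ku_apply_mem_of_quadrilateral hθ' hT hs hu hR hp hδ hD
      hquad (hb.rev_dominated hθ'.le hT.lipschitz_symm hT.unstable hT.eps_pos.le hη.le hm) hy' hv⟩

open MatrixCocycle in
theorem map_retr_spanAt {Hu Hs : ∀ x y, E x →ₗ[ℝ] E y} {x : X} {u : E x} (y : X) :
    (spanAt T (fun x y => P.conj (Hs x y)) {z | ∃ x' ∈ unstableSet T x, ∃ n,
      z = (T^[n] x', (P.cocycle hθ hΦ).Mn n x' (P.conj (Hu x x') (P.incl x u)))} y).map (P.retr y) =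
    Submodule.span ℝ {v | ∃ x' ∈ unstableSet T x, ∃ n, T^[n] x' ∈ stableSet T y ∧
      v = Hs (T^[n] x') y (iter Φ n x' (Hu x x' u))} := by
  rw [spanAt, Submodule.map_span]
  congr 1
  ext v
  constructor
  · rintro ⟨_, ⟨_, ⟨x', hx', n, rfl⟩, hy, rfl⟩, rfl⟩
    refine ⟨x', hx', n, hy, ?_⟩
    rw [P.cocycle_Mn, P.conj_incl, P.conj_incl, P.conj_incl, P.retr_incl]
  · rintro ⟨x', hx', n, hy, rfl⟩
    refine ⟨_, ⟨_, ⟨x', hx', n, rfl⟩, hy, rfl⟩, ?_⟩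
    rw [P.cocycle_Mn, P.conj_incl, P.conj_incl, P.conj_incl, P.retr_incl]

end HolderPartition

end Spannability

end HolderCocycle

theorem theorem3p5
    {X : Type*} [MetricSpace X] [CompactSpace X]
    (θ : ℝ≥0) (hθ : 0 < θ) (hX : HolderNormal X θ)
    (T : X ≃ₜ X) (ε₀ : ℝ) (lu ls : X → ℝ)
    (hT : IsHyperbolic T ε₀ lu ls) (hT' : IsTransitive T)
    (η₀ : ℝ) (hη₀ : IsStrongBunchingExponent T ε₀ lu ls θ η₀)
    {d : ℕ} {E : X → Type*}
    [∀ x, AddCommGroup (E x)] [∀ x, Module ℝ (E x)] [∀ x, TopologicalSpace (E x)]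
    [TopologicalSpace (TotalSpace (Model d) E)]
    [FiberBundle (Model d) E] [VectorBundle ℝ (Model d) E]
    (A : HolderAtlas d E θ)
    (Φ : ∀ x, E x ≃ₗ[ℝ] E (T x)) (hΦ : IsHolderAutomorphism A Φ)
    (hbunched : IsStronglyBunched d Φ θ lu ls η₀) (hirr : IsIrreducible A Φ) :
    IsSpannable A Φ ε₀ := by
  have hθ' : (0 : ℝ) < θ := by exact_mod_cast hθ
  obtain ⟨P⟩ := A.exists_holderPartition hX
  obtain ⟨η, hη, hηθ, ⟨g, hg⟩, hd⟩ := hbunched.exists_exponent hθ hη₀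
  have hb := P.bunchedBy_cocycle hθ hΦ g
    ((hT.continuous_lu.const_mul η).min (hT.continuous_ls.const_mul (θ : ℝ))) hg
  have hmu : ∀ x, min (η * lu x) (θ * ls x) ≤ η * lu x := fun x => min_le_left _ _
  have hms : ∀ x, min (η * lu x) (θ * ls x) ≤ θ * ls x := fun x => min_le_right _ _
  -- Existence of holonomies uses only domination with exponent `θ`; on the unstable side the
  -- stronger bound with `η ≤ θ` is relaxed.
  refine ⟨P.exists_isUnstableHolonomy hθ hΦ g hT hθ'.le
    (hb.rev_dominated hθ'.le hT.lipschitz_symm hT.unstable hT.eps_pos.le hθ'.le fun x =>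
      (hmu x).trans (mul_le_mul_of_nonneg_right hηθ (hT.lu_pos x).le)),
    P.exists_isStableHolonomy hθ hΦ g hT (hb.dominated hT.stable hT.eps_pos.le hθ'.le hms),
    fun Hu Hs hHu hHs x y u hu => ?_⟩
  have hs := P.isStableFamily_conj hθ hΦ hHs
  have hu' := P.isStableFamily_rev_conj hθ hΦ hθ'.le hT.lipschitz_symm hHu
  have hR := MatrixCocycle.isSaturated_of_ne_zero hu' (P.conj_incl LinearMap.id u)
    (P.incl_ne_zero hu)
  obtain ⟨p, hp0, hp⟩ := MatrixCocycle.exists_finrank_eq hθ' hT hT' hs hu' hR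
  have hrank : Module.finrank ℝ (Submodule.span ℝ {v | ∃ x' ∈ unstableSet T x, ∃ n,
      T^[n] x' ∈ stableSet T y ∧ v = Hs (T^[n] x') y (iter Φ n x' (Hu x x' u))}) = p := by
    rw [← P.map_retr_spanAt (hθ := hθ) (hΦ := hΦ),
      P.finrank_map_retr fun v hv => MatrixCocycle.IsSaturated.Q_apply_of_mem hs hv, hp]
  have := P.finiteDimensional y
  have hpd : p = d := by
    refine le_antisymm ?_ (not_lt.1 fun hlt => hirr ?_)
    · rw [← hrank, ← A.finrank_eq y]
      exact Submodule.finrank_le _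
    -- Were `p` smaller than `d`, the spans would be a proper invariant Hölder subbundle.
    · obtain ⟨ρ, hρ, hinv⟩ := HolderPartition.exists_Ku_apply_mem hθ' hη hb hmu hT hT' hη₀ hd hs hu'
        hR hp0 hlt hp
      exact HolderPartition.isReducible_of_finrank_spanAt g hs hR hp0 hlt hp
        (MatrixCocycle.exists_transport_spanAt hθ' hT hs hu' hρ hinv)
  subst hpd
  -- The basis is selected among the generators themselves, so each of its members comes with a
  -- point and an iteration time.
  obtain ⟨f, hf, hspan, hli⟩ := Submodule.exists_fun_fin_finrank_span_eq ℝ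
    {v | ∃ x' ∈ unstableSet T x, ∃ n,
      T^[n] x' ∈ stableSet T y ∧ v = Hs (T^[n] x') y (iter Φ n x' (Hu x x' u))}
  have htop := Submodule.eq_top_of_finrank_eq (hrank.trans (A.finrank_eq y).symm)
  replace hspan := hspan.trans htop
  choose x' hx' n hn hfv using hf
  let e := finCongr hrank.symm
  have hfe : (fun i => Hs (T^[n (e i)] (x' (e i))) y
      (iter Φ (n (e i)) (x' (e i)) (Hu x (x' (e i)) u))) = f ∘ e :=
    funext fun i => (hfv (e i)).symm
  refine ⟨x' ∘ e, n ∘ e, fun i => hx' _, fun i => hn _, ?_, ?_⟩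
  · exact hfe ▸ hli.comp e e.injective
  · refine Eq.trans ?_ hspan
    rw [← e.surjective.range_comp f, ← hfe]
    rfl
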